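/- Let $n,p,k\in\mathbb R$ with $n\neq 1$, $p\neq 0$, $p\neq -2$, $k\neq 0$, and consider the radial Schr\"odinger equation for a complex function $u(t,r)$, $r>0$, $$E:=i u_t-u_{rr}-(n-1)r^{-1}u_r-k|u|^p u=0,$$ with the radial Lagrangian $$L=\Big(\tfrac12 i\bar u u_t-\tfrac12 i\bar u_t u+|u_r|^2-\tfrac{2}{p+2}k|u|^{p+2}\Big)r^{n-1}.$$ Let $D$ be a non-empty connected open set of points $(t,r,u)\in\mathbb R\times(0,\infty)\times(\mathbb C\setminus\{0\})$. For a generator $\mathrm X=\tau\,\partial_t+\rho\,\partial_r+\eta\,\partial_u+\bar\eta\,\partial_{\bar u}$ on $D$ with smooth coefficients $\tau,\rho$ (real) and $\eta$ (complex) depending on $(t,r,u,\bar u)$, put $P=\eta-\tau u_t-\rho u_r$ and $\hat{\mathrm X}=P\,\partial_u+\bar P\,\partial_{\bar u}$. $\mathrm X$ is a variational point symmetry if, identically on the jets over $D$, $\mathrm{pr}\hat{\mathrm X}\,L=D_tA+D_rB$ for some smooth functions $A,B$ of $t,r,u,\bar u$ and finitely many $t$- and $r$-derivatives of $u,\bar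 u$ (over $D$), where $D_t,D_r$ are the total derivatives. Let $$\mathrm X_{\rm phas}=iu\,\partial_u-i\bar u\,\partial_{\bar u},\qquad \mathrm X_{\rm trans}=\partial_t,\qquad \mathrm X_{\rm scal}=2t\,\partial_t+r\,\partial_r-\tfrac2p u\,\partial_u-\tfrac2p\bar u\,\partial_{\bar u},$$ $$\mathrm X_{\rm inver}=t^2\partial_t+tr\,\partial_r-\big(\tfrac{2t}{p}+\tfrac{i r^2}{4}\big)u\,\partial_u-\big(\tfrac{2t}{p}-\tfrac{i r^2}{4}\big)\bar u\,\partial_{\bar u}.$$ (a) If $p\neq 4/n$ (which includes the case $n=0$), the variational point symmetries on $D$ are exactly the real linear combinations of $\mathrm X_{\rm phas}$ and $\mathrm X_{\rm trans}$. (b) If $p=4/n$, they are exactly the real linear combinations of $\mathrm X_{\rm phas},\mathrm X_{\rm trans},\mathrm X_{\rm scal},\mathrm X_{\rm inver}$. (c) For every variational point symmetry $\mathrm X$ on $D$, the functions $$T_{\mathrm X}=-\tau L+r^{n-1}\mathrm{Re}(iu\bar P),\qquad \Phi_{\mathrm X}=-\rho L-2r^{n-1}\mathrm{Re}(\bar P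 u_r)$$ satisfy, identically on the jets over $D$, the multiplier equation $2r^{n-1}\mathrm{Re}(E\bar P)=D_tT_{\mathrm X}+D_r\Phi_{\mathrm X}$, and hence the conservation law $D_tT_{\mathrm X}+D_r\Phi_{\mathrm X}=0$ on all formal solutions of $E=0$. (d) Up to the overall sign, $(T,\Phi)=-(T_{\mathrm X},\Phi_{\mathrm X})$, the generators yield the following conservation laws $D_tT+D_r\Phi=0$, valid on all formal solutions with $r>0$, $u\neq 0$: 1. (charge, from $\mathrm X_{\rm phas}$) $T=-r^{n-1}|u|^2$, $\ \Phi=i r^{n-1}(u\bar u_r-\bar u u_r)$. 2. (energy, from $\mathrm X_{\rm trans}$) $T=r^{n-1}\big(|u_r|^2-\tfrac{2}{p+2}k|u|^{2+p}\big)$, $\ \Phi=-r^{n-1}(u_t\bar u_r+\bar u_tu_r)$. 3. (dilation energy, from $\mathrm X_{\rm scal}$, $p=4/n$) $T=2tr^{n-1}\big(|u_r|^2-\tfrac{2}{p+2}k|u|^{2+p}\big)+\tfrac12 i r^n(u\bar u_r-\bar uu_r)$, $\ \Phi=-r^n\big(|u_r|^2+\tfrac{2}{p+2}k|u|^{2+p}\big)+\tfrac12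 i r^n(\bar uu_t-u\bar u_t)-\tfrac2p r^{n-1}(u\bar u_r+\bar uu_r)-2tr^{n-1}(u_t\bar u_r+\bar u_tu_r)$. 4. (pseudo-conformal energy, from $\mathrm X_{\rm inver}$, $p=4/n$) $T=t^2r^{n-1}\big(|u_r|^2-\tfrac{2}{p+2}k|u|^{2+p}\big)+\tfrac12 i t r^n(u\bar u_r-\bar uu_r)+\tfrac14 r^{n+1}|u|^2$, $\ \Phi=-\tfrac2p tr^{n-1}(u\bar u_r+\bar uu_r)-t^2r^{n-1}(u_t\bar u_r+\bar u_tu_r)-tr^n\big(|u_r|^2+\tfrac{2}{p+2}k|u|^{2+p}\big)+\tfrac12 i t r^n(\bar uu_t-u\bar u_t)+\tfrac14 i r^{n+1}(\bar uu_r-u\bar u_r)$. -/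

import Mathlib

namespace RadialNLS

section

open Complex
open scoped ContDiff ComplexConjugate

/-- The space of the variables `(t, r, u)`; a complex `u` stands for the pair `(u, ū)`. -/
abbrev Base : Type := ℝ × ℝ × ℂ

/-- Index set of the jet variables of order at most `N`: the pair `(i, j)` stands for
`∂ⁱ⁺ʲ u / ∂tⁱ ∂rʲ`. -/
abbrev JetIndex (N : ℕ) : Type := {q : ℕ × ℕ // q.1 + q.2 ≤ N}

instance instFintypeJetIndex (N : ℕ) : Fintype (JetIndex N) :=
  Fintype.subtype
    ((Finset.range (N + 1) ×ˢ Finset.range (N + 1)).filter (fun q => q.1 + q.2 ≤ N))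
    (by
      intro q
      simp only [Finset.mem_filter, Finset.mem_product, Finset.mem_range]
      omega)

/-- The jet space of order `N`: points `(t, r, (u_{ij})_{i+j ≤ N})`. -/
abbrev Jet (N : ℕ) : Type := ℝ × ℝ × (JetIndex N → ℂ)

/-- The jet coordinate `∂ⁱ⁺ʲ u / ∂tⁱ ∂rʲ`. -/
def coord {N : ℕ} (z : Jet N) (i j : ℕ) (h : i + j ≤ N) : ℂ := z.2.2 ⟨(i, j), h⟩

/-- Projection of a jet to its lower order part. -/
def trunc {M N : ℕ} (h : M ≤ N) (z : Jet N) : Jet M :=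
  (z.1, z.2.1, fun q => z.2.2 ⟨q.1, q.2.trans h⟩)

/-- Projection of a jet to `(t, r, u)`. -/
def base {N : ℕ} (z : Jet N) : Base := (z.1, z.2.1, coord z 0 0 (Nat.zero_le N))

section TotalDerivatives

variable {N : ℕ} {E : Type*} [NormedAddCommGroup E] [NormedSpace ℝ E]

/-- Total `t`-derivative
`D_t F = ∂F/∂t + ∑ (u_{i+1,j} ∂F/∂u_{ij} + ū_{i+1,j} ∂F/∂ū_{ij})`, written as the real
derivative of `F` in the direction `(1, 0, (u_{i+1,j})_{ij})`. -/
noncomputable def totalT (F : Jet N → E) (z : Jet (N + 1)) : E :=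
  fderiv ℝ F (trunc (Nat.le_succ N) z)
    (1, 0, fun q => coord z (q.1.1 + 1) q.1.2 (by have := q.2; omega))

/-- Total `r`-derivative, in the same way. -/
noncomputable def totalR (F : Jet N → E) (z : Jet (N + 1)) : E :=
  fderiv ℝ F (trunc (Nat.le_succ N) z)
    (0, 1, fun q => coord z q.1.1 (q.1.2 + 1) (by have := q.2; omega))

end TotalDerivatives

/-- The radial Lagrangian
`L = (½ i ū u_t - ½ i ū_t u + ū_r u_r - (2/(p+2)) k |u|^(p+2)) r^(n-1)`. -/
noncomputable def lagrangian (n p k : ℝ) (z : Jet 1) : ℝ :=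
  let r := z.2.1
  let u := coord z 0 0 (by norm_num)
  let ut := coord z 1 0 (by norm_num)
  let ur := coord z 0 1 (by norm_num)
  ((1 / 2 * I * conj u * ut - 1 / 2 * I * conj ut * u).re + ‖ur‖ ^ 2
    - 2 / (p + 2) * k * ‖u‖ ^ (p + 2)) * r ^ (n - 1)

/-- The radial Schrödinger expression `i u_t - u_rr - (n-1) r⁻¹ u_r - k |u|^p u`; the equation
says that it vanishes. -/
noncomputable def residual (n p k : ℝ) (z : Jet 2) : ℂ :=
  let r := z.2.1
  let u := coord z 0 0 (by norm_num)
  let ut := coord z 1 0 (by norm_num)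
  let ur := coord z 0 1 (by norm_num)
  let urr := coord z 0 2 (by norm_num)
  I * ut - urr - ((n - 1) * r⁻¹ : ℝ) * ur - (k * ‖u‖ ^ p : ℝ) * u

/-- The characteristic `P = η - τ u_t - ρ u_r` of the generator
`X = τ ∂/∂t + ρ ∂/∂r + η ∂/∂u + η̄ ∂/∂ū`, given as the map `X = (τ, ρ, η)`. -/
noncomputable def characteristic (X : Base → Base) (z : Jet 1) : ℂ :=
  (X (base z)).2.2 - ((X (base z)).1 : ℂ) * coord z 1 0 (by norm_num)
    - ((X (base z)).2.1 : ℂ) * coord z 0 1 (by norm_num)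

/-- `pr X̂ F` for a differential function `F` of first order, where `X̂ = P ∂/∂u + P̄ ∂/∂ū` is the
characteristic form of `X`: the derivative of `F` in the direction in which `u`, `u_t`, `u_r`
change by `P`, `D_t P`, `D_r P` while `t` and `r` are fixed. -/
noncomputable def prolongApply (X : Base → Base) (F : Jet 1 → ℝ) (z : Jet 2) : ℝ :=
  fderiv ℝ F (trunc one_le_two z)
    (0, 0, fun q =>
      if q.1 = (0, 0) then characteristic X (trunc one_le_two z)
      else if q.1 = (1, 0) then totalT (characteristic X) z
      else totalR (characteristic X) z)

/-- `X` is (the generator of) a variational point symmetry over the domain `D`: its coefficients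
are smooth on `D`, and `pr X̂ L = D_t A + D_r B` for some smooth functions `A`, `B` of
`t`, `r`, `u`, `ū` and finitely many derivatives of `u`, `ū`. -/
def IsVariational (n p k : ℝ) (D : Set Base) (X : Base → Base) : Prop :=
  ContDiffOn ℝ ∞ X D ∧
  ∃ (N : ℕ) (A B : Jet (N + 1) → ℝ),
    ContDiffOn ℝ ∞ A {z | base z ∈ D} ∧
    ContDiffOn ℝ ∞ B {z | base z ∈ D} ∧
    ∀ z : Jet (N + 2), base z ∈ D →
      prolongApply X (lagrangian n p k) (trunc (Nat.le_add_left 2 N) z)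
        = totalT A z + totalR B z

/-- Phase rotation `i u ∂/∂u - i ū ∂/∂ū`. -/
noncomputable def Xphas : Base → Base := fun x => (0, 0, I * x.2.2)

/-- Time translation `∂/∂t`. -/
noncomputable def Xtrans : Base → Base := fun _ => (1, 0, 0)

/-- Scaling `2t ∂/∂t + r ∂/∂r - (2/p) u ∂/∂u - (2/p) ū ∂/∂ū`. -/
noncomputable def Xscal (p : ℝ) : Base → Base :=
  fun x => (2 * x.1, x.2.1, -(2 / p : ℝ) * x.2.2)

/-- Inversion
`t² ∂/∂t + t r ∂/∂r - (2t/p + i r²/4) u ∂/∂u - (2t/p - i r²/4) ū ∂/∂ū`. -/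
noncomputable def Xinver (p : ℝ) : Base → Base :=
  fun x => (x.1 ^ 2, x.1 * x.2.1,
    -((2 * x.1 / p : ℝ) + I * (x.2.1 ^ 2 / 4 : ℝ)) * x.2.2)

/-- The Noether density `T = -τ L + r^(n-1) Re (i u P̄)` of a generator `X`. -/
noncomputable def noetherDensity (n p k : ℝ) (X : Base → Base) (z : Jet 1) : ℝ :=
  -(X (base z)).1 * lagrangian n p k z
    + z.2.1 ^ (n - 1) * (I * coord z 0 0 (by norm_num) * conj (characteristic X z)).re

/-- The Noether flux `-ρ L - 2 r^(n-1) Re (P̄ u_r)` of a generator `X`. -/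
noncomputable def noetherFlux (n p k : ℝ) (X : Base → Base) (z : Jet 1) : ℝ :=
  -(X (base z)).2.1 * lagrangian n p k z
    - 2 * z.2.1 ^ (n - 1) * (conj (characteristic X z) * coord z 0 1 (by norm_num)).re

/-- `D_t T + D_r Φ = 0` holds on all formal solutions of the radial Schrödinger equation
(`D_t T + D_r Φ` involves derivatives of `u` of order at most two only). -/
def IsConservationLaw (n p k : ℝ) (T Φ : Jet 1 → ℂ) : Prop :=
  ∀ z : Jet 2, 0 < (base z).2.1 → (base z).2.2 ≠ 0 → residual n p k z = 0 →
    totalT T z + totalR Φ z = 0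

/-- `T`, `Φ` are, up to the overall sign, the Noether density and flux of the generator `X`, and
form a conservation law of the radial Schrödinger equation. -/
def YieldsConservationLaw (n p k : ℝ) (X : Base → Base) (T Φ : Jet 1 → ℂ) : Prop :=
  (∀ z : Jet 1, 0 < (base z).2.1 → (base z).2.2 ≠ 0 →
    T z = -(noetherDensity n p k X z : ℂ) ∧ Φ z = -(noetherFlux n p k X z : ℂ)) ∧
  IsConservationLaw n p k T Φ

/-- `T = -r^(n-1) |u|²`. -/
noncomputable def chargeDensity (n : ℝ) (z : Jet 1) : ℂ :=
  let r := z.2.1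
  let u := coord z 0 0 (by norm_num);
  -(r ^ (n - 1) * ‖u‖ ^ 2 : ℝ)

/-- `Φ = i r^(n-1) (u ū_r - ū u_r)`. -/
noncomputable def chargeFlux (n : ℝ) (z : Jet 1) : ℂ :=
  let r := z.2.1
  let u := coord z 0 0 (by norm_num)
  let ur := coord z 0 1 (by norm_num)
  I * (r ^ (n - 1) : ℝ) * (u * conj ur - conj u * ur)

/-- `T = r^(n-1) (|u_r|² - (2/(p+2)) k |u|^(2+p))`. -/
noncomputable def energyDensity (n p k : ℝ) (z : Jet 1) : ℂ :=
  let r := z.2.1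
  let u := coord z 0 0 (by norm_num)
  let ur := coord z 0 1 (by norm_num)
  (r ^ (n - 1) * (‖ur‖ ^ 2 - 2 / (p + 2) * k * ‖u‖ ^ (2 + p)) : ℝ)

/-- `Φ = -r^(n-1) (u_t ū_r + ū_t u_r)`. -/
noncomputable def energyFlux (n : ℝ) (z : Jet 1) : ℂ :=
  let r := z.2.1
  let ut := coord z 1 0 (by norm_num)
  let ur := coord z 0 1 (by norm_num);
  -(r ^ (n - 1) : ℝ) * (ut * conj ur + conj ut * ur)

/-- `T = 2t r^(n-1) (|u_r|² - (2/(p+2)) k |u|^(2+p)) + ½ i r^n (u ū_r - ū u_r)`. -/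
noncomputable def dilationDensity (n p k : ℝ) (z : Jet 1) : ℂ :=
  let t := z.1
  let r := z.2.1
  let u := coord z 0 0 (by norm_num)
  let ur := coord z 0 1 (by norm_num)
  (2 * t * r ^ (n - 1) * (‖ur‖ ^ 2 - 2 / (p + 2) * k * ‖u‖ ^ (2 + p)) : ℝ)
    + 1 / 2 * I * (r ^ n : ℝ) * (u * conj ur - conj u * ur)

/-- `Φ = -r^n (|u_r|² + (2/(p+2)) k |u|^(2+p)) + ½ i r^n (ū u_t - u ū_t)
- (2/p) r^(n-1) (u ū_r + ū u_r) - 2t r^(n-1) (u_t ū_r + ū_t u_r)`. -/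
noncomputable def dilationFlux (n p k : ℝ) (z : Jet 1) : ℂ :=
  let t := z.1
  let r := z.2.1
  let u := coord z 0 0 (by norm_num)
  let ut := coord z 1 0 (by norm_num)
  let ur := coord z 0 1 (by norm_num);
  -(r ^ n * (‖ur‖ ^ 2 + 2 / (p + 2) * k * ‖u‖ ^ (2 + p)) : ℝ)
    + 1 / 2 * I * (r ^ n : ℝ) * (conj u * ut - u * conj ut)
    - (2 / p * r ^ (n - 1) : ℝ) * (u * conj ur + conj u * ur)
    - (2 * t * r ^ (n - 1) : ℝ) * (ut * conj ur + conj ut * ur)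

/-- `T = t² r^(n-1) (|u_r|² - (2/(p+2)) k |u|^(2+p)) + ½ i t r^n (u ū_r - ū u_r)
+ ¼ r^(n+1) |u|²`. -/
noncomputable def pseudoConformalDensity (n p k : ℝ) (z : Jet 1) : ℂ :=
  let t := z.1
  let r := z.2.1
  let u := coord z 0 0 (by norm_num)
  let ur := coord z 0 1 (by norm_num)
  (t ^ 2 * r ^ (n - 1) * (‖ur‖ ^ 2 - 2 / (p + 2) * k * ‖u‖ ^ (2 + p)) : ℝ)
    + 1 / 2 * I * (t * r ^ n : ℝ) * (u * conj ur - conj u * ur)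
    + (1 / 4 * r ^ (n + 1) * ‖u‖ ^ 2 : ℝ)

/-- `Φ = -(2/p) t r^(n-1) (u ū_r + ū u_r) - t² r^(n-1) (u_t ū_r + ū_t u_r)
- t r^n (|u_r|² + (2/(p+2)) k |u|^(2+p)) + ½ i t r^n (ū u_t - u ū_t)
+ ¼ i r^(n+1) (ū u_r - u ū_r)`. -/
noncomputable def pseudoConformalFlux (n p k : ℝ) (z : Jet 1) : ℂ :=
  let t := z.1
  let r := z.2.1
  let u := coord z 0 0 (by norm_num)
  let ut := coord z 1 0 (by norm_num)
  let ur := coord z 0 1 (by norm_num);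
  -(2 / p * t * r ^ (n - 1) : ℝ) * (u * conj ur + conj u * ur)
    - (t ^ 2 * r ^ (n - 1) : ℝ) * (ut * conj ur + conj ut * ur)
    - (t * r ^ n * (‖ur‖ ^ 2 + 2 / (p + 2) * k * ‖u‖ ^ (2 + p)) : ℝ)
    + 1 / 2 * I * (t * r ^ n : ℝ) * (conj u * ut - u * conj ut)
    + 1 / 4 * I * (r ^ (n + 1) : ℝ) * (conj u * ur - u * conj ur)

end

end RadialNLS

/-!
For a generator `X = (τ, ρ, η)` the variation of the Lagrangian along the characteristic form of
`X` differs by a total divergence from the Lie derivative of the Lagrangian form `L dt ∧ dr`,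
`lieLagrangian`, which is a polynomial in `u_t`, `u_r` with coefficients that depend on
`(t, r, u)` (`prolongApply_eq`). So `X` is variational exactly if `lieLagrangian` is a total
divergence over `D`.

A total divergence satisfies the Euler–Lagrange equations identically
(`eulerLagrange_of_divergence`). As the order of `A` and `B` is arbitrary, this is proved without
the algebra of Euler operators: the linearisation of a total divergence along a compactly supported
variation of a quadratic polynomial `u(t, r)` integrates to zero, and the fundamental lemma of the
calculus of variations applies. A first order null Lagrangian is affine along rank one directions
of the gradient (`IsNullLagrangian.rank_one`), which removes the cubic and quadratic terms and shows
that `τ = τ(t)`, `ρ = ρ(t, r)` and that `η` is holomorphic in `u` with `Re η_u` determined by `τ`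
and `ρ` (`IsNullLagrangian.firstDetermining`). What remains is affine in the gradient, and
`IsNullLagrangian.of_affine` yields the remaining equations (`second_determining`). They are
algebraic in `u`; comparing degrees of homogeneity, where `p ≠ 0` and `k ≠ 0` enter, gives
`η = α(t, r) u` and equations for `τ`, `ρ`, `α` alone (`determining`). These give
`(n - 1) ρ = (2 / p - 1 / 2) r τ_t` and `2 ρ_r = τ_t`, hence `(n p - 4) τ_t = 0`. If `n p ≠ 4`, then
`τ` is constant and `ρ = 0`, because `n ≠ 1`; if `n p = 4`, then `τ` is quadratic in `t` and
everything else follows from it up to a constant phase. Since `D` is connected, the constants of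
integration are global.

Conversely, `lieLagrangian` vanishes for each of these generators (`lieLagrangian_combination`).
Then the multiplier equation is Noether's identity (`noether_identity`), which is integration by
parts in the first variation, and the four conservation laws are its explicit forms.
-/

namespace RadialNLS

open Complex MeasureTheory Set Filter Topology
open scoped ContDiff ComplexConjugate

/-! ### Functions of `(t, r)` and their jets -/

/-- Partial derivative in `t` of a function of `(t, r)`. -/
noncomputable def partialT {E : Type*} [NormedAddCommGroup E] [NormedSpace ℝ E]
    (f : ℝ × ℝ → E) (y : ℝ × ℝ) : E := fderiv ℝ f y (1, 0)

/-- Partial derivative in `r` of a function of `(t, r)`. -/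
noncomputable def partialR {E : Type*} [NormedAddCommGroup E] [NormedSpace ℝ E]
    (f : ℝ × ℝ → E) (y : ℝ × ℝ) : E := fderiv ℝ f y (0, 1)

section JetsOfFunctions

variable {E : Type*} [NormedAddCommGroup E] [NormedSpace ℝ E]

lemma contDiff_partialT {f : ℝ × ℝ → E} (hf : ContDiff ℝ ∞ f) : ContDiff ℝ ∞ (partialT f) :=
  (hf.fderiv_right (m := ∞) (by simp)).clm_apply contDiff_const

lemma contDiff_partialR {f : ℝ × ℝ → E} (hf : ContDiff ℝ ∞ f) : ContDiff ℝ ∞ (partialR f) :=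
  (hf.fderiv_right (m := ∞) (by simp)).clm_apply contDiff_const

lemma two_le_infty : (2 : WithTop ℕ∞) ≤ ∞ :=
  ENat.LEInfty.out

/-- Symmetry of the second derivative in the form in which partial derivatives are iterated. -/
lemma fderiv_fderiv_comm {F : Type*} [NormedAddCommGroup F] [NormedSpace ℝ F] {f : F → E} {x : F}
    (hf : ContDiffAt ℝ ∞ f x) (a b : F) :
    fderiv ℝ (fun y => fderiv ℝ f y a) x b = fderiv ℝ (fun y => fderiv ℝ f y b) x a := by
  have hd : DifferentiableAt ℝ (fderiv ℝ f) x :=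
    (hf.fderiv_right (m := ∞) (by simp)).differentiableAt (by simp)
  have hs : IsSymmSndFDerivAt ℝ f x := hf.isSymmSndFDerivAt (by simpa using two_le_infty)
  rw [fderiv_clm_apply hd (differentiableAt_const _),
    fderiv_clm_apply hd (differentiableAt_const _)]
  simpa using hs b a

lemma partialR_partialT {f : ℝ × ℝ → E} (hf : ContDiff ℝ ∞ f) :
    partialR (partialT f) = partialT (partialR f) :=
  funext fun _ => fderiv_fderiv_comm hf.contDiffAt _ _

lemma contDiff_partialT_iterate {f : ℝ × ℝ → E} (hf : ContDiff ℝ ∞ f) (i : ℕ) :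
    ContDiff ℝ ∞ (partialT^[i] f) := by
  induction i with
  | zero => exact hf
  | succ i ih => rw [Function.iterate_succ_apply']; exact contDiff_partialT ih

lemma contDiff_partialR_iterate {f : ℝ × ℝ → E} (hf : ContDiff ℝ ∞ f) (i : ℕ) :
    ContDiff ℝ ∞ (partialR^[i] f) := by
  induction i with
  | zero => exact hf
  | succ i ih => rw [Function.iterate_succ_apply']; exact contDiff_partialR ih

lemma partialR_partialT_iterate {f : ℝ × ℝ → E} (hf : ContDiff ℝ ∞ f) (i : ℕ) :
    partialR (partialT^[i] f) = partialT^[i] (partialR f) := by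
  induction i with
  | zero => rfl
  | succ i ih =>
    rw [Function.iterate_succ_apply', Function.iterate_succ_apply', ← ih,
      partialR_partialT (contDiff_partialT_iterate hf i)]

/-- The function `∂ⁱ⁺ʲ u / ∂tⁱ ∂rʲ`. -/
noncomputable def mixedPartial (u : ℝ × ℝ → ℂ) (q : ℕ × ℕ) : ℝ × ℝ → ℂ :=
  partialT^[q.1] (partialR^[q.2] u)

lemma contDiff_mixedPartial {u : ℝ × ℝ → ℂ} (hu : ContDiff ℝ ∞ u) (q : ℕ × ℕ) :
    ContDiff ℝ ∞ (mixedPartial u q) :=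
  contDiff_partialT_iterate (contDiff_partialR_iterate hu _) _

lemma partialT_mixedPartial (u : ℝ × ℝ → ℂ) (i j : ℕ) :
    partialT (mixedPartial u (i, j)) = mixedPartial u (i + 1, j) := by
  simp only [mixedPartial, Function.iterate_succ_apply']

lemma partialR_mixedPartial {u : ℝ × ℝ → ℂ} (hu : ContDiff ℝ ∞ u) (i j : ℕ) :
    partialR (mixedPartial u (i, j)) = mixedPartial u (i, j + 1) := by
  simp only [mixedPartial, Function.iterate_succ_apply',
    partialR_partialT_iterate (contDiff_partialR_iterate hu _)]

/-- The derivatives of order at most `M` of a function `u`, as a jet variable. -/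
noncomputable def jetVars (M : ℕ) (u : ℝ × ℝ → ℂ) (y : ℝ × ℝ) : JetIndex M → ℂ :=
  fun q => mixedPartial u q.1 y

/-- The jet of order `M` of a function `u` of `(t, r)`. -/
noncomputable def jetOf (M : ℕ) (u : ℝ × ℝ → ℂ) (y : ℝ × ℝ) : Jet M :=
  (y.1, y.2, jetVars M u y)

lemma contDiff_jetVars (M : ℕ) {u : ℝ × ℝ → ℂ} (hu : ContDiff ℝ ∞ u) :
    ContDiff ℝ ∞ (jetVars M u) :=
  contDiff_pi.2 fun q => contDiff_mixedPartial hu q.1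

lemma contDiff_jetOf (M : ℕ) {u : ℝ × ℝ → ℂ} (hu : ContDiff ℝ ∞ u) :
    ContDiff ℝ ∞ (jetOf M u) :=
  contDiff_fst.prodMk (contDiff_snd.prodMk (contDiff_jetVars M hu))

/-- The shift `(u_{ij}) ↦ (u_{i+1,j})` of the jet variables. -/
def shiftT (M : ℕ) (z : Jet (M + 1)) : JetIndex M → ℂ :=
  fun q => coord z (q.1.1 + 1) q.1.2 (by have := q.2; omega)

/-- The shift `(u_{ij}) ↦ (u_{i,j+1})` of the jet variables. -/
def shiftR (M : ℕ) (z : Jet (M + 1)) : JetIndex M → ℂ :=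
  fun q => coord z q.1.1 (q.1.2 + 1) (by have := q.2; omega)

lemma fderiv_jetVars_apply (M : ℕ) {u : ℝ × ℝ → ℂ} (hu : ContDiff ℝ ∞ u) (y e : ℝ × ℝ)
    (q : JetIndex M) : fderiv ℝ (jetVars M u) y e q = fderiv ℝ (mixedPartial u q.1) y e := by
  have h := ((contDiff_jetVars M hu).contDiffAt (x := y)).differentiableAt (by simp)
  have h1 : HasFDerivAt (mixedPartial u q.1) _ y := (hasFDerivAt_pi'.1 h.hasFDerivAt) q
  rw [h1.fderiv]; rfl

lemma fderiv_jetVars_T (M : ℕ) {u : ℝ × ℝ → ℂ} (hu : ContDiff ℝ ∞ u) (y : ℝ × ℝ) :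
    fderiv ℝ (jetVars M u) y (1, 0) = shiftT M (jetOf (M + 1) u y) := by
  ext q
  rw [fderiv_jetVars_apply M hu]
  exact congrFun (partialT_mixedPartial u q.1.1 q.1.2) y

lemma fderiv_jetVars_R (M : ℕ) {u : ℝ × ℝ → ℂ} (hu : ContDiff ℝ ∞ u) (y : ℝ × ℝ) :
    fderiv ℝ (jetVars M u) y (0, 1) = shiftR M (jetOf (M + 1) u y) := by
  ext q
  rw [fderiv_jetVars_apply M hu]
  exact congrFun (partialR_mixedPartial hu q.1.1 q.1.2) y

lemma fderiv_jetOf (M : ℕ) {u : ℝ × ℝ → ℂ} (hu : ContDiff ℝ ∞ u) (y e : ℝ × ℝ) :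
    fderiv ℝ (jetOf M u) y e = (e.1, e.2, fderiv ℝ (jetVars M u) y e) := by
  have h1 : HasFDerivAt (jetVars M u) (fderiv ℝ (jetVars M u) y) y :=
    ((contDiff_jetVars M hu).contDiffAt.differentiableAt (by simp)).hasFDerivAt
  have h := (hasFDerivAt_fst (𝕜 := ℝ) (p := y)).prodMk
    ((hasFDerivAt_snd (𝕜 := ℝ) (p := y)).prodMk h1)
  have h2 : HasFDerivAt (jetOf M u) _ y := h
  rw [h2.fderiv]; rfl

/-- The linearisation at `u` in the direction `φ` of the differential function `A`, evaluated on
functions of `(t, r)`. -/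
noncomputable def linearization {M : ℕ} (A : Jet M → E) (u φ : ℝ × ℝ → ℂ) (y : ℝ × ℝ) : E :=
  fderiv ℝ A (jetOf M u y) (0, 0, jetVars M φ y)

/-- Linearisation commutes with the total derivative in a direction `e`; `S` is the shift of jet
variables that belongs to `e`. -/
lemma fderiv_totalDeriv_jetOf {M : ℕ} {A : Jet M → E} {u φ : ℝ × ℝ → ℂ} (hu : ContDiff ℝ ∞ u)
    (hφ : ContDiff ℝ ∞ φ) {y : ℝ × ℝ} (hA : ContDiffAt ℝ ∞ A (jetOf M u y)) (e : ℝ × ℝ)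
    (S : Jet (M + 1) →L[ℝ] JetIndex M → ℂ)
    (hSu : fderiv ℝ (jetVars M u) y e = S (jetOf (M + 1) u y))
    (hSφ : fderiv ℝ (jetVars M φ) y e = S (0, 0, jetVars (M + 1) φ y)) :
    DifferentiableAt ℝ (fun z : Jet (M + 1) => fderiv ℝ A (trunc (Nat.le_succ M) z) (e.1, e.2, S z))
        (jetOf (M + 1) u y) ∧
    fderiv ℝ (fun z : Jet (M + 1) => fderiv ℝ A (trunc (Nat.le_succ M) z) (e.1, e.2, S z))
        (jetOf (M + 1) u y) (0, 0, jetVars (M + 1) φ y)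
      = fderiv ℝ (linearization A u φ) y e := by
  have hd : HasFDerivAt (fderiv ℝ A) (fderiv ℝ (fderiv ℝ A) (jetOf M u y)) (jetOf M u y) :=
    ((hA.fderiv_right (m := ∞) (by simp)).differentiableAt (by simp)).hasFDerivAt
  have hs : IsSymmSndFDerivAt ℝ A (jetOf M u y) :=
    hA.isSymmSndFDerivAt (by simpa using two_le_infty)
  let T : Jet (M + 1) →L[ℝ] Jet M :=
    (ContinuousLinearMap.fst ℝ _ _).prod (((ContinuousLinearMap.fst ℝ _ _).comp
      (ContinuousLinearMap.snd ℝ _ _)).prod (ContinuousLinearMap.pi fun q : JetIndex M =>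
        (ContinuousLinearMap.proj (⟨q.1, q.2.trans (Nat.le_succ M)⟩ : JetIndex (M + 1))).comp
          ((ContinuousLinearMap.snd ℝ _ _).comp (ContinuousLinearMap.snd ℝ _ _))))
  have hT : ∀ z, T z = trunc (Nat.le_succ M) z := fun z => rfl
  have hTu : T (jetOf (M + 1) u y) = jetOf M u y := rfl
  have h1 : HasFDerivAt (fun z : Jet (M + 1) => fderiv ℝ A (trunc (Nat.le_succ M) z)) _
      (jetOf (M + 1) u y) := HasFDerivAt.comp (f := T) (jetOf (M + 1) u y) hd T.hasFDerivAt
  have h2 : HasFDerivAt (fun z : Jet (M + 1) => (e.1, e.2, S z)) _ (jetOf (M + 1) u y) :=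
    (hasFDerivAt_const e.1 _).prodMk ((hasFDerivAt_const e.2 _).prodMk S.hasFDerivAt)
  have h3 := h1.clm_apply h2
  have h4 : HasFDerivAt (fun y => fderiv ℝ A (jetOf M u y)) _ y :=
    HasFDerivAt.comp y hd ((contDiff_jetOf M hu).contDiffAt.differentiableAt (by simp)).hasFDerivAt
  have h5 : HasFDerivAt (fun y => ((0 : ℝ), (0 : ℝ), jetVars M φ y)) _ y :=
    (hasFDerivAt_const (0 : ℝ) _).prodMk ((hasFDerivAt_const (0 : ℝ) _).prodMk
      ((contDiff_jetVars M hφ).contDiffAt.differentiableAt (by simp)).hasFDerivAt)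
  have h6 : HasFDerivAt (linearization A u φ) _ y := h4.clm_apply h5
  refine ⟨h3.differentiableAt, ?_⟩
  rw [h3.fderiv, h6.fderiv]
  have hTφ : T (0, 0, jetVars (M + 1) φ y) = (0, 0, jetVars M φ y) := rfl
  have htr : trunc (Nat.le_succ M) (jetOf (M + 1) u y) = jetOf M u y := rfl
  simp only [add_apply, ContinuousLinearMap.comp_apply,
    ContinuousLinearMap.flip_apply, ContinuousLinearMap.prod_apply, hTφ, htr, fderiv_jetOf M hu,
    hSu, hSφ, zero_apply]
  rw [hs (0, 0, jetVars M φ y)]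

end JetsOfFunctions

/-! ### Total divergences and the Euler–Lagrange equations -/

lemma integrable_fderiv_apply {f : ℝ × ℝ → ℝ} (hf : ContDiff ℝ ∞ f) (hc : HasCompactSupport f)
    (e : ℝ × ℝ) : Integrable (fun y => fderiv ℝ f y e) :=
  ((hf.fderiv_right (m := ∞) (by simp)).clm_apply
    contDiff_const).continuous.integrable_of_hasCompactSupport (hc.fderiv_apply ℝ e)

lemma integral_fderiv_eq_zero {f : ℝ × ℝ → ℝ} (hf : ContDiff ℝ ∞ f) (hc : HasCompactSupport f)
    (e : ℝ × ℝ) : ∫ y, fderiv ℝ f y e = 0 := by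
  have hd : Differentiable ℝ f := hf.differentiable (by simp)
  have h := integral_mul_fderiv_eq_neg_fderiv_mul_of_integrable (μ := volume) (𝕜 := ℝ)
    (f := fun _ : ℝ × ℝ => (1 : ℝ)) (g := f) (v := e) (by simp)
    (by simpa using integrable_fderiv_apply hf hc e)
    (by simpa using hf.continuous.integrable_of_hasCompactSupport hc)
    (fun x _ => differentiableAt_const _) (fun x _ => hd x)
  simpa using h

lemma mixedPartial_eq_zero {φ : ℝ × ℝ → ℂ} {y : ℝ × ℝ} (hy : y ∉ tsupport φ) (q : ℕ × ℕ) :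
    mixedPartial φ q y = 0 := by
  have hT : ∀ f : ℝ × ℝ → ℂ, tsupport (partialT f) ⊆ tsupport f := fun f =>
    closure_minimal (fun x hx => by
      refine support_fderiv_subset ℝ (f := f) (fun h => hx ?_)
      simp [partialT, h]) (isClosed_tsupport f)
  have hR : ∀ f : ℝ × ℝ → ℂ, tsupport (partialR f) ⊆ tsupport f := fun f =>
    closure_minimal (fun x hx => by
      refine support_fderiv_subset ℝ (f := f) (fun h => hx ?_)
      simp [partialR, h]) (isClosed_tsupport f)
  have hRi : ∀ j, tsupport (partialR^[j] φ) ⊆ tsupport φ := fun j => by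
    induction j with
    | zero => exact subset_rfl
    | succ j ih => rw [Function.iterate_succ_apply']; exact (hR _).trans ih
  have hTi : ∀ i j, tsupport (partialT^[i] (partialR^[j] φ)) ⊆ tsupport φ := fun i j => by
    induction i with
    | zero => exact hRi j
    | succ i ih => rw [Function.iterate_succ_apply']; exact (hT _).trans ih
  exact image_eq_zero_of_notMem_tsupport fun h => hy (hTi _ _ h)

lemma jetVars_eq_zero (M : ℕ) {φ : ℝ × ℝ → ℂ} {y : ℝ × ℝ} (hy : y ∉ tsupport φ) :
    jetVars M φ y = 0 :=
  funext fun q => mixedPartial_eq_zero hy q.1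

lemma linearization_eq_zero {M : ℕ} (A : Jet M → ℝ) (u : ℝ × ℝ → ℂ) {φ : ℝ × ℝ → ℂ} {y : ℝ × ℝ}
    (hy : y ∉ tsupport φ) : linearization A u φ y = 0 := by
  rw [linearization, jetVars_eq_zero M hy]
  exact map_zero _

/-- The first order data `(t, r, u, u_t, u_r)` of a function. -/
noncomputable def firstJet (u : ℝ × ℝ → ℂ) (y : ℝ × ℝ) : Base × ℂ × ℂ :=
  ((y.1, y.2, u y), partialT u y, partialR u y)

lemma contDiff_firstJet {u : ℝ × ℝ → ℂ} (hu : ContDiff ℝ ∞ u) : ContDiff ℝ ∞ (firstJet u) :=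
  (contDiff_fst.prodMk (contDiff_snd.prodMk hu)).prodMk
    ((contDiff_partialT hu).prodMk (contDiff_partialR hu))

section Linearization

variable {M : ℕ} {A : Jet M → ℝ} {D : Set Base} {u φ : ℝ × ℝ → ℂ}

lemma isOpen_base_preimage (hD : IsOpen D) (M : ℕ) : IsOpen {z : Jet M | base z ∈ D} := by
  refine hD.preimage ?_
  unfold base coord
  fun_prop

lemma contDiff_linearization (hD : IsOpen D) (hA : ContDiffOn ℝ ∞ A {z | base z ∈ D})
    (hu : ContDiff ℝ ∞ u) (hφ : ContDiff ℝ ∞ φ)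
    (hs : tsupport φ ⊆ {y | (y.1, y.2, u y) ∈ D}) : ContDiff ℝ ∞ (linearization A u φ) := by
  rw [contDiff_iff_contDiffAt]
  intro y
  by_cases hy : y ∈ tsupport φ
  · have hAy : ContDiffAt ℝ ∞ A (jetOf M u y) :=
      hA.contDiffAt ((isOpen_base_preimage hD M).mem_nhds (hs hy))
    have h1 : ContDiffAt ℝ ∞ (fun y => fderiv ℝ A (jetOf M u y)) y :=
      ContDiffAt.comp y (hAy.fderiv_right (m := ∞) (by simp)) (contDiff_jetOf M hu).contDiffAt
    exact h1.clm_apply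
      (contDiffAt_const.prodMk (contDiffAt_const.prodMk (contDiff_jetVars M hφ).contDiffAt))
  · refine (contDiffAt_const (c := (0 : ℝ))).congr_of_eventuallyEq ?_
    filter_upwards [(isClosed_tsupport φ).isOpen_compl.mem_nhds hy] with x hx
    exact linearization_eq_zero A u hx

lemma hasCompactSupport_linearization (hc : HasCompactSupport φ) :
    HasCompactSupport (linearization A u φ) :=
  HasCompactSupport.intro hc.isCompact fun _ hy => linearization_eq_zero A u hy

end Linearization

/-- If a first order Lagrangian `G` is a total divergence over `D`, then its first variation in
a direction with compact support integrates to zero. -/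
lemma integral_firstVariation_eq_zero {D : Set Base} (hD : IsOpen D) {G : Base × ℂ × ℂ → ℝ}
    (hG : ContDiffOn ℝ ∞ G (D ×ˢ univ)) {N : ℕ} {A B : Jet (N + 1) → ℝ}
    (hA : ContDiffOn ℝ ∞ A {z | base z ∈ D}) (hB : ContDiffOn ℝ ∞ B {z | base z ∈ D})
    (h : ∀ z : Jet (N + 2), base z ∈ D →
      G (base z, coord z 1 0 (by omega), coord z 0 1 (by omega)) = totalT A z + totalR B z)
    {u φ : ℝ × ℝ → ℂ} (hu : ContDiff ℝ ∞ u) (hφ : ContDiff ℝ ∞ φ) (hc : HasCompactSupport φ)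
    (hs : tsupport φ ⊆ {y | (y.1, y.2, u y) ∈ D}) :
    ∫ y, fderiv ℝ G (firstJet u y) ((0, 0, φ y), partialT φ y, partialR φ y) = 0 := by
  -- On the support of `φ` linearise the divergence identity; elsewhere both sides vanish.
  have key : ∀ y, fderiv ℝ G (firstJet u y) ((0, 0, φ y), partialT φ y, partialR φ y)
      = fderiv ℝ (linearization A u φ) y (1, 0) + fderiv ℝ (linearization B u φ) y (0, 1) := by
    intro y
    by_cases hy : y ∈ tsupport φ
    · have hyD : base (jetOf (N + 2) u y) ∈ D := hs hy
      have hAy : ContDiffAt ℝ ∞ A (jetOf (N + 1) u y) :=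
        hA.contDiffAt ((isOpen_base_preimage hD (N + 1)).mem_nhds (hs hy))
      have hBy : ContDiffAt ℝ ∞ B (jetOf (N + 1) u y) :=
        hB.contDiffAt ((isOpen_base_preimage hD (N + 1)).mem_nhds (hs hy))
      let coordL : JetIndex (N + 2) → (Jet (N + 2) →L[ℝ] ℂ) := fun q =>
        (ContinuousLinearMap.proj q).comp
          ((ContinuousLinearMap.snd ℝ _ _).comp (ContinuousLinearMap.snd ℝ _ _))
      let P : Jet (N + 2) →L[ℝ] Base × ℂ × ℂ :=
        ((ContinuousLinearMap.fst ℝ _ _).prod (((ContinuousLinearMap.fst ℝ _ _).comp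
          (ContinuousLinearMap.snd ℝ _ _)).prod (coordL ⟨(0, 0), by simp⟩))).prod
          ((coordL ⟨(1, 0), by simp⟩).prod (coordL ⟨(0, 1), by simp⟩))
      let ST : Jet (N + 1 + 1) →L[ℝ] JetIndex (N + 1) → ℂ := ContinuousLinearMap.pi fun q =>
        coordL ⟨(q.1.1 + 1, q.1.2), by have := q.2; omega⟩
      let SR : Jet (N + 1 + 1) →L[ℝ] JetIndex (N + 1) → ℂ := ContinuousLinearMap.pi fun q =>
        coordL ⟨(q.1.1, q.1.2 + 1), by have := q.2; omega⟩
      have hT := fderiv_totalDeriv_jetOf hu hφ hAy (1, 0) ST (fderiv_jetVars_T _ hu y)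
        (fderiv_jetVars_T _ hφ y)
      have hR := fderiv_totalDeriv_jetOf hu hφ hBy (0, 1) SR (fderiv_jetVars_R _ hu y)
        (fderiv_jetVars_R _ hφ y)
      rw [← hT.2, ← hR.2, ← add_apply, ← fderiv_add hT.1 hR.1]
      have hGy : DifferentiableAt ℝ G (P (jetOf (N + 2) u y)) :=
        (hG.contDiffAt ((hD.prod isOpen_univ).mem_nhds ⟨hyD, trivial⟩)).differentiableAt (by simp)
      have hP : HasFDerivAt (fun z => G (P z)) _ (jetOf (N + 2) u y) :=
        HasFDerivAt.comp (f := P) _ hGy.hasFDerivAt P.hasFDerivAt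
      have he : (fun z => G (P z)) =ᶠ[𝓝 (jetOf (N + 2) u y)] fun z => totalT A z + totalR B z := by
        filter_upwards [(isOpen_base_preimage hD (N + 2)).mem_nhds hyD] with z hz
        exact h z hz
      have := congrArg (fun L => L (0, 0, jetVars (N + 2) φ y)) (hP.fderiv.symm.trans he.fderiv_eq)
      exact this
    · have h0 : φ y = 0 := image_eq_zero_of_notMem_tsupport hy
      have h1 : partialT φ y = 0 := mixedPartial_eq_zero hy (1, 0)
      have h2 : partialR φ y = 0 := mixedPartial_eq_zero hy (0, 1)
      have h3 : ∀ F : Jet (N + 1) → ℝ, fderiv ℝ (linearization F u φ) y = 0 := fun F => by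
        have : linearization F u φ =ᶠ[𝓝 y] fun _ => 0 := by
          filter_upwards [(isClosed_tsupport φ).isOpen_compl.mem_nhds hy] with x hx
          exact linearization_eq_zero F u hx
        rw [this.fderiv_eq]; simp
      simp [h0, h1, h2, h3, ← Prod.zero_eq_mk]
  have hAs := contDiff_linearization hD hA hu hφ hs
  have hBs := contDiff_linearization hD hB hu hφ hs
  simp_rw [key]
  rw [integral_add (integrable_fderiv_apply hAs (hasCompactSupport_linearization hc) _)
    (integrable_fderiv_apply hBs (hasCompactSupport_linearization hc) _),
    integral_fderiv_eq_zero hAs (hasCompactSupport_linearization hc),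
    integral_fderiv_eq_zero hBs (hasCompactSupport_linearization hc), add_zero]

lemma partialT_eq {E : Type*} [NormedAddCommGroup E] [NormedSpace ℝ E] {f : ℝ × ℝ → E}
    (hf : Differentiable ℝ f) {y : ℝ × ℝ} {f' : E}
    (h : HasDerivAt (fun s => f (s, y.2)) f' y.1) : partialT f y = f' := by
  have h1 : HasDerivAt (fun s : ℝ => (s, y.2)) ((1 : ℝ), (0 : ℝ)) y.1 :=
    (hasDerivAt_id _).prodMk (hasDerivAt_const _ _)
  exact (HasFDerivAt.comp_hasDerivAt (f := fun s : ℝ => (s, y.2)) y.1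
    (hf y).hasFDerivAt h1).unique h

lemma partialR_eq {E : Type*} [NormedAddCommGroup E] [NormedSpace ℝ E] {f : ℝ × ℝ → E}
    (hf : Differentiable ℝ f) {y : ℝ × ℝ} {f' : E}
    (h : HasDerivAt (fun s => f (y.1, s)) f' y.2) : partialR f y = f' := by
  have h1 : HasDerivAt (fun s : ℝ => (y.1, s)) ((0 : ℝ), (1 : ℝ)) y.2 :=
    (hasDerivAt_const _ _).prodMk (hasDerivAt_id _)
  exact (HasFDerivAt.comp_hasDerivAt (f := fun s : ℝ => (y.1, s)) y.2
    (hf y).hasFDerivAt h1).unique h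

/-- Every jet of order two is the jet of a quadratic polynomial. -/
lemma exists_function_of_jet (t₀ r₀ : ℝ) (u₀ v w vt vr wr : ℂ) :
    ∃ u : ℝ × ℝ → ℂ, ContDiff ℝ ∞ u ∧ firstJet u (t₀, r₀) = ((t₀, r₀, u₀), v, w) ∧
      fderiv ℝ (firstJet u) (t₀, r₀) (1, 0) = ((1, 0, v), vt, vr) ∧
      fderiv ℝ (firstJet u) (t₀, r₀) (0, 1) = ((0, 1, w), vr, wr) := by
  let u : ℝ × ℝ → ℂ := fun y => u₀ + (y.1 - t₀) • v + (y.2 - r₀) • w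
    + ((y.1 - t₀) ^ 2 / 2) • vt + ((y.1 - t₀) * (y.2 - r₀)) • vr + ((y.2 - r₀) ^ 2 / 2) • wr
  have hu : ContDiff ℝ ∞ u := by fun_prop
  have hT : partialT u = fun y => v + (y.1 - t₀) • vt + (y.2 - r₀) • vr := by
    funext y
    refine partialT_eq (hu.differentiable (by simp)) ?_
    have hs := (hasDerivAt_id y.1).sub_const t₀
    refine ((((((hasDerivAt_const y.1 u₀).add (hs.smul_const v)).add
      (hasDerivAt_const y.1 ((y.2 - r₀) • w))).add
      (((hs.pow 2).div_const 2).smul_const vt)).add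
      ((hs.mul_const (y.2 - r₀)).smul_const vr)).add
      (hasDerivAt_const y.1 (((y.2 - r₀) ^ 2 / 2) • wr))).congr_deriv ?_
    simp
  have hR : partialR u = fun y => w + (y.1 - t₀) • vr + (y.2 - r₀) • wr := by
    funext y
    refine partialR_eq (hu.differentiable (by simp)) ?_
    have hs := (hasDerivAt_id y.2).sub_const r₀
    refine ((((((hasDerivAt_const y.2 u₀).add
      (hasDerivAt_const y.2 ((y.1 - t₀) • v))).add (hs.smul_const w)).add
      (hasDerivAt_const y.2 (((y.1 - t₀) ^ 2 / 2) • vt))).add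
      ((hs.const_mul (y.1 - t₀)).smul_const vr)).add
      (((hs.pow 2).div_const 2).smul_const wr)).congr_deriv ?_
    simp
  have hJ : firstJet u = fun y => ((y.1, y.2, u y), v + (y.1 - t₀) • vt + (y.2 - r₀) • vr,
      w + (y.1 - t₀) • vr + (y.2 - r₀) • wr) := by
    funext y; simp only [firstJet, hT, hR]
  have hd : Differentiable ℝ (firstJet u) := (contDiff_firstJet hu).differentiable (by simp)
  refine ⟨u, hu, by rw [hJ]; simp [u], partialT_eq hd ?_, partialR_eq hd ?_⟩
  · rw [hJ]
    have hs := (hasDerivAt_id t₀).sub_const t₀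
    have h0 : HasDerivAt (fun s : ℝ => u (s, r₀)) v t₀ := by
      have := HasFDerivAt.comp_hasDerivAt (f := fun s : ℝ => (s, r₀)) t₀
        (hu.differentiable (by simp) (t₀, r₀)).hasFDerivAt
        ((hasDerivAt_id t₀).prodMk (hasDerivAt_const t₀ r₀))
      refine this.congr_deriv ?_
      have := congrFun hT (t₀, r₀)
      simpa [partialT] using this
    refine (((hasDerivAt_id t₀).prodMk ((hasDerivAt_const t₀ r₀).prodMk h0)).prodMk
      ((((hs.smul_const vt).const_add v).add_const ((r₀ - r₀) • vr)).prodMk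
      (((hs.smul_const vr).const_add w).add_const ((r₀ - r₀) • wr)))).congr_deriv ?_
    simp
  · rw [hJ]
    have hs := (hasDerivAt_id r₀).sub_const r₀
    have h0 : HasDerivAt (fun s : ℝ => u (t₀, s)) w r₀ := by
      have := HasFDerivAt.comp_hasDerivAt (f := fun s : ℝ => (t₀, s)) r₀
        (hu.differentiable (by simp) (t₀, r₀)).hasFDerivAt
        ((hasDerivAt_const r₀ t₀).prodMk (hasDerivAt_id r₀))
      refine this.congr_deriv ?_
      have := congrFun hR (t₀, r₀)
      simpa [partialR] using this
    refine (((hasDerivAt_const r₀ t₀).prodMk ((hasDerivAt_id r₀).prodMk h0)).prodMk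
      (((hs.smul_const vr).const_add (v + (t₀ - t₀) • vt)).prodMk
      ((hs.smul_const wr).const_add (w + (t₀ - t₀) • vr)))).congr_deriv ?_
    simp

/-- The Euler–Lagrange equations of a first order Lagrangian hold identically (for all values of
the second order derivatives `vt`, `vr`, `wr`) as soon as the Lagrangian is a total divergence. -/
theorem eulerLagrange_of_divergence {D : Set Base} (hD : IsOpen D) {G : Base × ℂ × ℂ → ℝ}
    (hG : ContDiffOn ℝ ∞ G (D ×ˢ univ)) {N : ℕ} {A B : Jet (N + 1) → ℝ}
    (hA : ContDiffOn ℝ ∞ A {z | base z ∈ D}) (hB : ContDiffOn ℝ ∞ B {z | base z ∈ D})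
    (h : ∀ z : Jet (N + 2), base z ∈ D →
      G (base z, coord z 1 0 (by omega), coord z 0 1 (by omega)) = totalT A z + totalR B z)
    {x : Base} (hx : x ∈ D) (v w vt vr wr ξ : ℂ) :
    fderiv ℝ G (x, v, w) ((0, 0, ξ), 0, 0)
      = fderiv ℝ (fun j => fderiv ℝ G j (0, ξ, 0)) (x, v, w) ((1, 0, v), vt, vr)
        + fderiv ℝ (fun j => fderiv ℝ G j (0, 0, ξ)) (x, v, w) ((0, 1, w), vr, wr) := by
  obtain ⟨t₀, r₀, u₀⟩ := x
  obtain ⟨u, hu, hJ0, hJT, hJR⟩ := exists_function_of_jet t₀ r₀ u₀ v w vt vr wr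
  set U : Set (ℝ × ℝ) := {y | (y.1, y.2, u y) ∈ D} with hU
  have hUo : IsOpen U := hD.preimage (by have := hu.continuous; fun_prop)
  have hu0 : u (t₀, r₀) = u₀ := congrArg (fun j => j.1.2.2) hJ0
  have hy0 : (t₀, r₀) ∈ U := by simpa [hU, hu0] using hx
  have hDo : IsOpen (D ×ˢ (univ : Set (ℂ × ℂ))) := hD.prod isOpen_univ
  have hGJ : ∀ e, ∀ y ∈ U, ContDiffAt ℝ ∞ (fun y => fderiv ℝ G (firstJet u y) e) y := by
    intro e y hy
    have h1 : ContDiffAt ℝ ∞ G (firstJet u y) :=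
      hG.contDiffAt (hDo.mem_nhds ⟨hy, trivial⟩)
    exact (ContDiffAt.comp y (h1.fderiv_right (m := ∞) (by simp))
      (contDiff_firstJet hu).contDiffAt).clm_apply contDiffAt_const
  -- `F` is the Euler–Lagrange expression in the direction `ξ`, evaluated on the polynomial `u`.
  set g0 : ℝ × ℝ → ℝ := fun y => fderiv ℝ G (firstJet u y) ((0, 0, ξ), 0, 0) with hg0
  set g1 : ℝ × ℝ → ℝ := fun y => fderiv ℝ G (firstJet u y) (0, ξ, 0) with hg1
  set g2 : ℝ × ℝ → ℝ := fun y => fderiv ℝ G (firstJet u y) (0, 0, ξ) with hg2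
  set F : ℝ × ℝ → ℝ := fun y => g0 y - fderiv ℝ g1 y (1, 0) - fderiv ℝ g2 y (0, 1) with hF
  have hFc : ContinuousOn F U := by
    intro y hy
    have e1 := (((hGJ (0, ξ, 0) y hy).fderiv_right (m := ∞) (by simp)).clm_apply
      (contDiffAt_const (c := ((1 : ℝ), (0 : ℝ))))).continuousAt
    have e2 := (((hGJ (0, 0, ξ) y hy).fderiv_right (m := ∞) (by simp)).clm_apply
      (contDiffAt_const (c := ((0 : ℝ), (1 : ℝ))))).continuousAt
    exact (((hGJ _ y hy).continuousAt.sub e1).sub e2).continuousWithinAt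
  have hint : ∀ χ : ℝ × ℝ → ℝ, ContDiff ℝ ∞ χ → HasCompactSupport χ → tsupport χ ⊆ U →
      ∫ y, χ y • F y = 0 := by
    intro χ hχ hc hs
    have hsub : tsupport (fun y => χ y • ξ) ⊆ tsupport χ :=
      closure_mono (fun y hy hχy => hy (by simp [hχy]))
    have hφ : ContDiff ℝ ∞ (fun y => χ y • ξ) := hχ.smul contDiff_const
    have h0 := integral_firstVariation_eq_zero hD hG hA hB h hu hφ hc.smul_right (hsub.trans hs)
    have hsm : ∀ g : ℝ × ℝ → ℝ, (∀ y ∈ U, ContDiffAt ℝ ∞ g y) →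
        ContDiff ℝ ∞ (fun y => χ y * g y) := by
      intro g hg
      rw [contDiff_iff_contDiffAt]
      intro y
      by_cases hy : y ∈ tsupport χ
      · exact hχ.contDiffAt.mul (hg y (hs hy))
      · refine (contDiffAt_const (c := (0 : ℝ))).congr_of_eventuallyEq ?_
        filter_upwards [(isClosed_tsupport χ).isOpen_compl.mem_nhds hy] with x hx
        simp [image_eq_zero_of_notMem_tsupport hx]
    have hs1 := hsm g1 (hGJ _)
    have hs2 := hsm g2 (hGJ _)
    have hc1 : HasCompactSupport (fun y => χ y * g1 y) := hc.mul_right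
    have hc2 : HasCompactSupport (fun y => χ y * g2 y) := hc.mul_right
    have hχd : Differentiable ℝ χ := hχ.differentiable (by simp)
    have hφT : ∀ y, partialT (fun y => χ y • ξ) y = fderiv ℝ χ y (1, 0) • ξ := fun y => by
      simp only [partialT]
      rw [((hχd y).hasFDerivAt.smul_const ξ).fderiv]; rfl
    have hφR : ∀ y, partialR (fun y => χ y • ξ) y = fderiv ℝ χ y (0, 1) • ξ := fun y => by
      simp only [partialR]
      rw [((hχd y).hasFDerivAt.smul_const ξ).fderiv]; rfl
    have hpt : ∀ y, fderiv ℝ G (firstJet u y) ((0, 0, χ y • ξ),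
        partialT (fun y => χ y • ξ) y, partialR (fun y => χ y • ξ) y)
        = χ y • F y + (fderiv ℝ (fun y => χ y * g1 y) y (1, 0)
          + fderiv ℝ (fun y => χ y * g2 y) y (0, 1)) := by
      intro y
      have hsplit : (((0, 0, χ y • ξ), partialT (fun y => χ y • ξ) y,
          partialR (fun y => χ y • ξ) y) : Base × ℂ × ℂ) = χ y • ((0, 0, ξ), 0, 0)
          + fderiv ℝ χ y (1, 0) • (0, ξ, 0) + fderiv ℝ χ y (0, 1) • (0, 0, ξ) := by
        rw [hφT, hφR]; simp
      rw [hsplit, map_add, map_add, map_smul, map_smul, map_smul]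
      by_cases hy : y ∈ tsupport χ
      · have d1 := (hGJ (0, ξ, 0) y (hs hy)).differentiableAt (by simp)
        have d2 := (hGJ (0, 0, ξ) y (hs hy)).differentiableAt (by simp)
        rw [fderiv_fun_mul (hχd y) d1, fderiv_fun_mul (hχd y) d2]
        simp only [hF, hg0, hg1, hg2, add_apply, smul_apply, smul_eq_mul]
        ring
      · have e0 : χ =ᶠ[𝓝 y] fun _ => 0 := by
          filter_upwards [(isClosed_tsupport χ).isOpen_compl.mem_nhds hy] with x hx
          exact image_eq_zero_of_notMem_tsupport hx
        have e1 : ∀ g : ℝ × ℝ → ℝ, fderiv ℝ (fun y => χ y * g y) y = 0 := fun g => by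
          have : (fun y => χ y * g y) =ᶠ[𝓝 y] fun _ => 0 := by
            filter_upwards [e0] with x hx
            simp [hx]
          rw [this.fderiv_eq]; simp
        rw [e1, e1, e0.fderiv_eq, e0.self_of_nhds]
        simp
    simp_rw [hpt] at h0
    have hF' : Integrable (fun y => χ y • F y) := by
      have hcF : HasCompactSupport (fun y => χ y • F y) := hc.smul_right
      refine Continuous.integrable_of_hasCompactSupport ?_ hcF
      rw [continuous_iff_continuousAt]
      intro y
      by_cases hy : y ∈ tsupport χ
      · exact hχ.continuous.continuousAt.smul (hFc.continuousAt (hUo.mem_nhds (hs hy)))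
      · refine (continuousAt_const (y := (0 : ℝ))).congr ?_
        filter_upwards [(isClosed_tsupport χ).isOpen_compl.mem_nhds hy] with x hx
        simp [image_eq_zero_of_notMem_tsupport hx]
    have h12 : Integrable (fun y => fderiv ℝ (fun y => χ y * g1 y) y (1, 0)
        + fderiv ℝ (fun y => χ y * g2 y) y (0, 1)) := (integrable_fderiv_apply hs1 hc1 _).add
      (integrable_fderiv_apply hs2 hc2 _)
    rw [integral_add hF' h12,
      integral_add (integrable_fderiv_apply hs1 hc1 _) (integrable_fderiv_apply hs2 hc2 _),
      integral_fderiv_eq_zero hs1 hc1, integral_fderiv_eq_zero hs2 hc2] at h0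
    simpa using h0
  -- The fundamental lemma of the calculus of variations gives `F = 0` almost everywhere on `U`,
  -- hence everywhere by continuity.
  have hae := hUo.ae_eq_zero_of_integral_contDiff_smul_eq_zero (μ := volume)
    (hFc.locallyIntegrableOn hUo.measurableSet) hint
  have hzero : F (t₀, r₀) = 0 := by
    refine Measure.eqOn_open_of_ae_eq (μ := volume) (f := F) (g := fun _ => 0) ?_ hUo hFc
      continuousOn_const hy0
    exact (ae_restrict_iff' hUo.measurableSet).2 hae
  have hchain : ∀ e d : Base × ℂ × ℂ, ∀ s : ℝ × ℝ, fderiv ℝ (firstJet u) (t₀, r₀) s = d →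
      fderiv ℝ (fun y => fderiv ℝ G (firstJet u y) e) (t₀, r₀) s
        = fderiv ℝ (fun j => fderiv ℝ G j e) ((t₀, r₀, u₀), v, w) d := by
    intro e d s hd
    have h1 : ContDiffAt ℝ ∞ G (firstJet u (t₀, r₀)) :=
      hG.contDiffAt (hDo.mem_nhds ⟨hy0, trivial⟩)
    have h2 : DifferentiableAt ℝ (fun j => fderiv ℝ G j e) (firstJet u (t₀, r₀)) :=
      ((h1.fderiv_right (m := ∞) (by simp)).clm_apply contDiffAt_const).differentiableAt (by simp)
    have h3 : HasFDerivAt (fun y => fderiv ℝ G (firstJet u y) e) _ (t₀, r₀) :=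
      HasFDerivAt.comp (t₀, r₀) h2.hasFDerivAt
        ((contDiff_firstJet hu).differentiable (by simp) _).hasFDerivAt
    rw [h3.fderiv, ContinuousLinearMap.comp_apply, hd, hJ0]
  simp only [hF, hg0, hg1, hg2] at hzero
  rw [hchain _ _ _ hJT, hchain _ _ _ hJR, hJ0] at hzero
  linarith

/-! ### Null Lagrangians of first order -/

section Lines

variable {F E : Type*} [NormedAddCommGroup F] [NormedSpace ℝ F] [NormedAddCommGroup E]
  [NormedSpace ℝ E]

lemma hasDerivAt_line {f : F → E} {x : F} (hf : DifferentiableAt ℝ f x) (d : F) :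
    HasDerivAt (fun s : ℝ => f (x + s • d)) (fderiv ℝ f x d) 0 := by
  have h1 : HasDerivAt (fun s : ℝ => x + s • d) d 0 := by
    simpa using ((hasDerivAt_id (0 : ℝ)).smul_const d).const_add x
  have h2 : HasFDerivAt f (fderiv ℝ f x) (x + (0 : ℝ) • d) := by simpa using hf.hasFDerivAt
  exact h2.comp_hasDerivAt 0 h1

lemma fderiv_apply_of_line {f : F → E} {x d : F} {f' : E} (hf : DifferentiableAt ℝ f x)
    (h : HasDerivAt (fun s : ℝ => f (x + s • d)) f' 0) : fderiv ℝ f x d = f' :=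
  (hasDerivAt_line hf d).unique h

lemma hasDerivAt_re {f : ℝ → ℂ} {f' : ℂ} {s : ℝ} (h : HasDerivAt f f' s) :
    HasDerivAt (fun s => (f s).re) f'.re s :=
  reCLM.hasFDerivAt.comp_hasDerivAt s h

lemma hasDerivAt_conj {f : ℝ → ℂ} {f' : ℂ} {s : ℝ} (h : HasDerivAt f f' s) :
    HasDerivAt (fun s => conj (f s)) (conj f') s :=
  (conjCLE : ℂ →L[ℝ] ℂ).hasFDerivAt.comp_hasDerivAt s h

end Lines

/-- The Euler–Lagrange equations of the first order Lagrangian `G` hold over `D` identically in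
the values `v`, `w`, `vt`, `vr`, `wr` of `u_t`, `u_r`, `u_tt`, `u_tr`, `u_rr`. -/
def IsNullLagrangian (D : Set Base) (G : Base × ℂ × ℂ → ℝ) : Prop :=
  ∀ x ∈ D, ∀ v w vt vr wr ξ : ℂ,
    fderiv ℝ G (x, v, w) ((0, 0, ξ), 0, 0)
      = fderiv ℝ (fun j => fderiv ℝ G j (0, ξ, 0)) (x, v, w) ((1, 0, v), vt, vr)
        + fderiv ℝ (fun j => fderiv ℝ G j (0, 0, ξ)) (x, v, w) ((0, 1, w), vr, wr)

/-- A null Lagrangian is affine along the rank one directions `(aξ, bξ)` in the space of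
gradients `(u_t, u_r)`. -/
theorem IsNullLagrangian.rank_one {D : Set Base} (hD : IsOpen D) {G : Base × ℂ × ℂ → ℝ}
    (hG : ContDiffOn ℝ ∞ G (D ×ˢ univ)) (h : IsNullLagrangian D G) {x : Base} (hx : x ∈ D)
    (v w ξ : ℂ) (a b : ℝ) :
    G (x, v + a * ξ, w + b * ξ) + G (x, v - a * ξ, w - b * ξ) = 2 * G (x, v, w) := by
  have hGc : ∀ v w, ContDiffAt ℝ ∞ G (x, v, w) := fun v w =>
    hG.contDiffAt ((hD.prod isOpen_univ).mem_nhds ⟨hx, trivial⟩)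
  have hd : ∀ e v w, DifferentiableAt ℝ (fun j => fderiv ℝ G j e) (x, v, w) := fun e v w =>
    (((hGc v w).fderiv_right (m := ∞) (by simp)).clm_apply contDiffAt_const).differentiableAt
      (by simp)
  set e : Base × ℂ × ℂ := (0, a * ξ, b * ξ) with he
  have he' : e = a • (0, ξ, 0) + b • (0, 0, ξ) := by simp [he]
  -- The coefficients of the second derivatives in the Euler–Lagrange equations vanish.
  have h2 : ∀ v w, fderiv ℝ (fun j => fderiv ℝ G j e) (x, v, w) e = 0 := by
    intro v w
    have e1 : (fun j => fderiv ℝ G j e)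
        = fun j => a * fderiv ℝ G j (0, ξ, 0) + b * fderiv ℝ G j (0, 0, ξ) := by
      funext j; rw [he', map_add, map_smul, map_smul]; rfl
    rw [e1, fderiv_fun_add ((hd _ v w).const_mul a) ((hd _ v w).const_mul b),
      fderiv_const_mul (hd _ v w), fderiv_const_mul (hd _ v w)]
    have key := h x hx v w (a * (a * ξ)) (a * (b * ξ)) (b * (b * ξ)) ξ
    have key0 := h x hx v w 0 0 0 ξ
    have s1 : (((1, 0, v), a * (a * ξ), a * (b * ξ)) : Base × ℂ × ℂ)
        = ((1, 0, v), 0, 0) + a • e := by simp [he]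
    have s2 : (((0, 1, w), a * (b * ξ), b * (b * ξ)) : Base × ℂ × ℂ)
        = ((0, 1, w), 0, 0) + b • e := by simp [he]; ring
    rw [s1, s2, map_add, map_add, map_smul, map_smul] at key
    simp only [add_apply, smul_apply, smul_eq_mul] at key ⊢
    linarith
  set γ : ℝ → Base × ℂ × ℂ := fun s => (x, v, w) + s • e with hγ
  have hγe : ∀ s, γ s = (x, v + s * (a * ξ), w + s * (b * ξ)) := fun s => by simp [hγ, he]
  have hγd : ∀ s, HasDerivAt γ e s := fun s => by
    refine (((hasDerivAt_id s).smul_const e).const_add (x, v, w)).congr_deriv ?_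
    simp
  have hf : ∀ s, HasDerivAt (fun s => G (γ s)) (fderiv ℝ G (γ s) e) s := fun s => by
    have : DifferentiableAt ℝ G (γ s) := by
      rw [hγe]; exact (hGc _ _).differentiableAt (by simp)
    exact this.hasFDerivAt.comp_hasDerivAt s (hγd s)
  have hf' : ∀ s, HasDerivAt (fun s => fderiv ℝ G (γ s) e) 0 s := fun s => by
    have h3 : DifferentiableAt ℝ (fun j => fderiv ℝ G j e) (γ s) := by rw [hγe]; exact hd _ _ _
    have h4 := h3.hasFDerivAt.comp_hasDerivAt s (hγd s)
    refine h4.congr_deriv ?_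
    rw [hγe]; exact h2 _ _
  have hconst : ∀ s, fderiv ℝ G (γ s) e = fderiv ℝ G (γ 0) e := fun s =>
    is_const_of_deriv_eq_zero (fun s => (hf' s).differentiableAt) (fun s => (hf' s).deriv) s 0
  have hlin : ∀ s, HasDerivAt (fun s => G (γ s) - s * fderiv ℝ G (γ 0) e) 0 s := fun s => by
    refine ((hf s).sub ((hasDerivAt_id s).mul_const (fderiv ℝ G (γ 0) e))).congr_deriv ?_
    rw [hconst]; simp
  have hl : ∀ s, G (γ s) - s * fderiv ℝ G (γ 0) e = G (γ 0) - 0 * fderiv ℝ G (γ 0) e := fun s =>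
    is_const_of_deriv_eq_zero (fun s => (hlin s).differentiableAt) (fun s => (hlin s).deriv) s 0
  have l1 := hl 1
  have l2 := hl (-1)
  simp only [hγe] at l1 l2
  norm_num at l1 l2
  simp only [← sub_eq_add_neg] at l2
  linarith

/-- A Lagrangian `a + Re (b̄ u_t) + Re (c̄ u_r)` is null exactly if `b` and `c` are gradients in `u`
and the gradient of `a` is `b_t + c_r`; here is the direction needed. -/
theorem IsNullLagrangian.of_affine {D : Set Base} (hD : IsOpen D) {G : Base × ℂ × ℂ → ℝ}
    {a : Base → ℝ} {b c : Base → ℂ} (ha : ContDiffOn ℝ ∞ a D) (hb : ContDiffOn ℝ ∞ b D)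
    (hc : ContDiffOn ℝ ∞ c D) (h : IsNullLagrangian D G)
    (hG : ∀ x ∈ D, ∀ v w, G (x, v, w) = a x + (conj (b x) * v).re + (conj (c x) * w).re)
    {x : Base} (hx : x ∈ D) (ξ v : ℂ) :
    (conj (fderiv ℝ b x (0, 0, ξ)) * v).re = (conj (fderiv ℝ b x (0, 0, v)) * ξ).re ∧
    (conj (fderiv ℝ c x (0, 0, ξ)) * v).re = (conj (fderiv ℝ c x (0, 0, v)) * ξ).re ∧
    fderiv ℝ a x (0, 0, ξ) = (conj (fderiv ℝ b x (1, 0, 0) + fderiv ℝ c x (0, 1, 0)) * ξ).re := by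
  set G' : Base × ℂ × ℂ → ℝ := fun j => a j.1 + (conj (b j.1) * j.2.1).re
    + (conj (c j.1) * j.2.2).re with hG'
  have da : ∀ y ∈ D, DifferentiableAt ℝ a y := fun y hy =>
    (ha.contDiffAt (hD.mem_nhds hy)).differentiableAt (by simp)
  have db : ∀ y ∈ D, DifferentiableAt ℝ b y := fun y hy =>
    (hb.contDiffAt (hD.mem_nhds hy)).differentiableAt (by simp)
  have dc : ∀ y ∈ D, DifferentiableAt ℝ c y := fun y hy =>
    (hc.contDiffAt (hD.mem_nhds hy)).differentiableAt (by simp)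
  have hdG : ∀ j : Base × ℂ × ℂ, j.1 ∈ D → DifferentiableAt ℝ G' j := by
    intro j hj
    have e1 : DifferentiableAt ℝ (fun j : Base × ℂ × ℂ => a j.1) j :=
      DifferentiableAt.comp j (da _ hj) differentiableAt_fst
    have e2 : DifferentiableAt ℝ (fun j : Base × ℂ × ℂ => b j.1) j :=
      DifferentiableAt.comp j (db _ hj) differentiableAt_fst
    have e3 : DifferentiableAt ℝ (fun j : Base × ℂ × ℂ => c j.1) j :=
      DifferentiableAt.comp j (dc _ hj) differentiableAt_fst
    have e2' := (conjCLE : ℂ →L[ℝ] ℂ).differentiableAt.comp j e2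
    have e3' := (conjCLE : ℂ →L[ℝ] ℂ).differentiableAt.comp j e3
    have d2 : DifferentiableAt ℝ (fun j : Base × ℂ × ℂ => j.2.1) j := by fun_prop
    have d3 : DifferentiableAt ℝ (fun j : Base × ℂ × ℂ => j.2.2) j := by fun_prop
    exact (e1.add (reCLM.differentiableAt.comp j (e2'.mul d2))).add
      (reCLM.differentiableAt.comp j (e3'.mul d3))
  have hline : ∀ j : Base × ℂ × ℂ, j.1 ∈ D → ∀ e : Base × ℂ × ℂ, fderiv ℝ G' j e
      = fderiv ℝ a j.1 e.1 + (conj (fderiv ℝ b j.1 e.1) * j.2.1 + conj (b j.1) * e.2.1).re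
        + (conj (fderiv ℝ c j.1 e.1) * j.2.2 + conj (c j.1) * e.2.2).re := by
    intro j hj e
    refine fderiv_apply_of_line (hdG j hj) ?_
    have l2 : HasDerivAt (fun s : ℝ => j.2.1 + s • e.2.1) e.2.1 0 := by
      simpa using ((hasDerivAt_id (0 : ℝ)).smul_const e.2.1).const_add j.2.1
    have l3 : HasDerivAt (fun s : ℝ => j.2.2 + s • e.2.2) e.2.2 0 := by
      simpa using ((hasDerivAt_id (0 : ℝ)).smul_const e.2.2).const_add j.2.2
    have := ((hasDerivAt_line (da _ hj) e.1).add
      (hasDerivAt_re ((hasDerivAt_conj (hasDerivAt_line (db _ hj) e.1)).mul l2))).add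
      (hasDerivAt_re ((hasDerivAt_conj (hasDerivAt_line (dc _ hj) e.1)).mul l3))
    refine this.congr_deriv ?_
    simp
  have hev : ∀ j : Base × ℂ × ℂ, j.1 ∈ D → G =ᶠ[𝓝 j] G' := by
    intro j hj
    filter_upwards [(hD.preimage continuous_fst).mem_nhds hj] with y hy
    exact hG y.1 hy y.2.1 y.2.2
  have hGd : ∀ e j, j.1 ∈ D → fderiv ℝ G j e = fderiv ℝ a j.1 e.1
      + (conj (fderiv ℝ b j.1 e.1) * j.2.1 + conj (b j.1) * e.2.1).re
        + (conj (fderiv ℝ c j.1 e.1) * j.2.2 + conj (c j.1) * e.2.2).re := fun e j hj => by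
    rw [(hev j hj).fderiv_eq, hline j hj]
  have hsec : ∀ (f : Base → ℂ) (ζ v w : ℂ) (d e : Base × ℂ × ℂ), DifferentiableAt ℝ f x →
      (∀ j : Base × ℂ × ℂ, j.1 ∈ D → fderiv ℝ G j e = (conj (f j.1) * ζ).re) →
      fderiv ℝ (fun j => fderiv ℝ G j e) (x, v, w) d = (conj (fderiv ℝ f x d.1) * ζ).re := by
    intro f ζ v w d e hf hfe
    have e1 : (fun j => fderiv ℝ G j e) =ᶠ[𝓝 (x, v, w)] fun j => (conj (f j.1) * ζ).re := by
      filter_upwards [(hD.preimage continuous_fst).mem_nhds hx] with y hy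
      exact hfe y hy
    rw [e1.fderiv_eq]
    have d1 : DifferentiableAt ℝ (fun j : Base × ℂ × ℂ => f j.1) (x, v, w) :=
      DifferentiableAt.comp (x, v, w) hf differentiableAt_fst
    refine fderiv_apply_of_line (reCLM.differentiableAt.comp _
      (((conjCLE : ℂ →L[ℝ] ℂ).differentiableAt.comp _ d1).mul_const ζ)) ?_
    exact hasDerivAt_re ((hasDerivAt_conj (hasDerivAt_line hf d.1)).mul_const ζ)
  have hEL : ∀ v w ξ : ℂ, fderiv ℝ a x (0, 0, ξ) + (conj (fderiv ℝ b x (0, 0, ξ)) * v).re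
      + (conj (fderiv ℝ c x (0, 0, ξ)) * w).re
      = (conj (fderiv ℝ b x (1, 0, v)) * ξ).re + (conj (fderiv ℝ c x (0, 1, w)) * ξ).re := by
    intro v w ξ
    have h0 := h x hx v w 0 0 0 ξ
    rw [hGd _ (x, v, w) hx,
      hsec b ξ v w _ _ (db x hx) (fun j hj => by rw [hGd _ _ hj]; simp),
      hsec c ξ v w _ _ (dc x hx) (fun j hj => by rw [hGd _ _ hj]; simp)] at h0
    simpa using h0
  have hsplit : ∀ (f : Base → ℂ) (p q : ℝ) (v : ℂ),
      fderiv ℝ f x (p, q, v) = fderiv ℝ f x (p, q, 0) + fderiv ℝ f x (0, 0, v) := fun f p q v => by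
    rw [← map_add]; simp
  have hz : ∀ f : Base → ℂ, fderiv ℝ f x (0, 0, 0) = 0 := fun f => map_zero _
  have k0 := hEL 0 0 ξ
  have k1 := hEL v 0 ξ
  have k2 := hEL 0 v ξ
  rw [hsplit b 1 0 v] at k1
  rw [hsplit c 0 1 v] at k2
  simp only [mul_zero, zero_re, map_add, add_mul, add_re] at k0 k1 k2 ⊢
  exact ⟨by linarith, by linarith, by linarith⟩

/-! ### The Lie derivative of the Lagrangian and Noether's identity -/

lemma hasDerivAt_norm_sq {f : ℝ → ℂ} {f' : ℂ} {s : ℝ} (hf : HasDerivAt f f' s) :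
    HasDerivAt (fun s => ‖f s‖ ^ 2) (2 * (conj (f s) * f').re) s := by
  have h := hasDerivAt_re ((hasDerivAt_conj hf).mul hf)
  have e : (fun s => ‖f s‖ ^ 2) = fun s => (conj (f s) * f s).re := by
    funext s
    rw [← normSq_eq_norm_sq, normSq_apply]; simp
  rw [e]
  refine h.congr_deriv ?_
  simp; ring

lemma hasDerivAt_norm_rpow {f : ℝ → ℂ} {f' : ℂ} {s : ℝ} (hf : HasDerivAt f f' s) (h0 : f s ≠ 0)
    (q : ℝ) : HasDerivAt (fun s => ‖f s‖ ^ q) (q * ‖f s‖ ^ (q - 2) * (conj (f s) * f').re) s := by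
  have e : ∀ z : ℂ, ∀ q : ℝ, ‖z‖ ^ q = (‖z‖ ^ 2) ^ (q / 2) := fun z q => by
    rw [← Real.rpow_natCast, ← Real.rpow_mul (norm_nonneg z)]
    congr 1; push_cast; ring
  simp_rw [e]
  have h2 : ‖f s‖ ^ 2 ≠ 0 := by positivity
  refine ((hasDerivAt_norm_sq hf).rpow_const (p := q / 2) (Or.inl h2)).congr_deriv ?_
  have : q / 2 - 1 = (q - 2) / 2 := by ring
  rw [this]; ring

/-- The Lagrangian divided by the weight `r ^ (n - 1)`, as a function of `u`, `u_t`, `u_r`. -/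
noncomputable def lagrangianDensity (p k : ℝ) (u v w : ℂ) : ℝ :=
  (I * conj u * v).re + ‖w‖ ^ 2 - 2 / (p + 2) * k * ‖u‖ ^ (p + 2)

lemma lagrangian_eq (n p k : ℝ) (z : Jet 1) :
    lagrangian n p k z = lagrangianDensity p k (coord z 0 0 (by norm_num))
      (coord z 1 0 (by norm_num)) (coord z 0 1 (by norm_num)) * z.2.1 ^ (n - 1) := by
  simp only [lagrangian, lagrangianDensity]
  congr 3
  simp; ring

/-- The part of jet space over `r > 0`, `u ≠ 0`. -/
def regularJets (N : ℕ) : Set (Jet N) := {z | 0 < (base z).2.1 ∧ (base z).2.2 ≠ 0}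

lemma isOpen_regularBase : IsOpen {x : Base | 0 < x.2.1 ∧ x.2.2 ≠ 0} :=
  (isOpen_lt (f := fun _ : Base => (0 : ℝ)) (g := fun x => x.2.1) (by fun_prop) (by fun_prop)).inter
    (isOpen_ne_fun (f := fun x : Base => x.2.2) (g := fun _ => 0) (by fun_prop) (by fun_prop))

lemma isOpen_regularJets (N : ℕ) : IsOpen (regularJets N) :=
  isOpen_base_preimage isOpen_regularBase N

lemma contDiff_coord {N : ℕ} (i j : ℕ) (h : i + j ≤ N) :
    ContDiff ℝ ∞ (fun z : Jet N => coord z i j h) := by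
  unfold coord; fun_prop

lemma contDiff_base (N : ℕ) : ContDiff ℝ ∞ (base : Jet N → Base) := by
  unfold base coord; fun_prop

lemma contDiffAt_lagrangian (n p k : ℝ) {z : Jet 1} (hz : z ∈ regularJets 1) :
    ContDiffAt ℝ ∞ (lagrangian n p k) z := by
  rw [funext (lagrangian_eq n p k)]
  have c0 : ContDiffAt ℝ ∞ (fun z : Jet 1 => coord z 0 0 (by norm_num)) z :=
    (contDiff_coord 0 0 _).contDiffAt
  have c1 : ContDiffAt ℝ ∞ (fun z : Jet 1 => coord z 1 0 (by norm_num)) z :=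
    (contDiff_coord 1 0 _).contDiffAt
  have c2 : ContDiffAt ℝ ∞ (fun z : Jet 1 => coord z 0 1 (by norm_num)) z :=
    (contDiff_coord 0 1 _).contDiffAt
  have cr : ContDiffAt ℝ ∞ (fun z : Jet 1 => z.2.1) z := by fun_prop
  have cn : ContDiffAt ℝ ∞ (fun z : Jet 1 => ‖coord z 0 0 (by norm_num)‖) z := c0.norm ℝ hz.2
  have hn : ‖coord z 0 0 (by norm_num)‖ ≠ 0 := norm_ne_zero_iff.2 hz.2
  have hr : z.2.1 ≠ 0 := hz.1.ne'
  have cc : ContDiffAt ℝ ∞ (fun z : Jet 1 => conj (coord z 0 0 (by norm_num))) z :=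
    (conjCLE : ℂ →L[ℝ] ℂ).contDiff.contDiffAt.comp z c0
  exact (((reCLM.contDiff.contDiffAt.comp z ((contDiffAt_const.mul cc).mul c1)).add
    (c2.norm_sq ℝ)).sub (contDiffAt_const.mul (cn.rpow_const_of_ne hn))).mul
    (cr.rpow_const_of_ne hr)

lemma hasDerivAt_add_smul {E : Type*} [NormedAddCommGroup E] [NormedSpace ℝ E] (a b : E) :
    HasDerivAt (fun s : ℝ => a + s • b) b 0 := by
  simpa using ((hasDerivAt_id (0 : ℝ)).smul_const b).const_add a

lemma hasDerivAt_coord {N : ℕ} (z d : Jet N) (i j : ℕ) (h : i + j ≤ N) :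
    HasDerivAt (fun s : ℝ => coord (z + s • d) i j h) (coord d i j h) 0 :=
  hasDerivAt_add_smul _ _

lemma hasDerivAt_comp_base {N : ℕ} {E : Type*} [NormedAddCommGroup E] [NormedSpace ℝ E]
    {f : Base → E} {z : Jet N} (hf : DifferentiableAt ℝ f (base z)) (d : Jet N) :
    HasDerivAt (fun s : ℝ => f (base (z + s • d))) (fderiv ℝ f (base z) (base d)) 0 :=
  hasDerivAt_line hf (base d)

lemma hasDerivAt_lagrangian (n k : ℝ) {p : ℝ} (hp2 : p ≠ -2) {z : Jet 1}
    (hz : z ∈ regularJets 1) (d : Jet 1) :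
    HasDerivAt (fun s : ℝ => lagrangian n p k (z + s • d))
      (z.2.1 ^ (n - 1) * ((n - 1) * d.2.1 / z.2.1 * lagrangianDensity p k
          (coord z 0 0 (by norm_num)) (coord z 1 0 (by norm_num)) (coord z 0 1 (by norm_num))
        + (I * conj (coord d 0 0 (by norm_num)) * coord z 1 0 (by norm_num)).re
        + (I * conj (coord z 0 0 (by norm_num)) * coord d 1 0 (by norm_num)).re
        + 2 * (conj (coord z 0 1 (by norm_num)) * coord d 0 1 (by norm_num)).re
        - 2 * k * ‖coord z 0 0 (by norm_num)‖ ^ p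
          * (conj (coord z 0 0 (by norm_num)) * coord d 0 0 (by norm_num)).re)) 0 := by
  simp_rw [lagrangian_eq, lagrangianDensity]
  have h0 := hasDerivAt_coord z d 0 0 (by norm_num)
  have h1 := hasDerivAt_coord z d 1 0 (by norm_num)
  have h2 := hasDerivAt_coord z d 0 1 (by norm_num)
  have hr : HasDerivAt (fun s : ℝ => (z + s • d).2.1) d.2.1 0 := hasDerivAt_add_smul z.2.1 d.2.1
  have hr0 : z.2.1 ≠ 0 := hz.1.ne'
  have hu0 : coord z 0 0 (by norm_num) ≠ 0 := hz.2
  have hp2' : p + 2 ≠ 0 := fun h => hp2 (by linarith)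
  refine ((((hasDerivAt_re (((hasDerivAt_conj h0).const_mul I).mul h1)).add
    (hasDerivAt_norm_sq h2)).sub ((hasDerivAt_norm_rpow h0 (by simpa using hu0) (p + 2)).const_mul
      (2 / (p + 2) * k))).mul (hr.rpow_const (p := n - 1)
        (Or.inl (by simpa using hr0)))).congr_deriv ?_
  have e : z.2.1 ^ (n - 1 - 1) = z.2.1 ^ (n - 1) / z.2.1 := by
    rw [Real.rpow_sub_one hr0]
  simp only [zero_smul, add_zero, e, add_sub_cancel_right, Pi.mul_apply,
    Pi.add_apply, Pi.sub_apply, add_re]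
  field_simp
  ring

/-- The Lie derivative along `pr X` of the Lagrangian form `L dt ∧ dr`, that is
`pr X L + (D_t τ + D_r ρ) L`, as a function of `(t, r, u)`, `u_t` and `u_r`. -/
noncomputable def lieLagrangian (n p k : ℝ) (X : Base → Base) (j : Base × ℂ × ℂ) : ℝ :=
  let r := j.1.2.1
  let u := j.1.2.2
  let v := j.2.1
  let w := j.2.2
  let x := X j.1
  let xT := fderiv ℝ X j.1 (1, 0, v)
  let xR := fderiv ℝ X j.1 (0, 1, w)
  r ^ (n - 1) * (((n - 1) * x.2.1 / r + xT.1 + xR.2.1) * lagrangianDensity p k u v w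
    + (I * conj x.2.2 * v).re + (I * conj u * (xT.2.2 - xT.1 * v - xT.2.1 * w)).re
    + 2 * (conj w * (xR.2.2 - xR.1 * v - xR.2.1 * w)).re
    - 2 * k * ‖u‖ ^ p * (conj u * x.2.2).re)

section Characteristic

variable {X : Base → Base} {z : Jet 1}

lemma differentiableAt_comp_base {N : ℕ} {z : Jet N} (hX : DifferentiableAt ℝ X (base z)) :
    DifferentiableAt ℝ (fun z : Jet N => X (base z)) z :=
  DifferentiableAt.comp z hX ((contDiff_base N).differentiable (by simp) z)

lemma differentiableAt_coord {N : ℕ} {z : Jet N} (i j : ℕ) (h : i + j ≤ N) :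
    DifferentiableAt ℝ (fun z : Jet N => coord z i j h) z :=
  (contDiff_coord i j h).differentiable (by simp) z

lemma differentiableAt_characteristic (hX : DifferentiableAt ℝ X (base z)) :
    DifferentiableAt ℝ (characteristic X) z := by
  have h := differentiableAt_comp_base hX
  have h1 : DifferentiableAt ℝ (fun z : Jet 1 => ((X (base z)).1 : ℂ)) z :=
    ofRealCLM.differentiableAt.comp z h.fst
  have h2 : DifferentiableAt ℝ (fun z : Jet 1 => ((X (base z)).2.1 : ℂ)) z :=
    ofRealCLM.differentiableAt.comp z h.snd.fst
  exact (h.snd.snd.sub (h1.mul (differentiableAt_coord 1 0 _))).sub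
    (h2.mul (differentiableAt_coord 0 1 _))

lemma hasDerivAt_characteristic (hX : DifferentiableAt ℝ X (base z)) (d : Jet 1) :
    HasDerivAt (fun s : ℝ => characteristic X (z + s • d))
      ((fderiv ℝ X (base z) (base d)).2.2
        - ((fderiv ℝ X (base z) (base d)).1 * coord z 1 0 (by norm_num)
          + (X (base z)).1 * coord d 1 0 (by norm_num))
        - ((fderiv ℝ X (base z) (base d)).2.1 * coord z 0 1 (by norm_num)
          + (X (base z)).2.1 * coord d 0 1 (by norm_num))) 0 := by
  have h := hasDerivAt_comp_base hX d
  have h1 := (hasFDerivAt_fst (𝕜 := ℝ)).comp_hasDerivAt 0 h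
  have h2 := (hasFDerivAt_snd (𝕜 := ℝ)).comp_hasDerivAt 0 h
  have h3 := (hasFDerivAt_fst (𝕜 := ℝ)).comp_hasDerivAt 0 h2
  have h4 := (hasFDerivAt_snd (𝕜 := ℝ)).comp_hasDerivAt 0 h2
  refine ((h4.sub (h1.ofReal_comp.mul (hasDerivAt_coord z d 1 0 (by norm_num)))).sub
    (h3.ofReal_comp.mul (hasDerivAt_coord z d 0 1 (by norm_num)))).congr_deriv ?_
  simp

lemma fderiv_characteristic (hX : DifferentiableAt ℝ X (base z)) (d : Jet 1) :
    fderiv ℝ (characteristic X) z d = (fderiv ℝ X (base z) (base d)).2.2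
        - ((fderiv ℝ X (base z) (base d)).1 * coord z 1 0 (by norm_num)
          + (X (base z)).1 * coord d 1 0 (by norm_num))
        - ((fderiv ℝ X (base z) (base d)).2.1 * coord z 0 1 (by norm_num)
          + (X (base z)).2.1 * coord d 0 1 (by norm_num)) :=
  fderiv_apply_of_line (differentiableAt_characteristic hX) (hasDerivAt_characteristic hX d)

end Characteristic

/-- The direction in jet space that defines the total `t`-derivative. -/
def dirT (z : Jet 2) : Jet 1 := (1, 0, shiftT 1 z)

/-- The direction in jet space that defines the total `r`-derivative. -/
def dirR (z : Jet 2) : Jet 1 := (0, 1, shiftR 1 z)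

lemma trunc_mem_regularJets {z : Jet 2} (hz : z ∈ regularJets 2) :
    trunc one_le_two z ∈ regularJets 1 := hz

section NoetherIdentity

variable {n p k : ℝ} {X : Base → Base} {z : Jet 2}

lemma totalT_characteristic (hX : DifferentiableAt ℝ X (base z)) :
    totalT (characteristic X) z
      = (fderiv ℝ X (base z) (1, 0, coord z 1 0 (by norm_num))).2.2
        - ((fderiv ℝ X (base z) (1, 0, coord z 1 0 (by norm_num))).1 * coord z 1 0 (by norm_num)
          + (X (base z)).1 * coord z 2 0 (by norm_num))
        - ((fderiv ℝ X (base z) (1, 0, coord z 1 0 (by norm_num))).2.1 * coord z 0 1 (by norm_num)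
          + (X (base z)).2.1 * coord z 1 1 (by norm_num)) :=
  fderiv_characteristic (z := trunc one_le_two z) hX (dirT z)

lemma totalR_characteristic (hX : DifferentiableAt ℝ X (base z)) :
    totalR (characteristic X) z
      = (fderiv ℝ X (base z) (0, 1, coord z 0 1 (by norm_num))).2.2
        - ((fderiv ℝ X (base z) (0, 1, coord z 0 1 (by norm_num))).1 * coord z 1 0 (by norm_num)
          + (X (base z)).1 * coord z 1 1 (by norm_num))
        - ((fderiv ℝ X (base z) (0, 1, coord z 0 1 (by norm_num))).2.1 * coord z 0 1 (by norm_num)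
          + (X (base z)).2.1 * coord z 0 2 (by norm_num)) :=
  fderiv_characteristic (z := trunc one_le_two z) hX (dirR z)

lemma hasDerivAt_coeff_mul_lagrangian (hz : z ∈ regularJets 2) {f : Base → ℝ}
    (hf : DifferentiableAt ℝ f (base z)) (d : Jet 1) :
    HasDerivAt (fun s : ℝ => f (base (trunc one_le_two z + s • d))
        * lagrangian n p k (trunc one_le_two z + s • d))
      (fderiv ℝ f (base z) (base d) * lagrangian n p k (trunc one_le_two z)
        + f (base z) * fderiv ℝ (lagrangian n p k) (trunc one_le_two z) d) 0 := by
  have hL := hasDerivAt_line ((contDiffAt_lagrangian n p k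
    (trunc_mem_regularJets hz)).differentiableAt (by simp)) d
  refine ((hasDerivAt_comp_base (z := trunc one_le_two z) hf d).mul hL).congr_deriv ?_
  simp; rfl

lemma fderiv_coeff_mul_lagrangian (hz : z ∈ regularJets 2) {f : Base → ℝ}
    (hf : DifferentiableAt ℝ f (base z)) (d : Jet 1) :
    fderiv ℝ (fun z : Jet 1 => f (base z) * lagrangian n p k z) (trunc one_le_two z) d
      = fderiv ℝ f (base z) (base d) * lagrangian n p k (trunc one_le_two z)
        + f (base z) * fderiv ℝ (lagrangian n p k) (trunc one_le_two z) d := by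
  refine fderiv_apply_of_line (DifferentiableAt.mul ?_ ?_)
    (hasDerivAt_coeff_mul_lagrangian hz hf d)
  · exact DifferentiableAt.comp _ (g := f) hf ((contDiff_base 1).differentiable (by simp) _)
  · exact (contDiffAt_lagrangian n p k (trunc_mem_regularJets hz)).differentiableAt (by simp)

lemma fderiv_lagrangian (hp2 : p ≠ -2) {z : Jet 1} (hz : z ∈ regularJets 1) (d : Jet 1) :
    fderiv ℝ (lagrangian n p k) z d
      = z.2.1 ^ (n - 1) * ((n - 1) * d.2.1 / z.2.1 * lagrangianDensity p k
          (coord z 0 0 (by norm_num)) (coord z 1 0 (by norm_num)) (coord z 0 1 (by norm_num))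
        + (I * conj (coord d 0 0 (by norm_num)) * coord z 1 0 (by norm_num)).re
        + (I * conj (coord z 0 0 (by norm_num)) * coord d 1 0 (by norm_num)).re
        + 2 * (conj (coord z 0 1 (by norm_num)) * coord d 0 1 (by norm_num)).re
        - 2 * k * ‖coord z 0 0 (by norm_num)‖ ^ p
          * (conj (coord z 0 0 (by norm_num)) * coord d 0 0 (by norm_num)).re) :=
  fderiv_apply_of_line ((contDiffAt_lagrangian n p k hz).differentiableAt (by simp))
    (hasDerivAt_lagrangian n k hp2 hz d)

lemma prolongApply_lagrangian (hp2 : p ≠ -2) (hz : z ∈ regularJets 2) :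
    prolongApply X (lagrangian n p k) z = (base z).2.1 ^ (n - 1) *
      ((I * conj (characteristic X (trunc one_le_two z)) * coord z 1 0 (by norm_num)).re
        + (I * conj (coord z 0 0 (by norm_num)) * totalT (characteristic X) z).re
        + 2 * (conj (coord z 0 1 (by norm_num)) * totalR (characteristic X) z).re
        - 2 * k * ‖coord z 0 0 (by norm_num)‖ ^ p
          * (conj (coord z 0 0 (by norm_num)) * characteristic X (trunc one_le_two z)).re) := by
  rw [prolongApply, fderiv_lagrangian hp2 (trunc_mem_regularJets hz)]
  simp [coord, trunc, base]

/-- The variation of the Lagrangian along the characteristic form of `X` differs from its Lie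
derivative along `X` by a total divergence. -/
theorem prolongApply_eq (hp2 : p ≠ -2) (hX : DifferentiableAt ℝ X (base z))
    (hz : z ∈ regularJets 2) :
    prolongApply X (lagrangian n p k) z
      = lieLagrangian n p k X (base z, coord z 1 0 (by norm_num), coord z 0 1 (by norm_num))
        - totalT (fun z : Jet 1 => (X (base z)).1 * lagrangian n p k z) z
        - totalR (fun z : Jet 1 => (X (base z)).2.1 * lagrangian n p k z) z := by
  have hT : totalT (fun z : Jet 1 => (X (base z)).1 * lagrangian n p k z) z = _ :=
    fderiv_coeff_mul_lagrangian hz (f := fun x => (X x).1) hX.fst (dirT z)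
  have hR : totalR (fun z : Jet 1 => (X (base z)).2.1 * lagrangian n p k z) z = _ :=
    fderiv_coeff_mul_lagrangian hz (f := fun x => (X x).2.1) hX.snd.fst (dirR z)
  have e1 : ∀ d, fderiv ℝ (fun x => (X x).1) (base z) d = (fderiv ℝ X (base z) d).1 := fun d => by
    rw [hX.hasFDerivAt.fst.fderiv]; rfl
  have e2 : ∀ d, fderiv ℝ (fun x => (X x).2.1) (base z) d = (fderiv ℝ X (base z) d).2.1 :=
    fun d => by rw [hX.hasFDerivAt.snd.fst.fderiv]; rfl
  rw [hT, hR, e1, e2, prolongApply_lagrangian hp2 hz,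
    fderiv_lagrangian hp2 (trunc_mem_regularJets hz),
    fderiv_lagrangian hp2 (trunc_mem_regularJets hz), totalT_characteristic hX,
    totalR_characteristic hX, lagrangian_eq]
  have b1 : base (dirT z) = (1, 0, coord z 1 0 (by norm_num)) := rfl
  have b2 : base (dirR z) = (0, 1, coord z 0 1 (by norm_num)) := rfl
  have b3 : base z = (z.1, z.2.1, coord z 0 0 (by norm_num)) := rfl
  rw [b1, b2]
  simp only [lieLagrangian, characteristic, lagrangianDensity]
  simp only [coord, trunc, base, dirT, dirR, shiftT, shiftR]
  set u := z.2.2 ⟨(0, 0), _⟩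
  set v := z.2.2 ⟨(1, 0), _⟩
  set w := z.2.2 ⟨(0, 1), _⟩
  set xT := fderiv ℝ X (z.1, z.2.1, u) (1, 0, v)
  set xR := fderiv ℝ X (z.1, z.2.1, u) (0, 1, w)
  set x := X (z.1, z.2.1, u)
  rw [← normSq_eq_norm_sq, normSq_apply]
  simp only [map_sub, map_mul, conj_ofReal, mul_re, mul_im, sub_re, sub_im, add_re, add_im, I_re,
    I_im, conj_re, conj_im, ofReal_re, ofReal_im]
  ring

lemma differentiableAt_coeff_mul_lagrangian (n p k : ℝ) {z : Jet 1} (hz : z ∈ regularJets 1)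
    {f : Base → ℝ} (hf : DifferentiableAt ℝ f (base z)) :
    DifferentiableAt ℝ (fun z : Jet 1 => f (base z) * lagrangian n p k z) z :=
  (DifferentiableAt.comp z hf ((contDiff_base 1).differentiable (by simp) z)).mul
    ((contDiffAt_lagrangian n p k hz).differentiableAt (by simp))

lemma differentiableAt_weight (n : ℝ) {z : Jet 1} (hz : z ∈ regularJets 1) :
    DifferentiableAt ℝ (fun z : Jet 1 => z.2.1 ^ (n - 1)) z :=
  (by fun_prop : DifferentiableAt ℝ (fun z : Jet 1 => z.2.1) z).rpow_const (Or.inl hz.1.ne')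

lemma hasDerivAt_weight (n : ℝ) {z : Jet 1} (hz : z ∈ regularJets 1) (d : Jet 1) :
    HasDerivAt (fun s : ℝ => (z + s • d).2.1 ^ (n - 1))
      (z.2.1 ^ (n - 1) * ((n - 1) * d.2.1 / z.2.1)) 0 := by
  have hr : HasDerivAt (fun s : ℝ => (z + s • d).2.1) d.2.1 0 := hasDerivAt_add_smul z.2.1 d.2.1
  have hr0 : z.2.1 ≠ 0 := hz.1.ne'
  refine (hr.rpow_const (p := n - 1) (Or.inl (by simpa using hr0))).congr_deriv ?_
  simp only [zero_smul, add_zero, Real.rpow_sub_one hr0]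
  ring

/-- The density `r ^ (n - 1) Re (i u P̄)`. -/
noncomputable def momentumDensity (n : ℝ) (X : Base → Base) (z : Jet 1) : ℝ :=
  z.2.1 ^ (n - 1) * (I * coord z 0 0 (by norm_num) * conj (characteristic X z)).re

/-- The flux `2 r ^ (n - 1) Re (P̄ u_r)`. -/
noncomputable def momentumFlux (n : ℝ) (X : Base → Base) (z : Jet 1) : ℝ :=
  2 * z.2.1 ^ (n - 1) * (conj (characteristic X z) * coord z 0 1 (by norm_num)).re

lemma differentiableAt_momentumDensity (n : ℝ) {z : Jet 1} (hz : z ∈ regularJets 1)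
    (hX : DifferentiableAt ℝ X (base z)) : DifferentiableAt ℝ (momentumDensity n X) z :=
  (differentiableAt_weight n hz).mul (reCLM.differentiableAt.comp z
    (((differentiableAt_const I).mul (differentiableAt_coord 0 0 _)).mul
      ((conjCLE : ℂ →L[ℝ] ℂ).differentiableAt.comp z (differentiableAt_characteristic hX))))

lemma differentiableAt_momentumFlux (n : ℝ) {z : Jet 1} (hz : z ∈ regularJets 1)
    (hX : DifferentiableAt ℝ X (base z)) : DifferentiableAt ℝ (momentumFlux n X) z :=
  ((differentiableAt_weight n hz).const_mul 2).mul (reCLM.differentiableAt.comp z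
    (((conjCLE : ℂ →L[ℝ] ℂ).differentiableAt.comp z (differentiableAt_characteristic hX)).mul
      (differentiableAt_coord 0 1 _)))

lemma fderiv_momentumDensity (n : ℝ) {z : Jet 1} (hz : z ∈ regularJets 1)
    (hX : DifferentiableAt ℝ X (base z)) (d : Jet 1) :
    fderiv ℝ (momentumDensity n X) z d = z.2.1 ^ (n - 1) * ((n - 1) * d.2.1 / z.2.1
        * (I * coord z 0 0 (by norm_num) * conj (characteristic X z)).re
      + (I * coord d 0 0 (by norm_num) * conj (characteristic X z)
        + I * coord z 0 0 (by norm_num) * conj (fderiv ℝ (characteristic X) z d)).re) := by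
  refine fderiv_apply_of_line (differentiableAt_momentumDensity n hz hX) ?_
  have h := hasDerivAt_line (differentiableAt_characteristic hX) d
  refine ((hasDerivAt_weight n hz d).mul (hasDerivAt_re
    (((hasDerivAt_coord z d 0 0 (by norm_num)).const_mul I).mul
      (hasDerivAt_conj h)))).congr_deriv ?_
  simp only [zero_smul, add_zero, Pi.mul_apply]
  ring

lemma fderiv_momentumFlux (n : ℝ) {z : Jet 1} (hz : z ∈ regularJets 1)
    (hX : DifferentiableAt ℝ X (base z)) (d : Jet 1) :
    fderiv ℝ (momentumFlux n X) z d = 2 * z.2.1 ^ (n - 1) * ((n - 1) * d.2.1 / z.2.1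
        * (conj (characteristic X z) * coord z 0 1 (by norm_num)).re
      + (conj (fderiv ℝ (characteristic X) z d) * coord z 0 1 (by norm_num)
        + conj (characteristic X z) * coord d 0 1 (by norm_num)).re) := by
  refine fderiv_apply_of_line (differentiableAt_momentumFlux n hz hX) ?_
  have h := hasDerivAt_line (differentiableAt_characteristic hX) d
  refine (((hasDerivAt_weight n hz d).const_mul 2).mul (hasDerivAt_re
    ((hasDerivAt_conj h).mul (hasDerivAt_coord z d 0 1 (by norm_num))))).congr_deriv ?_
  simp only [zero_smul, add_zero, Pi.mul_apply]
  ring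

/-- Integration by parts in the first variation of the Lagrangian. -/
lemma prolongApply_eq_residual (hp2 : p ≠ -2) (hX : DifferentiableAt ℝ X (base z))
    (hz : z ∈ regularJets 2) :
    prolongApply X (lagrangian n p k) z
      = 2 * (base z).2.1 ^ (n - 1) * (residual n p k z
          * conj (characteristic X (trunc one_le_two z))).re
        - totalT (momentumDensity n X) z + totalR (momentumFlux n X) z := by
  have hT : totalT (momentumDensity n X) z = _ :=
    fderiv_momentumDensity n (trunc_mem_regularJets hz) hX (dirT z)
  have hR : totalR (momentumFlux n X) z = _ :=
    fderiv_momentumFlux n (trunc_mem_regularJets hz) hX (dirR z)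
  have eT : fderiv ℝ (characteristic X) (trunc one_le_two z) (dirT z)
    = totalT (characteristic X) z := rfl
  have eR : fderiv ℝ (characteristic X) (trunc one_le_two z) (dirR z)
    = totalR (characteristic X) z := rfl
  rw [hT, hR, eT, eR, prolongApply_lagrangian hp2 hz]
  set P := characteristic X (trunc one_le_two z)
  set Pt := totalT (characteristic X) z
  set Pr := totalR (characteristic X) z
  simp only [residual, coord, trunc, base, dirT, dirR, shiftT, shiftR]
  simp only [mul_re, mul_im, sub_re, sub_im, add_re, I_re, I_im, conj_re, conj_im, ofReal_re,
    ofReal_im]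
  ring

lemma noetherDensity_eq (n p k : ℝ) (X : Base → Base) :
    noetherDensity n p k X = fun z =>
      momentumDensity n X z - (X (base z)).1 * lagrangian n p k z := by
  funext z; simp only [noetherDensity, momentumDensity]; ring

lemma noetherFlux_eq (n p k : ℝ) (X : Base → Base) :
    noetherFlux n p k X = fun z =>
      -momentumFlux n X z - (X (base z)).2.1 * lagrangian n p k z := by
  funext z; simp only [noetherFlux, momentumFlux]; ring

/-- Noether's identity: the multiplier equation of `X` holds up to the Lie derivative of the
Lagrangian along `X`. -/
theorem noether_identity (hp2 : p ≠ -2) (hX : DifferentiableAt ℝ X (base z))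
    (hz : z ∈ regularJets 2) :
    2 * (base z).2.1 ^ (n - 1) * (residual n p k z
        * conj (characteristic X (trunc one_le_two z))).re
      = totalT (noetherDensity n p k X) z + totalR (noetherFlux n p k X) z
        + lieLagrangian n p k X
          (base z, coord z 1 0 (by norm_num), coord z 0 1 (by norm_num)) := by
  have hz1 := trunc_mem_regularJets hz
  have hX1 : DifferentiableAt ℝ X (base (trunc one_le_two z)) := hX
  have dT := differentiableAt_coeff_mul_lagrangian n p k hz1 (f := fun x => (X x).1) hX1.fst
  have dR := differentiableAt_coeff_mul_lagrangian n p k hz1 (f := fun x => (X x).2.1) hX1.snd.fst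
  have hT : totalT (noetherDensity n p k X) z = totalT (momentumDensity n X) z
      - totalT (fun z : Jet 1 => (X (base z)).1 * lagrangian n p k z) z := by
    simp only [totalT]
    rw [noetherDensity_eq, fderiv_fun_sub (differentiableAt_momentumDensity n hz1 hX1) dT]; rfl
  have hR : totalR (noetherFlux n p k X) z = -totalR (momentumFlux n X) z
      - totalR (fun z : Jet 1 => (X (base z)).2.1 * lagrangian n p k z) z := by
    simp only [totalR]
    rw [noetherFlux_eq, fderiv_fun_sub (differentiableAt_momentumFlux n hz1 hX1).fun_neg dR,
      fderiv_fun_neg]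
    rfl
  rw [hT, hR]
  have h1 := prolongApply_eq (n := n) (k := k) hp2 hX hz
  have h2 := prolongApply_eq_residual (n := n) (k := k) hp2 hX hz
  linarith

end NoetherIdentity

/-! ### Variational symmetries and null Lagrangians -/

section

variable {n p k : ℝ} {D : Set Base} {X : Base → Base}

lemma trunc_contDiff {M N : ℕ} (h : M ≤ N) : ContDiff ℝ ∞ (trunc h : Jet N → Jet M) := by
  unfold trunc; fun_prop

lemma fderiv_comp_trunc {M N : ℕ} (h : M ≤ N) {F : Jet M → ℝ} {z : Jet N}
    (hF : DifferentiableAt ℝ F (trunc h z)) (d : Jet N) :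
    fderiv ℝ (fun z => F (trunc h z)) z d = fderiv ℝ F (trunc h z) (trunc h d) :=
  fderiv_apply_of_line (DifferentiableAt.comp z hF
    ((trunc_contDiff h).differentiable (by simp) z)) (hasDerivAt_line hF (trunc h d))

lemma contDiffOn_coeff_mul_lagrangian (n p k : ℝ) (hDr : ∀ x ∈ D, 0 < x.2.1 ∧ x.2.2 ≠ 0)
    {f : Base → ℝ} (hf : ContDiffOn ℝ ∞ f D) :
    ContDiffOn ℝ ∞ (fun z : Jet 1 => f (base z) * lagrangian n p k z) {z | base z ∈ D} :=
  (hf.comp (contDiff_base 1).contDiffOn fun _ hz => hz).mul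
    fun _ hz => (contDiffAt_lagrangian n p k (hDr _ hz)).contDiffWithinAt

/-- A generator that leaves the Lagrangian form `L dt ∧ dr` invariant is variational. -/
theorem isVariational_of_lieLagrangian_eq_zero (hp2 : p ≠ -2) (hD : IsOpen D)
    (hDr : ∀ x ∈ D, 0 < x.2.1 ∧ x.2.2 ≠ 0) (hX : ContDiffOn ℝ ∞ X D)
    (h : ∀ x ∈ D, ∀ v w, lieLagrangian n p k X (x, v, w) = 0) : IsVariational n p k D X := by
  refine ⟨hX, 0, fun z => -((X (base z)).1 * lagrangian n p k z),
    fun z => -((X (base z)).2.1 * lagrangian n p k z),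
    (contDiffOn_coeff_mul_lagrangian n p k hDr hX.fst).neg,
    (contDiffOn_coeff_mul_lagrangian n p k hDr hX.snd.fst).neg, fun z hz => ?_⟩
  have h1 := prolongApply_eq (n := n) (k := k) hp2
    ((hX.contDiffAt (hD.mem_nhds hz)).differentiableAt (by simp)) (hDr _ hz)
  rw [h _ hz] at h1
  have e1 : totalT (fun z : Jet 1 => -((X (base z)).1 * lagrangian n p k z)) z
      = -totalT (fun z : Jet 1 => (X (base z)).1 * lagrangian n p k z) z := by
    simp only [totalT]; rw [fderiv_fun_neg]; rfl
  have e2 : totalR (fun z : Jet 1 => -((X (base z)).2.1 * lagrangian n p k z)) z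
      = -totalR (fun z : Jet 1 => (X (base z)).2.1 * lagrangian n p k z) z := by
    simp only [totalR]; rw [fderiv_fun_neg]; rfl
  have e3 : trunc (Nat.le_add_left 2 0) z = z := rfl
  have goal : prolongApply X (lagrangian n p k) z
      = totalT (fun z : Jet 1 => -((X (base z)).1 * lagrangian n p k z)) z
        + totalR (fun z : Jet 1 => -((X (base z)).2.1 * lagrangian n p k z)) z := by
    rw [e1, e2, h1]; ring
  exact goal

lemma contDiffOn_fderiv_apply {F E : Type*} [NormedAddCommGroup F] [NormedSpace ℝ F]
    [NormedAddCommGroup E] [NormedSpace ℝ E] {s : Set F} (hs : IsOpen s) {f : F → E}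
    (hf : ContDiffOn ℝ ∞ f s) (e : F) : ContDiffOn ℝ ∞ (fun x => fderiv ℝ f x e) s :=
  (hf.fderiv_of_isOpen (m := ∞) hs (by simp)).clm_apply contDiffOn_const

lemma contDiffOn_lieLagrangian (hD : IsOpen D) (hDr : ∀ x ∈ D, 0 < x.2.1 ∧ x.2.2 ≠ 0)
    (hX : ContDiffOn ℝ ∞ X D) : ContDiffOn ℝ ∞ (lieLagrangian n p k X) (D ×ˢ univ) := by
  have mfst : ∀ j ∈ D ×ˢ (univ : Set (ℂ × ℂ)), j.1 ∈ D := fun j hj => hj.1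
  have cX : ContDiffOn ℝ ∞ (fun j : Base × ℂ × ℂ => X j.1) (D ×ˢ univ) :=
    hX.comp contDiffOn_fst mfst
  have cD : ContDiffOn ℝ ∞ (fun j : Base × ℂ × ℂ => fderiv ℝ X j.1) (D ×ˢ univ) :=
    (hX.fderiv_of_isOpen (m := ∞) hD (by simp)).comp contDiffOn_fst mfst
  have cv : ContDiffOn ℝ ∞ (fun j : Base × ℂ × ℂ => j.2.1) (D ×ˢ univ) := by fun_prop
  have cw : ContDiffOn ℝ ∞ (fun j : Base × ℂ × ℂ => j.2.2) (D ×ˢ univ) := by fun_prop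
  have cu : ContDiffOn ℝ ∞ (fun j : Base × ℂ × ℂ => j.1.2.2) (D ×ˢ univ) := by fun_prop
  have cr : ContDiffOn ℝ ∞ (fun j : Base × ℂ × ℂ => j.1.2.1) (D ×ˢ univ) := by fun_prop
  have cT : ContDiffOn ℝ ∞ (fun j : Base × ℂ × ℂ => fderiv ℝ X j.1 (1, 0, j.2.1)) (D ×ˢ univ) :=
    cD.clm_apply (contDiffOn_const.prodMk (contDiffOn_const.prodMk cv))
  have cR : ContDiffOn ℝ ∞ (fun j : Base × ℂ × ℂ => fderiv ℝ X j.1 (0, 1, j.2.2)) (D ×ˢ univ) :=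
    cD.clm_apply (contDiffOn_const.prodMk (contDiffOn_const.prodMk cw))
  have hr0 : ∀ j ∈ D ×ˢ (univ : Set (ℂ × ℂ)), j.1.2.1 ≠ 0 := fun j hj => (hDr _ hj.1).1.ne'
  have hu0 : ∀ j ∈ D ×ˢ (univ : Set (ℂ × ℂ)), j.1.2.2 ≠ 0 := fun j hj => (hDr _ hj.1).2
  have hn0 : ∀ j ∈ D ×ˢ (univ : Set (ℂ × ℂ)), ‖j.1.2.2‖ ≠ 0 := fun j hj =>
    norm_ne_zero_iff.2 (hu0 j hj)
  have cre : ∀ {f : Base × ℂ × ℂ → ℂ}, ContDiffOn ℝ ∞ f (D ×ˢ univ) →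
      ContDiffOn ℝ ∞ (fun j => (f j).re) (D ×ˢ univ) := fun hf => reCLM.contDiff.comp_contDiffOn hf
  have cof : ∀ {f : Base × ℂ × ℂ → ℝ}, ContDiffOn ℝ ∞ f (D ×ˢ univ) →
      ContDiffOn ℝ ∞ (fun j => (f j : ℂ)) (D ×ˢ univ) := fun hf =>
    ofRealCLM.contDiff.comp_contDiffOn hf
  have cconj : ∀ {f : Base × ℂ × ℂ → ℂ}, ContDiffOn ℝ ∞ f (D ×ˢ univ) →
      ContDiffOn ℝ ∞ (fun j => conj (f j)) (D ×ˢ univ) := fun hf =>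
    (conjCLE : ℂ →L[ℝ] ℂ).contDiff.comp_contDiffOn hf
  have cI : ContDiffOn ℝ ∞ (fun _ : Base × ℂ × ℂ => I) (D ×ˢ univ) := contDiffOn_const
  have cn : ContDiffOn ℝ ∞ (fun j : Base × ℂ × ℂ => ‖j.1.2.2‖) (D ×ˢ univ) := cu.norm ℝ hu0
  refine (cr.rpow_const_of_ne hr0).mul ((((ContDiffOn.mul (((((contDiffOn_const.mul
    cX.snd.fst).div cr hr0)).add cT.fst).add cR.snd.fst) ?_).add ?_).add ?_).add ?_ |>.sub ?_)
  · exact ((cre ((cI.mul (cconj cu)).mul cv)).add (cw.norm_sq ℝ)).sub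
      (contDiffOn_const.mul (cn.rpow_const_of_ne hn0))
  · exact cre ((cI.mul (cconj cX.snd.snd)).mul cv)
  · exact cre ((cI.mul (cconj cu)).mul ((cT.snd.snd.sub ((cof cT.fst).mul cv)).sub
      ((cof cT.snd.fst).mul cw)))
  · exact contDiffOn_const.mul (cre ((cconj cw).mul ((cR.snd.snd.sub ((cof cR.fst).mul cv)).sub
      ((cof cR.snd.fst).mul cw))))
  · exact (contDiffOn_const.mul (cn.rpow_const_of_ne hn0)).mul (cre ((cconj cu).mul cX.snd.snd))

/-- For a variational point symmetry the Lie derivative of the Lagrangian, a first order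
differential function, is a null Lagrangian. -/
theorem IsVariational.isNullLagrangian (hp2 : p ≠ -2) (hD : IsOpen D)
    (hDr : ∀ x ∈ D, 0 < x.2.1 ∧ x.2.2 ≠ 0) (h : IsVariational n p k D X) :
    IsNullLagrangian D (lieLagrangian n p k X) := by
  obtain ⟨hX, N, A, B, hA, hB, hAB⟩ := h
  have hT1 := contDiffOn_coeff_mul_lagrangian n p k hDr hX.fst
  have hR1 := contDiffOn_coeff_mul_lagrangian n p k hDr hX.snd.fst
  have h1N : 1 ≤ N + 1 := Nat.le_add_left 1 N
  set FT : Jet 1 → ℝ := fun z => (X (base z)).1 * lagrangian n p k z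
  set FR : Jet 1 → ℝ := fun z => (X (base z)).2.1 * lagrangian n p k z
  have cT : ContDiffOn ℝ ∞ (fun z : Jet (N + 1) => FT (trunc h1N z)) {z | base z ∈ D} :=
    hT1.comp (trunc_contDiff h1N).contDiffOn fun _ hz => hz
  have cR : ContDiffOn ℝ ∞ (fun z : Jet (N + 1) => FR (trunc h1N z)) {z | base z ∈ D} :=
    hR1.comp (trunc_contDiff h1N).contDiffOn fun _ hz => hz
  intro x hx v w vt vr wr ξ
  refine eulerLagrange_of_divergence hD (contDiffOn_lieLagrangian hD hDr hX)
    (hA.add cT) (hB.add cR) (fun z hz => ?_) hx v w vt vr wr ξ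
  have hz' : base (trunc (Nat.le_succ (N + 1)) z) ∈ D := hz
  have hz1 : base (trunc h1N (trunc (Nat.le_succ (N + 1)) z)) ∈ D := hz
  have hmem := (isOpen_base_preimage hD (N + 1)).mem_nhds hz'
  have dFT : DifferentiableAt ℝ FT (trunc h1N (trunc (Nat.le_succ (N + 1)) z)) :=
    (hT1.contDiffAt ((isOpen_base_preimage hD 1).mem_nhds hz1)).differentiableAt (by simp)
  have dFR : DifferentiableAt ℝ FR (trunc h1N (trunc (Nat.le_succ (N + 1)) z)) :=
    (hR1.contDiffAt ((isOpen_base_preimage hD 1).mem_nhds hz1)).differentiableAt (by simp)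
  have eT : totalT (fun z => A z + FT (trunc h1N z)) z
      = totalT A z + totalT FT (trunc (Nat.le_add_left 2 N) z) := by
    simp only [totalT]
    rw [fderiv_fun_add ((hA.contDiffAt hmem).differentiableAt (by simp))
      ((cT.contDiffAt hmem).differentiableAt (by simp)), add_apply, fderiv_comp_trunc h1N dFT]
    rfl
  have eR : totalR (fun z => B z + FR (trunc h1N z)) z
      = totalR B z + totalR FR (trunc (Nat.le_add_left 2 N) z) := by
    simp only [totalR]
    rw [fderiv_fun_add ((hB.contDiffAt hmem).differentiableAt (by simp))
      ((cR.contDiffAt hmem).differentiableAt (by simp)), add_apply, fderiv_comp_trunc h1N dFR]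
    rfl
  have h1 := prolongApply_eq (n := n) (k := k) (z := trunc (Nat.le_add_left 2 N) z) hp2
    ((hX.contDiffAt (hD.mem_nhds hz)).differentiableAt (by simp)) (hDr _ hz)
  rw [hAB z hz] at h1
  have goal : lieLagrangian n p k X (base z, coord z 1 0 (by omega), coord z 0 1 (by omega))
      = totalT (fun z => A z + FT (trunc h1N z)) z
        + totalR (fun z => B z + FR (trunc h1N z)) z := by
    rw [eT, eR]
    have e : lieLagrangian n p k X (base (trunc (Nat.le_add_left 2 N) z),
        coord (trunc (Nat.le_add_left 2 N) z) 1 0 (by omega),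
        coord (trunc (Nat.le_add_left 2 N) z) 0 1 (by omega))
      = lieLagrangian n p k X (base z, coord z 1 0 (by omega), coord z 0 1 (by omega)) := rfl
    rw [← e]
    linarith
  exact goal

end

/-! ### First determining equations -/

section

section Partials

variable {E : Type*} [NormedAddCommGroup E] [NormedSpace ℝ E]

/-- The partial derivative `∂f/∂t` of a function of `(t, r, u)`. -/
noncomputable def tDeriv (f : Base → E) (x : Base) : E := fderiv ℝ f x (1, 0, 0)

/-- The partial derivative `∂f/∂r` of a function of `(t, r, u)`. -/
noncomputable def rDeriv (f : Base → E) (x : Base) : E := fderiv ℝ f x (0, 1, 0)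

/-- The derivative of a function of `(t, r, u)` with respect to `u` in the direction `ξ`. -/
noncomputable def uDeriv (ξ : ℂ) (f : Base → E) (x : Base) : E := fderiv ℝ f x (0, 0, ξ)

variable {D : Set Base} {f g : Base → E} {x : Base}

lemma fderiv_eq_of_eqOn (hD : IsOpen D) (h : EqOn f g D) (hx : x ∈ D) :
    fderiv ℝ f x = fderiv ℝ g x :=
  (h.eventuallyEq_of_mem (hD.mem_nhds hx)).fderiv_eq

lemma tDeriv_congr (hD : IsOpen D) (h : EqOn f g D) (hx : x ∈ D) : tDeriv f x = tDeriv g x := by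
  rw [tDeriv, fderiv_eq_of_eqOn hD h hx, tDeriv]

lemma rDeriv_congr (hD : IsOpen D) (h : EqOn f g D) (hx : x ∈ D) : rDeriv f x = rDeriv g x := by
  rw [rDeriv, fderiv_eq_of_eqOn hD h hx, rDeriv]

lemma uDeriv_congr (hD : IsOpen D) (h : EqOn f g D) (hx : x ∈ D) (ξ : ℂ) :
    uDeriv ξ f x = uDeriv ξ g x := by
  rw [uDeriv, fderiv_eq_of_eqOn hD h hx, uDeriv]

lemma fderiv_split (f : Base → E) (x : Base) (a b : ℝ) (ξ : ℂ) :
    fderiv ℝ f x (a, b, ξ) = a • tDeriv f x + b • rDeriv f x + uDeriv ξ f x := by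
  rw [tDeriv, rDeriv, uDeriv, ← map_smul, ← map_smul, ← map_add, ← map_add]
  simp

lemma uDeriv_eq (f : Base → E) (x : Base) (ξ : ℂ) :
    uDeriv ξ f x = ξ.re • uDeriv 1 f x + ξ.im • uDeriv I f x := by
  rw [uDeriv, uDeriv, uDeriv, ← map_smul, ← map_smul, ← map_add]
  congr 1
  simp [re_add_im]

end Partials

/-- If the Lie derivative of the Lagrangian is affine along rank one directions of the gradient
`(v, w)`, then the parts of degree two and three restrict the first derivatives of the
coefficients of the generator: `T`, `R`, `H` are the derivatives of `τ`, `ρ`, `η` with respect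
to `u`. -/
lemma coefficients_of_rank_one {u ηT ηR c₁ : ℂ} {m V W τT τR ρT ρR : ℝ} {T R : ℂ → ℝ} {H : ℂ → ℂ}
    (hT : ∀ a b, T (a + b) = T a + T b) (hR : ∀ a b, R (a + b) = R a + R b)
    (hH : ∀ a b, H (a + b) = H a + H b)
    (hTn : ∀ a, T (-a) = -T a) (hRn : ∀ a, R (-a) = -R a) (hHn : ∀ a, H (-a) = -H a)
    {g : ℂ → ℂ → ℝ} (hg : ∀ v w, g v w = (m + (τT + T v) + (ρR + R w))
        * ((I * conj u * v).re + ‖w‖ ^ 2 - V) + (I * conj c₁ * v).re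
      + (I * conj u * ((ηT + H v) - ((τT + T v : ℝ) : ℂ) * v - ((ρT + R v : ℝ) : ℂ) * w)).re
      + 2 * (conj w * ((ηR + H w) - ((τR + T w : ℝ) : ℂ) * v - ((ρR + R w : ℝ) : ℂ) * w)).re - W)
    (h : ∀ v w ξ : ℂ, ∀ a b : ℝ,
      g (v + a * ξ) (w + b * ξ) + g (v - a * ξ) (w - b * ξ) = 2 * g v w) (ξ : ℂ) :
    T ξ = 0 ∧ R ξ = 0 ∧ τR = 0 ∧ 2 * (conj ξ * H ξ).re = -(m + τT - ρR) * ‖ξ‖ ^ 2 := by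
  have T0 : T 0 = 0 := by simpa using hT 0 0
  have R0 : R 0 = 0 := by simpa using hR 0 0
  have H0 : H 0 = 0 := by simpa using hH 0 0
  have hRz : ∀ ξ, R ξ = 0 := by
    intro ξ
    by_cases hξ : ξ = 0
    · rw [hξ, R0]
    have k1 := h 0 ξ ξ 0 1
    have k2 := h 0 0 ξ 0 1
    have e : ‖ξ‖ ^ 2 * R ξ = 0 := by
      simp only [ofReal_zero, ofReal_one, zero_mul, one_mul, sub_self, zero_add, zero_sub,
        add_zero, hg, hT, hR, hH, hTn, hRn, hHn, T0, R0, H0, ← normSq_eq_norm_sq, normSq_apply]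
        at k1 k2 ⊢
      simp at k1 k2
      linear_combination (1 / 6) * k2 - (1 / 6) * k1
    rcases mul_eq_zero.1 e with h1 | h1
    · exact absurd h1 (by positivity)
    · exact h1
  have hTz : ∀ ξ, T ξ = 0 := by
    intro ξ
    by_cases hξ : ξ = 0
    · rw [hξ, T0]
    have k1 := h ξ ξ ξ 1 1
    have k2 := h 0 0 ξ 1 1
    have e : ‖ξ‖ ^ 2 * T ξ = 0 := by
      simp only [ofReal_one, one_mul, sub_self, zero_add, zero_sub,
        add_zero, hg, hT, hRz, hH, hTn, hHn, T0, H0, ← normSq_eq_norm_sq, normSq_apply]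
        at k1 k2 ⊢
      simp at k1 k2
      linear_combination (1 / 6) * k2 - (1 / 6) * k1
    rcases mul_eq_zero.1 e with h1 | h1
    · exact absurd h1 (by positivity)
    · exact h1
  have quad : ∀ ξ, 2 * (conj ξ * H ξ).re = -(m + τT - ρR) * ‖ξ‖ ^ 2 := by
    intro ξ
    have k := h 0 0 ξ 0 1
    simp only [ofReal_zero, ofReal_one, zero_mul, one_mul, sub_self, zero_add, zero_sub,
      add_zero, hg, hRz, hTz, hHn, H0, ← normSq_eq_norm_sq, normSq_apply] at k ⊢
    simp at k ⊢
    linear_combination (1 / 2) * k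
  refine ⟨hTz ξ, hRz ξ, ?_, quad ξ⟩
  have k := h 0 0 1 1 1
  have q := quad 1
  simp only [ofReal_one, one_mul, zero_add, zero_sub,
    add_zero, hg, hRz, hTz, hHn, H0, ← normSq_eq_norm_sq, normSq_apply] at k q
  simp at k q
  linear_combination (-1 / 4) * k + (1 / 2) * q

/-- The coefficient `τ` of a generator. -/
abbrev tau (X : Base → Base) (x : Base) : ℝ := (X x).1

/-- The coefficient `ρ` of a generator. -/
abbrev rho (X : Base → Base) (x : Base) : ℝ := (X x).2.1

/-- The coefficient `η` of a generator. -/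
abbrev eta (X : Base → Base) (x : Base) : ℂ := (X x).2.2

/-- The scalar `τ_t - ρ_r + (n - 1) ρ / r`, minus twice the real part of `η_u`. -/
noncomputable def sigma (n : ℝ) (X : Base → Base) (x : Base) : ℝ :=
  tDeriv (tau X) x - rDeriv (rho X) x + (n - 1) * rho X x / x.2.1

/-- The complex derivative `η_u`. -/
noncomputable def alpha (X : Base → Base) (x : Base) : ℂ := uDeriv 1 (eta X) x

/-- The first determining equations: `τ_u = ρ_u = 0`, `τ_r = 0`, and `η` is holomorphic in `u`
with `Re η_u = -σ / 2`. -/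
structure FirstDetermining (n : ℝ) (D : Set Base) (X : Base → Base) : Prop where
  isOpen : IsOpen D
  regular : ∀ x ∈ D, 0 < x.2.1 ∧ x.2.2 ≠ 0
  smooth : ContDiffOn ℝ ∞ X D
  tau_u : ∀ x ∈ D, ∀ ξ, uDeriv ξ (tau X) x = 0
  rho_u : ∀ x ∈ D, ∀ ξ, uDeriv ξ (rho X) x = 0
  tau_r : ∀ x ∈ D, rDeriv (tau X) x = 0
  eta_u : ∀ x ∈ D, ∀ ξ, uDeriv ξ (eta X) x = alpha X x * ξ
  re_alpha : ∀ x ∈ D, (alpha X x).re = -(sigma n X x) / 2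

variable {n p k : ℝ} {D : Set Base} {X : Base → Base}

lemma lieLagrangian_eq {x : Base} (hX : DifferentiableAt ℝ X x) (v w : ℂ) :
    lieLagrangian n p k X (x, v, w) = x.2.1 ^ (n - 1) *
      (((n - 1) * rho X x / x.2.1
          + (tDeriv (tau X) x + uDeriv v (tau X) x)
          + (rDeriv (rho X) x + uDeriv w (rho X) x))
        * ((I * conj x.2.2 * v).re + ‖w‖ ^ 2 - 2 / (p + 2) * k * ‖x.2.2‖ ^ (p + 2))
      + (I * conj (eta X x) * v).re
      + (I * conj x.2.2 * ((tDeriv (eta X) x + uDeriv v (eta X) x)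
          - ((tDeriv (tau X) x + uDeriv v (tau X) x : ℝ) : ℂ) * v
          - ((tDeriv (rho X) x + uDeriv v (rho X) x : ℝ) : ℂ) * w)).re
      + 2 * (conj w * ((rDeriv (eta X) x + uDeriv w (eta X) x)
          - ((rDeriv (tau X) x + uDeriv w (tau X) x : ℝ) : ℂ) * v
          - ((rDeriv (rho X) x + uDeriv w (rho X) x : ℝ) : ℂ) * w)).re
      - 2 * k * ‖x.2.2‖ ^ p * (conj x.2.2 * eta X x).re) := by
  have e1 : ∀ d, (fderiv ℝ X x d).1 = fderiv ℝ (tau X) x d := fun d => by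
    rw [hX.hasFDerivAt.fst.fderiv]; rfl
  have e2 : ∀ d, (fderiv ℝ X x d).2.1 = fderiv ℝ (rho X) x d := fun d => by
    rw [hX.hasFDerivAt.snd.fst.fderiv]; rfl
  have e3 : ∀ d, (fderiv ℝ X x d).2.2 = fderiv ℝ (eta X) x d := fun d => by
    rw [hX.hasFDerivAt.snd.snd.fderiv]; rfl
  simp only [lieLagrangian, lagrangianDensity, e1, e2, e3]
  simp only [fderiv_split, one_smul, zero_smul,
    add_zero, zero_add]

/-- The parts of degree two and three in the gradient of the Lie derivative of the Lagrangian give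
the first determining equations; `η` is holomorphic in `u` because `Re (ξ̄ η_u ξ)` is a multiple
of `|ξ|²`. -/
theorem IsNullLagrangian.firstDetermining (hD : IsOpen D) (hDr : ∀ x ∈ D, 0 < x.2.1 ∧ x.2.2 ≠ 0)
    (hX : ContDiffOn ℝ ∞ X D) (h : IsNullLagrangian D (lieLagrangian n p k X)) :
    FirstDetermining n D X := by
  have key : ∀ x ∈ D, ∀ ξ, uDeriv ξ (tau X) x = 0 ∧ uDeriv ξ (rho X) x = 0 ∧
      rDeriv (tau X) x = 0 ∧
      2 * (conj ξ * uDeriv ξ (eta X) x).re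
        = -((n - 1) * rho X x / x.2.1 + tDeriv (tau X) x
          - rDeriv (rho X) x) * ‖ξ‖ ^ 2 := by
    intro x hx ξ
    have hXd : DifferentiableAt ℝ X x := (hX.contDiffAt (hD.mem_nhds hx)).differentiableAt (by simp)
    have hr : x.2.1 ^ (n - 1) ≠ 0 := (Real.rpow_pos_of_pos (hDr x hx).1 _).ne'
    have hadd : ∀ {E : Type} [NormedAddCommGroup E] [NormedSpace ℝ E] (f : Base → E) (a b : ℂ),
        uDeriv (a + b) f x = uDeriv a f x + uDeriv b f x := fun f a b => by
      simp only [uDeriv]; rw [← map_add]; simp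
    have hneg : ∀ {E : Type} [NormedAddCommGroup E] [NormedSpace ℝ E] (f : Base → E) (a : ℂ),
        uDeriv (-a) f x = -uDeriv a f x := fun f a => by
      simp only [uDeriv]; rw [← map_neg]; simp
    refine coefficients_of_rank_one (T := fun ξ => uDeriv ξ (tau X) x)
      (R := fun ξ => uDeriv ξ (rho X) x)
      (H := fun ξ => uDeriv ξ (eta X) x) (u := x.2.2) (c₁ := eta X x)
      (ηT := tDeriv (eta X) x) (ηR := rDeriv (eta X) x)
      (ρT := tDeriv (rho X) x) (V := 2 / (p + 2) * k * ‖x.2.2‖ ^ (p + 2))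
      (W := 2 * k * ‖x.2.2‖ ^ p * (conj x.2.2 * eta X x).re) (hadd _) (hadd _) (hadd _)
      (hneg _) (hneg _) (hneg _) (fun v w => rfl) (fun v w ξ a b => ?_) ξ
    have h1 := h.rank_one hD (contDiffOn_lieLagrangian hD hDr hX) hx v w ξ a b
    rw [lieLagrangian_eq hXd, lieLagrangian_eq hXd, lieLagrangian_eq hXd] at h1
    refine mul_left_cancel₀ hr ?_
    rw [mul_add, h1]
    ring
  have hlin : ∀ x ∈ D, uDeriv I (eta X) x = I * alpha X x ∧
      (alpha X x).re = -(sigma n X x) / 2 := by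
    intro x hx
    have k1 := (key x hx 1).2.2.2
    have k2 := (key x hx I).2.2.2
    have k3 := (key x hx (1 + I)).2.2.2
    rw [uDeriv_eq _ x (1 + I)] at k3
    simp only [← normSq_eq_norm_sq, normSq_apply] at k1 k2 k3
    simp at k1 k2 k3
    refine ⟨Complex.ext ?_ ?_, ?_⟩
    · simp only [alpha, mul_re, I_re, I_im]
      linarith
    · simp only [alpha, mul_im, I_re, I_im]
      linarith
    · simp only [alpha, sigma]
      linarith
  refine ⟨hD, hDr, hX, fun x hx ξ => (key x hx ξ).1, fun x hx ξ => (key x hx ξ).2.1,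
    fun x hx => (key x hx 0).2.2.1, fun x hx ξ => ?_, fun x hx => (hlin x hx).2⟩
  rw [uDeriv_eq, (hlin x hx).1]
  change ξ.re • alpha X x + _ = _
  conv_rhs => rw [← re_add_im ξ]
  simp only [real_smul]
  ring

end

/-! ### Consequences of the first determining equations -/

section PartialCalculus

variable {E : Type*} [NormedAddCommGroup E] [NormedSpace ℝ E] {D : Set Base} {f : Base → E}
  {x : Base}

lemma differentiableAt_of_mem (hD : IsOpen D) (hf : ContDiffOn ℝ ∞ f D) (hx : x ∈ D) :
    DifferentiableAt ℝ f x :=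
  (hf.contDiffAt (hD.mem_nhds hx)).differentiableAt (by simp)

lemma fderiv_comm_of_eqOn (hD : IsOpen D) (hf : ContDiffOn ℝ ∞ f D) (hx : x ∈ D) {d e : Base}
    {g : Base → E} (h : EqOn (fun x => fderiv ℝ f x e) g D) :
    fderiv ℝ (fun x => fderiv ℝ f x d) x e = fderiv ℝ g x d := by
  rw [fderiv_fderiv_comm (hf.contDiffAt (hD.mem_nhds hx)), fderiv_eq_of_eqOn hD h hx]

lemma fderiv_comm_of_eqOn_zero (hD : IsOpen D) (hf : ContDiffOn ℝ ∞ f D) (hx : x ∈ D)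
    {d e : Base} (h : ∀ x ∈ D, fderiv ℝ f x e = 0) :
    fderiv ℝ (fun x => fderiv ℝ f x d) x e = 0 := by
  rw [fderiv_comm_of_eqOn hD hf hx (g := fun _ => 0) h]; simp

lemma fderiv_weight_smul (n : ℝ) (hr : x.2.1 ≠ 0) (hf : DifferentiableAt ℝ f x) (d : Base) :
    fderiv ℝ (fun x => x.2.1 ^ (n - 1) • f x) x d
      = x.2.1 ^ (n - 1) • (((n - 1) * d.2.1 / x.2.1) • f x + fderiv ℝ f x d) := by
  have hw : HasDerivAt (fun s : ℝ => (x + s • d).2.1 ^ (n - 1))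
      (x.2.1 ^ (n - 1) * ((n - 1) * d.2.1 / x.2.1)) 0 := by
    have h1 : HasDerivAt (fun s : ℝ => (x + s • d).2.1) d.2.1 0 := hasDerivAt_add_smul x.2.1 d.2.1
    refine (h1.rpow_const (p := n - 1) (Or.inl (by simpa using hr))).congr_deriv ?_
    simp only [zero_smul, add_zero, Real.rpow_sub_one hr]
    ring
  refine fderiv_apply_of_line (((by fun_prop : DifferentiableAt ℝ (fun x : Base => x.2.1)
    x).rpow_const (Or.inl hr)).smul hf) ?_
  refine (hw.smul (hasDerivAt_line hf d)).congr_deriv ?_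
  simp only [zero_smul, add_zero, smul_add, smul_smul]
  rw [add_comm]

end PartialCalculus

/-- The divergence `ρ_r + (n - 1) ρ / r` of the radial part of a generator. -/
noncomputable def kappa (n : ℝ) (X : Base → Base) (x : Base) : ℝ :=
  rDeriv (rho X) x + (n - 1) * rho X x / x.2.1

lemma sigma_eq (n : ℝ) (X : Base → Base) (x : Base) :
    sigma n X x = kappa n X x + tDeriv (tau X) x - 2 * rDeriv (rho X) x := by
  simp only [sigma, kappa]; ring

namespace FirstDetermining

variable {n : ℝ} {D : Set Base} {X : Base → Base} {x : Base}

lemma smooth_tau (h : FirstDetermining n D X) : ContDiffOn ℝ ∞ (tau X) D := h.smooth.fst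

lemma smooth_rho (h : FirstDetermining n D X) : ContDiffOn ℝ ∞ (rho X) D := h.smooth.snd.fst

lemma smooth_eta (h : FirstDetermining n D X) : ContDiffOn ℝ ∞ (eta X) D := h.smooth.snd.snd

lemma smooth_alpha (h : FirstDetermining n D X) : ContDiffOn ℝ ∞ (alpha X) D :=
  contDiffOn_fderiv_apply h.isOpen h.smooth_eta _

lemma tau_tu (h : FirstDetermining n D X) (hx : x ∈ D) (ξ : ℂ) : uDeriv ξ (tDeriv (tau X)) x = 0 :=
  fderiv_comm_of_eqOn_zero h.isOpen h.smooth_tau hx fun x hx => h.tau_u x hx ξ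

lemma tau_tr (h : FirstDetermining n D X) (hx : x ∈ D) : rDeriv (tDeriv (tau X)) x = 0 :=
  fderiv_comm_of_eqOn_zero h.isOpen h.smooth_tau hx h.tau_r

lemma rho_tu (h : FirstDetermining n D X) (hx : x ∈ D) (ξ : ℂ) : uDeriv ξ (tDeriv (rho X)) x = 0 :=
  fderiv_comm_of_eqOn_zero h.isOpen h.smooth_rho hx fun x hx => h.rho_u x hx ξ

lemma rho_ru (h : FirstDetermining n D X) (hx : x ∈ D) (ξ : ℂ) : uDeriv ξ (rDeriv (rho X)) x = 0 :=
  fderiv_comm_of_eqOn_zero h.isOpen h.smooth_rho hx fun x hx => h.rho_u x hx ξ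

lemma smooth_kappa (h : FirstDetermining n D X) : ContDiffOn ℝ ∞ (kappa n X) D :=
  (contDiffOn_fderiv_apply h.isOpen h.smooth_rho _).add ((contDiffOn_const.mul h.smooth_rho).div
    (by fun_prop) fun x hx => (h.regular x hx).1.ne')

lemma fderiv_kappa (h : FirstDetermining n D X) (hx : x ∈ D) (d : Base) :
    fderiv ℝ (kappa n X) x d = fderiv ℝ (rDeriv (rho X)) x d
      + (n - 1) * (fderiv ℝ (rho X) x d / x.2.1 - rho X x * d.2.1 / x.2.1 ^ 2) := by
  have hr : x.2.1 ≠ 0 := (h.regular x hx).1.ne'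
  have d1 : DifferentiableAt ℝ (rDeriv (rho X)) x :=
    differentiableAt_of_mem h.isOpen (contDiffOn_fderiv_apply h.isOpen h.smooth_rho _) hx
  have d2 : DifferentiableAt ℝ (rho X) x := differentiableAt_of_mem h.isOpen h.smooth_rho hx
  refine fderiv_apply_of_line (differentiableAt_of_mem h.isOpen h.smooth_kappa hx) ?_
  refine ((hasDerivAt_line d1 d).add (((hasDerivAt_line d2 d).const_mul (n - 1)).div
    (hasDerivAt_add_smul x.2.1 d.2.1) (by simpa using hr))).congr_deriv ?_
  simp only [zero_smul, add_zero]
  field_simp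

lemma kappa_u (h : FirstDetermining n D X) (hx : x ∈ D) (ξ : ℂ) : uDeriv ξ (kappa n X) x = 0 := by
  have h1 := h.rho_ru hx ξ
  have h2 := h.rho_u x hx ξ
  rw [uDeriv] at h1 h2 ⊢
  rw [h.fderiv_kappa hx, h1, h2]; simp

lemma sigma_u (h : FirstDetermining n D X) (hx : x ∈ D) (ξ : ℂ) : uDeriv ξ (sigma n X) x = 0 := by
  have d1 := differentiableAt_of_mem h.isOpen (h.smooth_kappa) hx
  have d2 : DifferentiableAt ℝ (tDeriv (tau X)) x :=
    differentiableAt_of_mem h.isOpen (contDiffOn_fderiv_apply h.isOpen h.smooth_tau _) hx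
  have d3 : DifferentiableAt ℝ (rDeriv (rho X)) x :=
    differentiableAt_of_mem h.isOpen (contDiffOn_fderiv_apply h.isOpen h.smooth_rho _) hx
  have e1 := h.kappa_u hx ξ
  have e2 := h.tau_tu hx ξ
  have e3 := h.rho_ru hx ξ
  rw [uDeriv] at e1 e2 e3 ⊢
  rw [funext (sigma_eq n X), fderiv_fun_sub (d1.fun_add d2) (d3.const_mul 2),
    fderiv_fun_add d1 d2, fderiv_const_mul d3]
  simp [e1, e2, e3]

/-- `η_u` does not depend on `u`: it is holomorphic in `u`, and its real part does not depend
on `u`. -/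
lemma alpha_u (h : FirstDetermining n D X) (hx : x ∈ D) (ξ : ℂ) : uDeriv ξ (alpha X) x = 0 := by
  have dα := differentiableAt_of_mem h.isOpen (h.smooth_alpha) hx
  have hI : uDeriv I (alpha X) x = I * uDeriv 1 (alpha X) x := by
    have h1 : uDeriv I (alpha X) x = fderiv ℝ (fun x => alpha X x * I) x (0, 0, 1) :=
      fderiv_comm_of_eqOn h.isOpen h.smooth_eta hx fun x hx => h.eta_u x hx I
    rw [h1, fderiv_mul_const dα]
    simp [uDeriv]
  have hre : ∀ ξ, (uDeriv ξ (alpha X) x).re = 0 := by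
    intro ξ
    have e1 : EqOn (fun x => (alpha X x).re) (fun x => (-1 / 2) * sigma n X x) D := fun x hx => by
      simp only [h.re_alpha x hx]; ring
    have e2 : uDeriv ξ (fun x => (alpha X x).re) x = (uDeriv ξ (alpha X) x).re :=
      fderiv_apply_of_line (reCLM.differentiableAt.comp x dα)
        (hasDerivAt_re (hasDerivAt_line dα _))
    rw [← e2, uDeriv_congr h.isOpen e1 hx, uDeriv, fderiv_const_mul]
    · have := h.sigma_u hx ξ
      rw [uDeriv] at this
      simp [this]
    · have e3 : EqOn (sigma n X) (fun x => -2 * (alpha X x).re) D := fun x hx => by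
        simp only [h.re_alpha x hx]; ring
      exact ((reCLM.differentiableAt.comp x dα).const_mul (-2)).congr_of_eventuallyEq
        (e3.eventuallyEq_of_mem (h.isOpen.mem_nhds hx))
  have h1 : uDeriv 1 (alpha X) x = 0 := by
    refine Complex.ext (hre 1) ?_
    have := hre I
    rw [hI] at this
    simpa using this
  rw [uDeriv_eq, hI, h1]; simp

lemma eta_ru (h : FirstDetermining n D X) (hx : x ∈ D) (ξ : ℂ) :
    uDeriv ξ (rDeriv (eta X)) x = rDeriv (alpha X) x * ξ := by
  have h1 : uDeriv ξ (rDeriv (eta X)) x = fderiv ℝ (fun x => alpha X x * ξ) x (0, 1, 0) :=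
    fderiv_comm_of_eqOn h.isOpen h.smooth_eta hx fun x hx => h.eta_u x hx ξ
  rw [h1, fderiv_mul_const (differentiableAt_of_mem h.isOpen (h.smooth_alpha) hx)]
  simp [rDeriv, mul_comm]

lemma eta_tu (h : FirstDetermining n D X) (hx : x ∈ D) (ξ : ℂ) :
    uDeriv ξ (tDeriv (eta X)) x = tDeriv (alpha X) x * ξ := by
  have h1 : uDeriv ξ (tDeriv (eta X)) x = fderiv ℝ (fun x => alpha X x * ξ) x (1, 0, 0) :=
    fderiv_comm_of_eqOn h.isOpen h.smooth_eta hx fun x hx => h.eta_u x hx ξ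
  rw [h1, fderiv_mul_const (differentiableAt_of_mem h.isOpen (h.smooth_alpha) hx)]
  simp [tDeriv, mul_comm]

end FirstDetermining

/-! ### Second determining equations -/

section Smoothness

variable {D : Set Base}

lemma contDiffOn_conj {f : Base → ℂ} (hf : ContDiffOn ℝ ∞ f D) :
    ContDiffOn ℝ ∞ (fun x => conj (f x)) D :=
  (conjCLE : ℂ →L[ℝ] ℂ).contDiff.comp_contDiffOn hf

lemma contDiffOn_re {f : Base → ℂ} (hf : ContDiffOn ℝ ∞ f D) :
    ContDiffOn ℝ ∞ (fun x => (f x).re) D :=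
  reCLM.contDiff.comp_contDiffOn hf

lemma contDiffOn_ofReal {f : Base → ℝ} (hf : ContDiffOn ℝ ∞ f D) :
    ContDiffOn ℝ ∞ (fun x => (f x : ℂ)) D :=
  ofRealCLM.contDiff.comp_contDiffOn hf

lemma contDiffOn_u : ContDiffOn ℝ ∞ (fun x : Base => x.2.2) D := by fun_prop

end Smoothness

/-- The coefficient of `u_t` in the Lie derivative of the Lagrangian, without its weight. -/
noncomputable def timeCoeff (n : ℝ) (X : Base → Base) (x : Base) : ℂ :=
  -I * (x.2.2 * kappa n X x + eta X x + x.2.2 * conj (alpha X x))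

/-- The coefficient of `u_r` in the Lie derivative of the Lagrangian, without its weight. -/
noncomputable def radialCoeff (X : Base → Base) (x : Base) : ℂ :=
  2 * rDeriv (eta X) x + I * tDeriv (rho X) x * x.2.2

/-- The part of order zero of the Lie derivative of the Lagrangian, without its weight. -/
noncomputable def zerothCoeff (n p k : ℝ) (X : Base → Base) (x : Base) : ℝ :=
  -(kappa n X x + tDeriv (tau X) x) * (2 / (p + 2) * k * ‖x.2.2‖ ^ (p + 2))
    + (I * conj x.2.2 * tDeriv (eta X) x).re - 2 * k * ‖x.2.2‖ ^ p * (conj x.2.2 * eta X x).re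

namespace FirstDetermining

variable {n p k : ℝ} {D : Set Base} {X : Base → Base} {x : Base}

lemma lieLagrangian_affine (h : FirstDetermining n D X) (hx : x ∈ D) (v w : ℂ) :
    lieLagrangian n p k X (x, v, w) = x.2.1 ^ (n - 1) • zerothCoeff n p k X x
      + (conj (x.2.1 ^ (n - 1) • timeCoeff n X x) * v).re
      + (conj (x.2.1 ^ (n - 1) • radialCoeff X x) * w).re := by
  have hre := h.re_alpha x hx
  rw [lieLagrangian_eq (differentiableAt_of_mem h.isOpen h.smooth hx), h.tau_u x hx,
    h.tau_u x hx, h.rho_u x hx, h.rho_u x hx, h.tau_r x hx, h.eta_u x hx, h.eta_u x hx]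
  have hre' : tDeriv (tau X) x = -2 * (alpha X x).re - kappa n X x + 2 * rDeriv (rho X) x := by
    have := sigma_eq n X x
    linarith
  have hκ : (n - 1) * rho X x / x.2.1 = kappa n X x - rDeriv (rho X) x := by
    simp only [kappa]; ring
  simp only [zerothCoeff, timeCoeff, radialCoeff, hκ, hre', smul_eq_mul, real_smul]
  simp only [← normSq_eq_norm_sq, normSq_apply]
  generalize x.2.1 ^ (n - 1) = q
  simp only [map_add, map_mul, map_neg, conj_ofReal, mul_re, mul_im, sub_re, sub_im,
    add_re, add_im, neg_re, neg_im, I_re, I_im, conj_re, conj_im, ofReal_re, ofReal_im, conj_conj,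
    re_ofNat, im_ofNat, map_ofNat, conj_I]
  ring

lemma smooth_timeCoeff (h : FirstDetermining n D X) : ContDiffOn ℝ ∞ (timeCoeff n X) D :=
  contDiffOn_const.mul (((contDiffOn_u.mul (contDiffOn_ofReal h.smooth_kappa)).add
    h.smooth_eta).add (contDiffOn_u.mul (contDiffOn_conj h.smooth_alpha)))

lemma smooth_radialCoeff (h : FirstDetermining n D X) : ContDiffOn ℝ ∞ (radialCoeff X) D :=
  (contDiffOn_const.mul (contDiffOn_fderiv_apply h.isOpen h.smooth_eta _)).add
    ((contDiffOn_const.mul (contDiffOn_ofReal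
      (contDiffOn_fderiv_apply h.isOpen h.smooth_rho _))).mul contDiffOn_u)

lemma smooth_zerothCoeff (h : FirstDetermining n D X) :
    ContDiffOn ℝ ∞ (zerothCoeff n p k X) D := by
  have hn : ContDiffOn ℝ ∞ (fun x : Base => ‖x.2.2‖) D :=
    contDiffOn_u.norm ℝ fun x hx => (h.regular x hx).2
  have hn0 : ∀ x ∈ D, ‖x.2.2‖ ≠ 0 := fun x hx => norm_ne_zero_iff.2 (h.regular x hx).2
  exact (((h.smooth_kappa.add (contDiffOn_fderiv_apply h.isOpen h.smooth_tau _)).neg.mul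
    (contDiffOn_const.mul (hn.rpow_const_of_ne hn0))).add (contDiffOn_re ((contDiffOn_const.mul
      (contDiffOn_conj contDiffOn_u)).mul (contDiffOn_fderiv_apply h.isOpen h.smooth_eta _)))).sub
    ((contDiffOn_const.mul (hn.rpow_const_of_ne hn0)).mul (contDiffOn_re
      ((contDiffOn_conj contDiffOn_u).mul h.smooth_eta)))

lemma smooth_weight (h : FirstDetermining n D X) :
    ContDiffOn ℝ ∞ (fun x : Base => x.2.1 ^ (n - 1)) D :=
  (by fun_prop : ContDiffOn ℝ ∞ (fun x : Base => x.2.1) D).rpow_const_of_ne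
    fun x hx => (h.regular x hx).1.ne'

lemma fderiv_timeCoeff (h : FirstDetermining n D X) (hx : x ∈ D) (d : Base) :
    fderiv ℝ (timeCoeff n X) x d = -I * (d.2.2 * kappa n X x + x.2.2 * fderiv ℝ (kappa n X) x d
      + fderiv ℝ (eta X) x d + d.2.2 * conj (alpha X x)
      + x.2.2 * conj (fderiv ℝ (alpha X) x d)) := by
  refine fderiv_apply_of_line (differentiableAt_of_mem h.isOpen h.smooth_timeCoeff hx) ?_
  have h1 := hasDerivAt_line (differentiableAt_of_mem h.isOpen h.smooth_kappa hx) d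
  have h2 := hasDerivAt_line (differentiableAt_of_mem h.isOpen h.smooth_eta hx) d
  have h3 := hasDerivAt_line (differentiableAt_of_mem h.isOpen h.smooth_alpha hx) d
  have hu := hasDerivAt_add_smul x.2.2 d.2.2
  refine ((((hu.mul h1.ofReal_comp).add h2).add (hu.mul (hasDerivAt_conj h3))).const_mul
    (-I)).congr_deriv ?_
  simp only [zero_smul, add_zero]
  ring

lemma fderiv_radialCoeff (h : FirstDetermining n D X) (hx : x ∈ D) (d : Base) :
    fderiv ℝ (radialCoeff X) x d = 2 * fderiv ℝ (rDeriv (eta X)) x d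
      + I * (fderiv ℝ (tDeriv (rho X)) x d * x.2.2 + tDeriv (rho X) x * d.2.2) := by
  refine fderiv_apply_of_line (differentiableAt_of_mem h.isOpen h.smooth_radialCoeff hx) ?_
  have h1 : HasDerivAt (fun s : ℝ => rDeriv (eta X) (x + s • d))
      (fderiv ℝ (rDeriv (eta X)) x d) 0 :=
    hasDerivAt_line (differentiableAt_of_mem h.isOpen
      (contDiffOn_fderiv_apply h.isOpen h.smooth_eta _) hx) d
  have h2 : HasDerivAt (fun s : ℝ => tDeriv (rho X) (x + s • d))
      (fderiv ℝ (tDeriv (rho X)) x d) 0 :=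
    hasDerivAt_line (differentiableAt_of_mem h.isOpen
      (contDiffOn_fderiv_apply h.isOpen h.smooth_rho _) hx) d
  have hu := hasDerivAt_add_smul x.2.2 d.2.2
  refine ((h1.const_mul 2).add ((h2.ofReal_comp.const_mul I).mul hu)).congr_deriv ?_
  simp only [zero_smul, add_zero]
  ring

lemma uDeriv_zerothCoeff (h : FirstDetermining n D X) (hp2 : p ≠ -2) (hx : x ∈ D) (ξ : ℂ) :
    fderiv ℝ (zerothCoeff n p k X) x (0, 0, ξ)
      = -(kappa n X x + tDeriv (tau X) x) * (2 * k * ‖x.2.2‖ ^ p * (conj x.2.2 * ξ).re)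
        + (I * conj ξ * tDeriv (eta X) x + I * conj x.2.2 * (tDeriv (alpha X) x * ξ)).re
        - 2 * k * (p * ‖x.2.2‖ ^ (p - 2) * (conj x.2.2 * ξ).re * (conj x.2.2 * eta X x).re
          + ‖x.2.2‖ ^ p * (conj ξ * eta X x + conj x.2.2 * (alpha X x * ξ)).re) := by
  refine fderiv_apply_of_line (differentiableAt_of_mem h.isOpen h.smooth_zerothCoeff hx) ?_
  have h1 := hasDerivAt_line (differentiableAt_of_mem h.isOpen h.smooth_kappa hx) (0, 0, ξ)
  have h2 : HasDerivAt (fun s : ℝ => tDeriv (tau X) (x + s • (0, 0, ξ))) _ 0 :=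
    hasDerivAt_line (differentiableAt_of_mem h.isOpen
      (contDiffOn_fderiv_apply h.isOpen h.smooth_tau _) hx) (0, 0, ξ)
  have h3 : HasDerivAt (fun s : ℝ => tDeriv (eta X) (x + s • (0, 0, ξ))) _ 0 :=
    hasDerivAt_line (differentiableAt_of_mem h.isOpen
      (contDiffOn_fderiv_apply h.isOpen h.smooth_eta _) hx) (0, 0, ξ)
  have h4 := hasDerivAt_line (differentiableAt_of_mem h.isOpen h.smooth_eta hx) (0, 0, ξ)
  have e1 : fderiv ℝ (kappa n X) x (0, 0, ξ) = 0 := h.kappa_u hx ξ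
  have e2 : fderiv ℝ (fun x => fderiv ℝ (tau X) x (1, 0, 0)) x (0, 0, ξ) = 0 := h.tau_tu hx ξ
  have e3 : fderiv ℝ (fun x => fderiv ℝ (eta X) x (1, 0, 0)) x (0, 0, ξ)
    = tDeriv (alpha X) x * ξ := h.eta_tu hx ξ
  have e4 : fderiv ℝ (eta X) x (0, 0, ξ) = alpha X x * ξ := h.eta_u x hx ξ
  rw [e1] at h1
  rw [e2] at h2
  rw [e3] at h3
  rw [e4] at h4
  have hu := hasDerivAt_add_smul x.2.2 ξ
  have hu0 : x.2.2 + (0 : ℝ) • ξ ≠ 0 := by simpa using (h.regular x hx).2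
  have hp2' : p + 2 ≠ 0 := fun h => hp2 (by linarith)
  refine ((((h1.add h2).neg.mul ((hasDerivAt_norm_rpow hu hu0 (p + 2)).const_mul
    (2 / (p + 2) * k))).add (hasDerivAt_re (((hasDerivAt_conj hu).const_mul I).mul h3))).sub
    (((hasDerivAt_norm_rpow hu hu0 p).const_mul (2 * k)).mul
      (hasDerivAt_re ((hasDerivAt_conj hu).mul h4)))).congr_deriv ?_
  simp only [zero_smul, add_zero, add_sub_cancel_right, Pi.add_apply, Pi.neg_apply, Pi.mul_apply]
  field_simp
  ring

/-- The equations that say that the Lie derivative of the Lagrangian, affine in `u_t` and `u_r`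
by the first determining equations, is a null Lagrangian. -/
theorem second_determining (h : FirstDetermining n D X) (hp2 : p ≠ -2)
    (hnull : IsNullLagrangian D (lieLagrangian n p k X)) (hx : x ∈ D) :
    kappa n X x = sigma n X x ∧ 2 * (rDeriv (alpha X) x).im + tDeriv (rho X) x = 0 ∧
    I * tDeriv (eta X) x - rDeriv (rDeriv (eta X)) x
        - ((n - 1) / x.2.1 : ℝ) * rDeriv (eta X) x
      = (k * ‖x.2.2‖ ^ p : ℝ) * ((p * ‖x.2.2‖ ^ (-2 : ℝ) * (conj x.2.2 * eta X x).re : ℝ) * x.2.2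
        + eta X x + (conj (alpha X x) + (sigma n X x + tDeriv (tau X) x : ℝ)) * x.2.2) := by
  have hr : x.2.1 ≠ 0 := (h.regular x hx).1.ne'
  have hq : x.2.1 ^ (n - 1) ≠ 0 := (Real.rpow_pos_of_pos (h.regular x hx).1 _).ne'
  have key := hnull.of_affine (a := fun x => x.2.1 ^ (n - 1) • zerothCoeff n p k X x)
    (b := fun x => x.2.1 ^ (n - 1) • timeCoeff n X x)
    (c := fun x => x.2.1 ^ (n - 1) • radialCoeff X x) h.isOpen
    (h.smooth_weight.smul h.smooth_zerothCoeff)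
    (h.smooth_weight.smul h.smooth_timeCoeff) (h.smooth_weight.smul h.smooth_radialCoeff)
    (fun x hx v w => h.lieLagrangian_affine hx v w) hx
  have db := differentiableAt_of_mem h.isOpen h.smooth_timeCoeff hx
  have dc := differentiableAt_of_mem h.isOpen h.smooth_radialCoeff hx
  have da := differentiableAt_of_mem h.isOpen (h.smooth_zerothCoeff (p := p) (k := k)) hx
  have eα : ∀ ξ, fderiv ℝ (alpha X) x (0, 0, ξ) = 0 := fun ξ => h.alpha_u hx ξ
  have eκ : ∀ ξ, fderiv ℝ (kappa n X) x (0, 0, ξ) = 0 := fun ξ => h.kappa_u hx ξ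
  have eη : ∀ ξ, fderiv ℝ (eta X) x (0, 0, ξ) = alpha X x * ξ := fun ξ => h.eta_u x hx ξ
  have eηr : ∀ ξ, fderiv ℝ (rDeriv (eta X)) x (0, 0, ξ) = rDeriv (alpha X) x * ξ := fun ξ =>
    h.eta_ru hx ξ
  have eρt : ∀ ξ, fderiv ℝ (tDeriv (rho X)) x (0, 0, ξ) = 0 := fun ξ => h.rho_tu hx ξ
  -- The coefficient of `u_t` is a gradient in `u`.
  have hκ : kappa n X x = sigma n X x := by
    have k1 := (key 1 I).1
    rw [fderiv_weight_smul n hr db, fderiv_weight_smul n hr db, h.fderiv_timeCoeff hx,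
      h.fderiv_timeCoeff hx, eα, eα, eκ, eκ, eη, eη] at k1
    have hre := h.re_alpha x hx
    refine mul_left_cancel₀ hq ?_
    simp at k1
    have : sigma n X x = -2 * (alpha X x).re := by linarith
    rw [this]
    linear_combination (-1 / 2) * k1
  refine ⟨hκ, ?_, ?_⟩
  -- The coefficient of `u_r` is a gradient in `u`.
  · have k2 := (key 1 I).2.1
    rw [fderiv_weight_smul n hr dc, fderiv_weight_smul n hr dc, h.fderiv_radialCoeff hx,
      h.fderiv_radialCoeff hx, eηr, eηr, eρt, eρt] at k2
    refine mul_left_cancel₀ hq ?_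
    simp only [real_smul, map_add, map_mul, map_one, map_ofNat, map_zero,
      conj_ofReal, conj_I, ofReal_zero, mul_re, mul_im, add_re, add_im, neg_re, neg_im,
      zero_re, zero_im, one_re, one_im, I_re, I_im, conj_re, conj_im, ofReal_re,
      ofReal_im, re_ofNat, im_ofNat] at k2
    linear_combination (1 / 2) * k2
  -- The equation `a_u = b_t + c_r`, tested in the directions `1` and `I`.
  · have k3 := fun ξ => (key ξ 0).2.2
    have hnorm : ‖x.2.2‖ ^ (p - 2) = ‖x.2.2‖ ^ p * ‖x.2.2‖ ^ (-2 : ℝ) := by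
      rw [← Real.rpow_add (norm_pos_iff.2 (h.regular x hx).2)]; rfl
    have eκt : fderiv ℝ (kappa n X) x (1, 0, 0) = fderiv ℝ (tDeriv (rho X)) x (0, 1, 0)
        + (n - 1) * tDeriv (rho X) x / x.2.1 := by
      have e1 : fderiv ℝ (rDeriv (rho X)) x (1, 0, 0) = fderiv ℝ (tDeriv (rho X)) x (0, 1, 0) :=
        fderiv_comm_of_eqOn h.isOpen h.smooth_rho hx fun _ _ => rfl
      rw [h.fderiv_kappa hx, e1]
      simp only [tDeriv]
      ring
    have k4 : ∀ ξ, _ := fun ξ => by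
      have := k3 ξ
      rw [fderiv_weight_smul n hr da, fderiv_weight_smul n hr db, fderiv_weight_smul n hr dc,
        h.uDeriv_zerothCoeff hp2 hx, h.fderiv_timeCoeff hx, h.fderiv_radialCoeff hx, eκt, hκ,
        hnorm] at this
      exact this
    have e1 := k4 1
    have e2 := k4 I
    clear k3 k4 key
    have r1 : fderiv ℝ (eta X) x (1, 0, 0) = tDeriv (eta X) x := rfl
    have r2 : fderiv ℝ (alpha X) x (1, 0, 0) = tDeriv (alpha X) x := rfl
    have r3 : fderiv ℝ (rDeriv (eta X)) x (0, 1, 0) = rDeriv (rDeriv (eta X)) x := rfl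
    rw [r1, r2, r3] at e1 e2
    simp only [radialCoeff, smul_eq_mul, real_smul, map_add, map_mul, map_neg, map_one,
      map_ofNat, map_zero, conj_ofReal, conj_I, mul_re, mul_im, add_re, add_im, neg_re, neg_im,
      zero_re, zero_im, one_re, one_im, I_re, I_im, conj_re, conj_im, ofReal_re,
      ofReal_im, re_ofNat, im_ofNat] at e1 e2
    refine Complex.ext (mul_left_cancel₀ hq ?_) (mul_left_cancel₀ hq ?_)
    · simp only [mul_re, mul_im, add_re, add_im, sub_re, I_re, I_im, conj_re, conj_im, ofReal_re,
        ofReal_im]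
      linear_combination (1 / 2) * e1
    · simp only [mul_re, mul_im, add_re, add_im, sub_im, I_re, I_im, conj_re, conj_im, ofReal_re,
        ofReal_im]
      linear_combination (1 / 2) * e2

end FirstDetermining

/-! ### Separation by homogeneity in `u` -/

/-- A function without `u`-derivative is locally constant in `u`. -/
lemma eventually_eq_of_uDeriv_eq_zero {E : Type*} [NormedAddCommGroup E] [NormedSpace ℝ E]
    {D : Set Base} (hD : IsOpen D) {f : Base → E} (hf : ContDiffOn ℝ ∞ f D)
    (h0 : ∀ x ∈ D, ∀ ξ, uDeriv ξ f x = 0) {x : Base} (hx : x ∈ D) :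
    ∀ᶠ u in 𝓝 x.2.2, f (x.1, x.2.1, u) = f x := by
  have hU : IsOpen {u : ℂ | (x.1, x.2.1, u) ∈ D} := hD.preimage (by fun_prop)
  obtain ⟨ε, hε, hsub⟩ := Metric.isOpen_iff.1 hU x.2.2 hx
  have hd : ∀ u ∈ Metric.ball x.2.2 ε,
      HasFDerivAt (𝕜 := ℝ) (fun u : ℂ => f (x.1, x.2.1, u)) (0 : ℂ →L[ℝ] E) u := by
    intro u hu
    have h1 : HasFDerivAt (𝕜 := ℝ) (fun u : ℂ => ((x.1, x.2.1, u) : Base))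
        ((0 : ℂ →L[ℝ] ℝ).prod ((0 : ℂ →L[ℝ] ℝ).prod (ContinuousLinearMap.id ℝ ℂ))) u :=
      (hasFDerivAt_const x.1 u).prodMk ((hasFDerivAt_const x.2.1 u).prodMk (hasFDerivAt_id u))
    have h2 := (differentiableAt_of_mem hD hf (hsub hu)).hasFDerivAt.comp u h1
    refine h2.congr_fderiv ?_
    ext ξ
    exact h0 _ (hsub hu) ξ
  filter_upwards [Metric.ball_mem_nhds x.2.2 hε] with u hu
  exact Metric.isOpen_ball.is_const_of_fderiv_eq_zero (𝕜 := ℝ)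
    (convex_ball x.2.2 ε).isPreconnected
    (fun u hu => (hd u hu).differentiableAt.differentiableWithinAt)
    (fun u hu => (hd u hu).fderiv) hu (Metric.mem_ball_self hε)

/-- If `Im (ū B) = c |u|ᵖ Im (ū β)` holds near a point `u₀ ≠ 0`, with `p ≠ 0` and `c ≠ 0`, then
`β = 0`: the two sides are homogeneous of different degrees. -/
lemma eq_zero_of_homogeneity {p c : ℝ} (hp : p ≠ 0) (hc : c ≠ 0) {u₀ B β : ℂ} (hu₀ : u₀ ≠ 0)
    (h : ∀ᶠ u in 𝓝 u₀, (conj u * B).im = c * ‖u‖ ^ p * (conj u * β).im) : β = 0 := by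
  -- Compare the equation at `u` and at `s u` with `s > 1`.
  have hray : ∀ᶠ u in 𝓝 u₀, (conj u * β).im = 0 := by
    filter_upwards [h.eventually_nhds, isOpen_ne.mem_nhds hu₀] with u hu hu0
    have hcont : Tendsto (fun s : ℝ => (s : ℂ) * u) (𝓝 1) (𝓝 u) := by
      have : Continuous (fun s : ℝ => (s : ℂ) * u) := by fun_prop
      simpa using this.tendsto 1
    have h1 := hcont.eventually hu
    have h2 : ∀ᶠ s : ℝ in 𝓝[>] 1, (conj ((s : ℂ) * u) * B).im
        = c * ‖(s : ℂ) * u‖ ^ p * (conj ((s : ℂ) * u) * β).im := h1.filter_mono nhdsWithin_le_nhds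
    obtain ⟨s, hs, hs1⟩ := (h2.and self_mem_nhdsWithin).exists
    have hs1 : 1 < s := hs1
    have hs0 : 0 < s := one_pos.trans hs1
    have hu' := hu.self_of_nhds
    have hn : ‖(s : ℂ) * u‖ ^ p = s ^ p * ‖u‖ ^ p := by
      rw [norm_mul, norm_real, Real.norm_of_nonneg hs0.le,
        Real.mul_rpow hs0.le (norm_nonneg u)]
    have e : ∀ w : ℂ, (conj ((s : ℂ) * u) * w).im = s * (conj u * w).im := fun w => by
      rw [map_mul, conj_ofReal, mul_assoc, im_ofReal_mul]
    rw [e, e, hn, hu'] at hs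
    have hsp : s ^ p - 1 ≠ 0 := by
      intro h0
      rcases lt_or_gt_of_ne hp with h1 | h1
      · have := Real.rpow_lt_one_of_one_lt_of_neg hs1 h1
        linarith
      · have := Real.one_lt_rpow hs1 h1
        linarith
    have hup : ‖u‖ ^ p ≠ 0 := (Real.rpow_pos_of_pos (norm_pos_iff.2 hu0) p).ne'
    have hz : (s * c * ‖u‖ ^ p * (s ^ p - 1)) * (conj u * β).im = 0 := by
      linear_combination -hs
    rcases mul_eq_zero.1 hz with h0 | h0
    · exact absurd h0 (mul_ne_zero (mul_ne_zero (mul_ne_zero hs0.ne' hc) hup) hsp)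
    · exact h0
  have hdir : ∀ ξ : ℂ, (conj ξ * β).im = 0 := by
    intro ξ
    have hcont : Tendsto (fun s : ℝ => u₀ + (s : ℂ) * ξ) (𝓝 0) (𝓝 u₀) := by
      have : Continuous (fun s : ℝ => u₀ + (s : ℂ) * ξ) := by fun_prop
      simpa using this.tendsto 0
    have h2 : ∀ᶠ s : ℝ in 𝓝[>] 0, (conj (u₀ + (s : ℂ) * ξ) * β).im = 0 :=
      (hcont.eventually hray).filter_mono nhdsWithin_le_nhds
    obtain ⟨s, hs, hs1⟩ := (h2.and self_mem_nhdsWithin).exists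
    have hs1 : 0 < s := hs1
    rw [map_add, add_mul, add_im, hray.self_of_nhds, map_mul, conj_ofReal, mul_assoc,
      im_ofReal_mul, zero_add] at hs
    exact (mul_eq_zero.1 hs).resolve_left hs1.ne'
  refine Complex.ext ?_ ?_
  · simpa using hdir I
  · simpa using hdir 1

/-- The terms of the last determining equation separate by their homogeneity in `u`. -/
lemma separate_powers {p k μ : ℝ} (hp : p ≠ 0) (hk : k ≠ 0) {u₀ A B β : ℂ} (hu₀ : u₀ ≠ 0)
    (hA : A.im = 0) (h : ∀ᶠ u in 𝓝 u₀, A * u + B = (k * ‖u‖ ^ p : ℝ)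
      * (μ * u + (p * ‖u‖ ^ (-2 : ℝ) * (conj u * β).re : ℝ) * u + β)) :
    β = 0 ∧ μ = 0 ∧ A = 0 := by
  have him : ∀ (a : ℝ) (u : ℂ), (conj u * (a * u)).im = 0 := fun a u => by
    simp; ring
  have h1 : ∀ᶠ u in 𝓝 u₀, (conj u * B).im = k * ‖u‖ ^ p * (conj u * β).im := by
    filter_upwards [h] with u hu
    have hA' : A = (A.re : ℂ) := Complex.ext (by simp) (by simp [hA])
    have h2 := congrArg (fun z => (conj u * z).im) hu
    beta_reduce at h2
    rw [hA', mul_add, add_im, him, mul_left_comm, im_ofReal_mul, mul_add, mul_add, add_im, add_im,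
      him, him] at h2
    simpa using h2
  obtain rfl := eq_zero_of_homogeneity hp hk hu₀ h1
  have h3 : ∀ᶠ u in 𝓝 u₀, (conj u * 0).im = 1 * ‖u‖ ^ p * (conj u * B).im := by
    filter_upwards [h1] with u hu
    rw [hu]
    simp
  obtain rfl := eq_zero_of_homogeneity hp one_ne_zero hu₀ h3
  have h4 : ∀ᶠ u in 𝓝 u₀, A = (k * ‖u‖ ^ p * μ : ℝ) := by
    filter_upwards [h, isOpen_ne.mem_nhds hu₀] with u hu hu0
    refine mul_right_cancel₀ hu0 ?_
    simp only [mul_zero, zero_re, ofReal_zero, zero_mul, add_zero] at hu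
    rw [hu]
    push_cast
    ring
  have h5 : ∀ᶠ u in 𝓝 u₀, (conj u * (A * I)).im = k * ‖u‖ ^ p * (conj u * (μ * I)).im := by
    filter_upwards [h4] with u hu
    rw [hu]
    simp
    ring
  have hμ : μ = 0 := by simpa using eq_zero_of_homogeneity hp hk hu₀ h5
  refine ⟨rfl, hμ, ?_⟩
  simpa [hμ] using h4.self_of_nhds

/-! ### The complete determining equations -/

/-- The linear part `i f_t - f_rr - (n - 1) f_r / r` of the radial Schrödinger expression, for a
function of `(t, r, u)`. -/
noncomputable def linearPart (n : ℝ) (f : Base → ℂ) (x : Base) : ℂ :=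
  I * tDeriv f x - rDeriv (rDeriv f) x - ((n - 1) / x.2.1 : ℝ) * rDeriv f x

section LinearPart

variable {n : ℝ} {D : Set Base} {f : Base → ℂ} {x : Base}

lemma contDiffOn_linearPart (hD : IsOpen D) (hDr : ∀ x ∈ D, 0 < x.2.1 ∧ x.2.2 ≠ 0)
    (hf : ContDiffOn ℝ ∞ f D) : ContDiffOn ℝ ∞ (linearPart n f) D := by
  have h1 : ContDiffOn ℝ ∞ (rDeriv f) D := contDiffOn_fderiv_apply hD hf _
  have h2 : ContDiffOn ℝ ∞ (rDeriv (rDeriv f)) D := contDiffOn_fderiv_apply hD h1 _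
  have h3 : ContDiffOn ℝ ∞ (fun x : Base => (n - 1) / x.2.1) D :=
    contDiffOn_const.div (by fun_prop) fun x hx => (hDr x hx).1.ne'
  exact ((contDiffOn_const.mul (contDiffOn_fderiv_apply hD hf _)).sub h2).sub
    ((ofRealCLM.contDiff.comp_contDiffOn h3).mul h1)

lemma uDeriv_linearPart (hD : IsOpen D) (hDr : ∀ x ∈ D, 0 < x.2.1 ∧ x.2.2 ≠ 0)
    (hf : ContDiffOn ℝ ∞ f D) (hx : x ∈ D) {g : Base → ℂ} {ξ : ℂ}
    (h : ∀ x ∈ D, uDeriv ξ f x = g x) : uDeriv ξ (linearPart n f) x = linearPart n g x := by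
  have h1 : ContDiffOn ℝ ∞ (rDeriv f) D := contDiffOn_fderiv_apply hD hf _
  have h2 : ContDiffOn ℝ ∞ (rDeriv (rDeriv f)) D := contDiffOn_fderiv_apply hD h1 _
  have h3 : ContDiffOn ℝ ∞ (tDeriv f) D := contDiffOn_fderiv_apply hD hf _
  have e1 : ∀ x ∈ D, uDeriv ξ (rDeriv f) x = rDeriv g x := fun x hx =>
    fderiv_comm_of_eqOn hD hf hx h
  have e2 : uDeriv ξ (rDeriv (rDeriv f)) x = rDeriv (rDeriv g) x :=
    fderiv_comm_of_eqOn hD h1 hx e1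
  have e3 : uDeriv ξ (tDeriv f) x = tDeriv g x := fderiv_comm_of_eqOn hD hf hx h
  have l1 := hasDerivAt_line (differentiableAt_of_mem hD h1 hx) (0, 0, ξ)
  have l2 := hasDerivAt_line (differentiableAt_of_mem hD h2 hx) (0, 0, ξ)
  have l3 := hasDerivAt_line (differentiableAt_of_mem hD h3 hx) (0, 0, ξ)
  rw [linearPart, ← e1 x hx, ← e2, ← e3]
  refine fderiv_apply_of_line (differentiableAt_of_mem hD (contDiffOn_linearPart hD hDr hf) hx) ?_
  refine (((l3.const_mul I).sub l2).sub
    (l1.const_mul (((n - 1) / x.2.1 : ℝ) : ℂ))).congr_of_eventuallyEq (Eventually.of_forall ?_)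
  intro s
  simp [linearPart]

lemma rDeriv_mul_const (hf : DifferentiableAt ℝ f x) (c : ℂ) :
    rDeriv (fun x => f x * c) x = rDeriv f x * c := by
  rw [rDeriv, fderiv_mul_const hf]
  simp [rDeriv, mul_comm]

lemma fderiv_re (hf : DifferentiableAt ℝ f x) (d : Base) :
    fderiv ℝ (fun x => (f x).re) x d = (fderiv ℝ f x d).re :=
  fderiv_apply_of_line (reCLM.differentiableAt.comp x hf) (hasDerivAt_re (hasDerivAt_line hf d))

lemma fderiv_im (hf : DifferentiableAt ℝ f x) (d : Base) :
    fderiv ℝ (fun x => (f x).im) x d = (fderiv ℝ f x d).im :=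
  fderiv_apply_of_line (imCLM.differentiableAt.comp x hf)
    (imCLM.hasFDerivAt.comp_hasDerivAt 0 (hasDerivAt_line hf d))

end LinearPart

/-- The complete determining equations: `τ` depends on `t` only, `ρ` on `(t, r)`, and
`η = α u` with `α` a function of `(t, r)`. -/
structure Determining (n p : ℝ) (D : Set Base) (X : Base → Base) : Prop
    extends FirstDetermining n D X where
  kappa_eq : ∀ x ∈ D, kappa n X x = sigma n X x
  im_alpha_r : ∀ x ∈ D, (rDeriv (alpha X) x).im = -(tDeriv (rho X) x) / 2
  eta_eq : ∀ x ∈ D, eta X x = alpha X x * x.2.2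
  tau_t : ∀ x ∈ D, tDeriv (tau X) x = p * sigma n X x / 2
  alpha_eq : ∀ x ∈ D, linearPart n (alpha X) x = 0

namespace FirstDetermining

variable {n p k : ℝ} {D : Set Base} {X : Base → Base} {x : Base}

/-- The imaginary part of the equation for `α = η_u` follows from the equations for `Re α` and
`Im α_r`. -/
lemma linearPart_alpha_im (h : FirstDetermining n D X)
    (hκ : ∀ x ∈ D, kappa n X x = sigma n X x)
    (hα : ∀ x ∈ D, (rDeriv (alpha X) x).im = -(tDeriv (rho X) x) / 2) (hx : x ∈ D) :
    (linearPart n (alpha X) x).im = 0 := by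
  have dα := differentiableAt_of_mem h.isOpen h.smooth_alpha hx
  have dαr : DifferentiableAt ℝ (rDeriv (alpha X)) x :=
    differentiableAt_of_mem h.isOpen (contDiffOn_fderiv_apply h.isOpen h.smooth_alpha _) hx
  have dρt : DifferentiableAt ℝ (tDeriv (rho X)) x :=
    differentiableAt_of_mem h.isOpen (contDiffOn_fderiv_apply h.isOpen h.smooth_rho _) hx
  have dκ := differentiableAt_of_mem h.isOpen h.smooth_kappa hx
  have e1 : (tDeriv (alpha X) x).re = -(1 / 2) * fderiv ℝ (kappa n X) x (1, 0, 0) := by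
    have : EqOn (fun x => (alpha X x).re) (fun x => -(1 / 2) * kappa n X x) D := fun x hx => by
      simp only [h.re_alpha x hx, hκ x hx]; ring
    rw [tDeriv, ← fderiv_re dα, fderiv_eq_of_eqOn h.isOpen this hx, fderiv_const_mul dκ]
    rfl
  have e2 : (rDeriv (rDeriv (alpha X)) x).im
      = -(1 / 2) * fderiv ℝ (tDeriv (rho X)) x (0, 1, 0) := by
    have : EqOn (fun x => (rDeriv (alpha X) x).im) (fun x => -(1 / 2) * tDeriv (rho X) x) D :=
      fun x hx => by simp only [hα x hx]; ring
    rw [rDeriv, ← fderiv_im dαr, fderiv_eq_of_eqOn h.isOpen this hx, fderiv_const_mul dρt]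
    rfl
  have e3 : fderiv ℝ (rDeriv (rho X)) x (1, 0, 0) = fderiv ℝ (tDeriv (rho X)) x (0, 1, 0) :=
    fderiv_comm_of_eqOn h.isOpen h.smooth_rho hx fun _ _ => rfl
  rw [h.fderiv_kappa hx, e3] at e1
  simp only [linearPart, sub_im, mul_im, I_re, I_im, ofReal_re, ofReal_im, e1, e2, hα x hx]
  simp only [tDeriv]
  ring

/-- The last of the second determining equations separates by homogeneity in `u`. -/
theorem determining (h : FirstDetermining n D X) (hp : p ≠ 0) (hp2 : p ≠ -2) (hk : k ≠ 0)
    (hnull : IsNullLagrangian D (lieLagrangian n p k X)) : Determining n p D X := by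
  have hκ : ∀ x ∈ D, kappa n X x = sigma n X x := fun x hx =>
    (h.second_determining hp2 hnull hx).1
  have hα : ∀ x ∈ D, (rDeriv (alpha X) x).im = -(tDeriv (rho X) x) / 2 := fun x hx => by
    have := (h.second_determining hp2 hnull hx).2.1
    linarith
  -- Near `x`, `η` is affine in `u` with slope `α`, and its image under the linear part of the
  -- equation is affine in `u` too; the last determining equation then has terms of degree
  -- `0`, `1`, `p` and `p + 1` in `u`.
  have key : ∀ x ∈ D, eta X x - alpha X x * x.2.2 = 0 ∧
      tDeriv (tau X) x - p * sigma n X x / 2 = 0 ∧ linearPart n (alpha X) x = 0 := by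
    intro x hx
    have sα := h.smooth_alpha
    have sΛ := contDiffOn_linearPart (n := n) h.isOpen h.regular h.smooth_eta
    have sA := contDiffOn_linearPart (n := n) h.isOpen h.regular sα
    have uA : ∀ x ∈ D, ∀ ξ, uDeriv ξ (linearPart n (alpha X)) x = 0 := fun x hx ξ => by
      rw [uDeriv_linearPart h.isOpen h.regular sα hx (g := fun _ => 0)
        fun x hx => h.alpha_u hx ξ]
      have e1 : rDeriv (fun _ : Base => (0 : ℂ)) = fun _ => 0 := by
        funext x; simp [rDeriv]
      simp [linearPart, e1, tDeriv]
    have uΛ : ∀ x ∈ D, ∀ ξ, uDeriv ξ (linearPart n (eta X)) x = linearPart n (alpha X) x * ξ :=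
        fun x hx ξ => by
      rw [uDeriv_linearPart h.isOpen h.regular h.smooth_eta hx (g := fun x => alpha X x * ξ)
        fun x hx => h.eta_u x hx ξ]
      have e1 : ∀ x ∈ D, rDeriv (fun x => alpha X x * ξ) x = rDeriv (alpha X) x * ξ :=
        fun x hx => rDeriv_mul_const (differentiableAt_of_mem h.isOpen sα hx) ξ
      have e2 : rDeriv (rDeriv fun x => alpha X x * ξ) x = rDeriv (rDeriv (alpha X)) x * ξ := by
        rw [rDeriv_congr h.isOpen e1 hx]
        exact rDeriv_mul_const (differentiableAt_of_mem h.isOpen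
          (contDiffOn_fderiv_apply h.isOpen sα _) hx) ξ
      have e3 : tDeriv (fun x => alpha X x * ξ) x = tDeriv (alpha X) x * ξ := by
        rw [tDeriv, fderiv_mul_const (differentiableAt_of_mem h.isOpen sα hx)]
        simp [tDeriv, mul_comm]
      simp only [linearPart, e1 x hx, e2, e3]
      ring
    have const : ∀ {f g : Base → ℂ}, ContDiffOn ℝ ∞ f D → ContDiffOn ℝ ∞ g D →
        (∀ x ∈ D, ∀ ξ, uDeriv ξ f x = g x * ξ) → (∀ x ∈ D, ∀ ξ, uDeriv ξ g x = 0) →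
        ∀ᶠ u in 𝓝 x.2.2, f (x.1, x.2.1, u) = g x * u + (f x - g x * x.2.2) := by
      intro f g hf hg hfu hgu
      have h1 := eventually_eq_of_uDeriv_eq_zero h.isOpen hg hgu hx
      have h2 := eventually_eq_of_uDeriv_eq_zero h.isOpen (f := fun x => f x - g x * x.2.2)
        (hf.sub (hg.mul contDiffOn_u)) (fun x hx ξ => ?_) hx
      · filter_upwards [h1, h2] with u h1 h2
        rw [h1] at h2
        rw [← h2]; ring
      · have df := differentiableAt_of_mem h.isOpen hf hx
        have dg := differentiableAt_of_mem h.isOpen hg hx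
        refine fderiv_apply_of_line (df.sub (dg.mul (by fun_prop))) ?_
        have l1 := hasDerivAt_line df (0, 0, ξ)
        have l2 := hasDerivAt_line dg (0, 0, ξ)
        have e1 : fderiv ℝ f x (0, 0, ξ) = g x * ξ := hfu x hx ξ
        have e2 : fderiv ℝ g x (0, 0, ξ) = 0 := hgu x hx ξ
        rw [e1] at l1
        rw [e2] at l2
        refine (l1.sub (l2.mul (hasDerivAt_add_smul x.2.2 ξ))).congr_deriv ?_
        simp
    have c1 := const h.smooth_eta sα h.eta_u fun x hx ξ => h.alpha_u hx ξ
    have c2 := const sΛ sA uΛ uA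
    have c3 := eventually_eq_of_uDeriv_eq_zero h.isOpen sα (fun x hx ξ => h.alpha_u hx ξ) hx
    have c4 := eventually_eq_of_uDeriv_eq_zero h.isOpen h.smooth_kappa
      (fun x hx ξ => h.kappa_u hx ξ) hx
    have c5 := eventually_eq_of_uDeriv_eq_zero h.isOpen
      (contDiffOn_fderiv_apply h.isOpen h.smooth_tau _) (fun x hx ξ => h.tau_tu hx ξ) hx
    have hmem : ∀ᶠ u in 𝓝 x.2.2, (x.1, x.2.1, u) ∈ D :=
      (h.isOpen.preimage (f := fun u : ℂ => ((x.1, x.2.1, u) : Base)) (by fun_prop)).mem_nhds hx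
    refine separate_powers (p := p) (B := linearPart n (eta X) x - linearPart n (alpha X) x * x.2.2)
      hp hk (h.regular x hx).2 (h.linearPart_alpha_im hκ hα hx) ?_
    filter_upwards [c1, c2, c3, c4, c5, hmem] with u c1 c2 c3 c4 c5 hu
    have hu0 : u ≠ 0 := (h.regular _ hu).2
    have key := (h.second_determining hp2 hnull hu).2.2
    have c5' : tDeriv (tau X) (x.1, x.2.1, u) = tDeriv (tau X) x := c5
    have hΛ : I * tDeriv (eta X) (x.1, x.2.1, u) - rDeriv (rDeriv (eta X)) (x.1, x.2.1, u)
        - ((n - 1) / x.2.1 : ℝ) * rDeriv (eta X) (x.1, x.2.1, u)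
        = linearPart n (eta X) (x.1, x.2.1, u) := rfl
    rw [← c2, ← hΛ, key, ← hκ _ hu, c1, c3, c4, c5', hκ x hx]
    congr 1
    have hre := h.re_alpha x hx
    generalize eta X x - alpha X x * x.2.2 = β
    have hnorm : ‖u‖ ^ (-2 : ℝ) * (conj u * (alpha X x * u + β)).re
        = (alpha X x).re + ‖u‖ ^ (-2 : ℝ) * (conj u * β).re := by
      have e1 : ‖u‖ ^ (-2 : ℝ) * ‖u‖ ^ 2 = 1 := by
        rw [← Real.rpow_natCast, ← Real.rpow_add (norm_pos_iff.2 hu0)]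
        norm_num
      have e2 : (conj u * (alpha X x * u + β)).re
          = (alpha X x).re * ‖u‖ ^ 2 + (conj u * β).re := by
        rw [← normSq_eq_norm_sq, normSq_apply]
        simp; ring
      rw [e2]
      linear_combination (alpha X x).re * e1
    rw [mul_assoc p, hnorm]
    have hc : alpha X x + conj (alpha X x) = ((-sigma n X x : ℝ) : ℂ) := by
      rw [add_conj, hre]; push_cast; ring
    have hs : conj (alpha X x) = ((-sigma n X x : ℝ) : ℂ) - alpha X x := by rw [← hc]; ring
    rw [hs, hre]
    push_cast
    ring
  exact { h with
    kappa_eq := hκ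
    im_alpha_r := hα
    eta_eq := fun x hx => sub_eq_zero.1 (key x hx).1
    tau_t := fun x hx => sub_eq_zero.1 (key x hx).2.1
    alpha_eq := fun x hx => (key x hx).2.2 }

end FirstDetermining

/-! ### Solution of the determining equations -/

/-- A function on a connected domain whose first derivatives are those of a quadratic polynomial
`a t² + b t + e r²` differs from it by a constant. -/
lemma exists_eq_quadratic {D : Set Base} (hD : IsOpen D) (hDc : IsPreconnected D) {f : Base → ℝ}
    (hf : ContDiffOn ℝ ∞ f D) (a b e : ℝ) (ht : ∀ x ∈ D, tDeriv f x = 2 * a * x.1 + b)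
    (hr : ∀ x ∈ D, rDeriv f x = 2 * e * x.2.1) (hu : ∀ x ∈ D, ∀ ξ, uDeriv ξ f x = 0) :
    ∃ c, ∀ x ∈ D, f x = a * x.1 ^ 2 + b * x.1 + e * x.2.1 ^ 2 + c := by
  have hq : ContDiff ℝ ∞ (fun x : Base => a * x.1 ^ 2 + b * x.1 + e * x.2.1 ^ 2) := by fun_prop
  have hg : DifferentiableOn ℝ
      (fun x : Base => f x - (a * x.1 ^ 2 + b * x.1 + e * x.2.1 ^ 2)) D :=
    (hf.sub hq.contDiffOn).differentiableOn (by simp)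
  obtain ⟨c, hc⟩ := hD.exists_is_const_of_fderiv_eq_zero hDc hg fun x hx => by
    refine ContinuousLinearMap.ext fun d => ?_
    refine fderiv_apply_of_line ((hg x hx).differentiableAt (hD.mem_nhds hx)) ?_
    have h0 := hasDerivAt_line (differentiableAt_of_mem hD hf hx) d
    have h1 := hasDerivAt_add_smul x.1 d.1
    have h2 := hasDerivAt_add_smul x.2.1 d.2.1
    refine (h0.sub ((((h1.pow 2).const_mul a).add (h1.const_mul b)).add
      ((h2.pow 2).const_mul e))).congr_deriv ?_
    have hs := fderiv_split f x d.1 d.2.1 d.2.2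
    rw [ht x hx, hr x hx, hu x hx] at hs
    rw [show d = (d.1, d.2.1, d.2.2) from rfl, hs]
    simp
    ring
  exact ⟨c, fun x hx => by rw [← hc x hx]; ring⟩

/-- The imaginary part of `η_u`, the rate at which the generator rotates the phase of `u`. -/
noncomputable def phase (X : Base → Base) (x : Base) : ℝ := (alpha X x).im

namespace Determining

variable {n p : ℝ} {D : Set Base} {X : Base → Base} {x : Base}

lemma rho_r (h : Determining n p D X) (hx : x ∈ D) : rDeriv (rho X) x = tDeriv (tau X) x / 2 := by
  have := sigma_eq n X x
  rw [h.kappa_eq x hx] at this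
  linarith

lemma sigma_eq_tau_t (h : Determining n p D X) (hp : p ≠ 0) (hx : x ∈ D) :
    sigma n X x = 2 / p * tDeriv (tau X) x := by
  rw [h.tau_t x hx]; field_simp

lemma rho_eq (h : Determining n p D X) (hp : p ≠ 0) (hx : x ∈ D) :
    (n - 1) * rho X x = x.2.1 * tDeriv (tau X) x * (2 / p - 1 / 2) := by
  have h1 := h.kappa_eq x hx
  have hr : x.2.1 ≠ 0 := (h.regular x hx).1.ne'
  rw [h.sigma_eq_tau_t hp hx, kappa, h.rho_r hx] at h1
  have h2 : (n - 1) * rho X x / x.2.1 = tDeriv (tau X) x * (2 / p - 1 / 2) := by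
    linear_combination h1
  rw [div_eq_iff hr] at h2
  rw [h2]; ring

/-- Only for `n p = 4` can `τ` be nonconstant: differentiate `rho_eq` with respect to `r`, and
insert `ρ_r = τ_t / 2`. -/
lemma tau_t_mul (h : Determining n p D X) (hp : p ≠ 0) (hx : x ∈ D) :
    tDeriv (tau X) x * (n * p - 4) = 0 := by
  have dτ : DifferentiableAt ℝ (tDeriv (tau X)) x :=
    differentiableAt_of_mem h.isOpen (contDiffOn_fderiv_apply h.isOpen h.smooth_tau _) hx
  have dρ := differentiableAt_of_mem h.isOpen h.smooth_rho hx
  have e : fderiv ℝ (fun x => x.2.1 * tDeriv (tau X) x * (2 / p - 1 / 2)) x (0, 1, 0)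
      = tDeriv (tau X) x * (2 / p - 1 / 2) := by
    refine fderiv_apply_of_line (DifferentiableAt.mul_const
      (DifferentiableAt.mul (by fun_prop) dτ) _) ?_
    have h1 := hasDerivAt_line dτ (0, 1, 0)
    have h2 : fderiv ℝ (tDeriv (tau X)) x (0, 1, 0) = 0 := h.tau_tr hx
    rw [h2] at h1
    refine (((hasDerivAt_add_smul x.2.1 1).mul h1).mul_const (2 / p - 1 / 2)).congr_deriv ?_
    simp
  rw [← fderiv_eq_of_eqOn h.isOpen (fun x hx => h.rho_eq hp hx) hx, fderiv_const_mul dρ] at e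
  have e' : (n - 1) * rDeriv (rho X) x = tDeriv (tau X) x * (2 / p - 1 / 2) := e
  rw [h.rho_r hx] at e'
  have : tDeriv (tau X) x * (n / 2 - 2 / p) = 0 := by linear_combination e'
  field_simp at this
  linear_combination this

lemma alpha_re (h : Determining n p D X) (hp : p ≠ 0) (hx : x ∈ D) :
    (alpha X x).re = -(1 / p) * tDeriv (tau X) x := by
  rw [h.re_alpha x hx, h.sigma_eq_tau_t hp hx]; ring

lemma smooth_phase (h : Determining n p D X) : ContDiffOn ℝ ∞ (phase X) D :=
  imCLM.contDiff.comp_contDiffOn h.smooth_alpha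

lemma fderiv_phase (h : Determining n p D X) (hx : x ∈ D) (d : Base) :
    fderiv ℝ (phase X) x d = (fderiv ℝ (alpha X) x d).im :=
  fderiv_im (differentiableAt_of_mem h.isOpen h.smooth_alpha hx) d

lemma phase_u (h : Determining n p D X) (hx : x ∈ D) (ξ : ℂ) : uDeriv ξ (phase X) x = 0 := by
  have := h.alpha_u hx ξ
  rw [uDeriv] at this ⊢
  rw [h.fderiv_phase hx, this]; rfl

lemma phase_r (h : Determining n p D X) (hx : x ∈ D) :
    rDeriv (phase X) x = -(tDeriv (rho X) x) / 2 := by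
  rw [← h.im_alpha_r x hx]
  exact h.fderiv_phase hx _

/-- This is the real part of the equation for `α`, as `Re α` does not depend on `r`. -/
lemma phase_t (h : Determining n p D X) (hp : p ≠ 0) (hx : x ∈ D) : tDeriv (phase X) x = 0 := by
  have hr : ∀ x ∈ D, (rDeriv (alpha X) x).re = 0 := fun x hx => by
    have dτ : DifferentiableAt ℝ (tDeriv (tau X)) x :=
      differentiableAt_of_mem h.isOpen (contDiffOn_fderiv_apply h.isOpen h.smooth_tau _) hx
    have := h.tau_tr hx
    rw [rDeriv] at this ⊢
    rw [← fderiv_re (differentiableAt_of_mem h.isOpen h.smooth_alpha hx),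
      fderiv_eq_of_eqOn h.isOpen (fun x hx => h.alpha_re hp hx) hx, fderiv_const_mul dτ]
    simp [this]
  have hrr : (rDeriv (rDeriv (alpha X)) x).re = 0 := by
    have d : DifferentiableAt ℝ (rDeriv (alpha X)) x :=
      differentiableAt_of_mem h.isOpen (contDiffOn_fderiv_apply h.isOpen h.smooth_alpha _) hx
    rw [rDeriv, ← fderiv_re d, fderiv_eq_of_eqOn (g := fun _ => 0) h.isOpen hr hx]
    simp
  have h1 := congrArg re (h.alpha_eq x hx)
  simp only [linearPart, sub_re, mul_re, I_re, I_im, ofReal_re, ofReal_im, hr x hx, hrr,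
    zero_re] at h1
  rw [tDeriv, h.fderiv_phase hx]
  change (tDeriv (alpha X) x).im = 0
  linarith

lemma eq_of_phase (h : Determining n p D X) (hp : p ≠ 0) (hx : x ∈ D) :
    X x = (tau X x, rho X x,
      ((-(1 / p) * tDeriv (tau X) x : ℝ) + I * (phase X x : ℝ)) * x.2.2) := by
  refine Prod.ext rfl (Prod.ext rfl ?_)
  change eta X x = _
  rw [h.eta_eq x hx, ← h.alpha_re hp hx, phase, mul_comm I, re_add_im]

/-- Here `τ` and the phase are constant, and `ρ = 0` as `n ≠ 1`. -/
theorem exists_eqOn_of_ne (h : Determining n p D X) (hDc : IsPreconnected D) (hn : n ≠ 1)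
    (hp : p ≠ 0) (hnp : n * p ≠ 4) : ∃ c d : ℝ, EqOn X (d • Xphas + c • Xtrans) D := by
  have hτ : ∀ x ∈ D, tDeriv (tau X) x = 0 := fun x hx =>
    (mul_eq_zero.1 (h.tau_t_mul hp hx)).resolve_right (sub_ne_zero.2 hnp)
  have hρ : ∀ x ∈ D, rho X x = 0 := fun x hx => by
    have := h.rho_eq hp hx
    rw [hτ x hx, mul_zero, zero_mul] at this
    exact (mul_eq_zero.1 this).resolve_left (sub_ne_zero.2 hn)
  have hθ : ∀ x ∈ D, rDeriv (phase X) x = 0 := fun x hx => by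
    rw [h.phase_r hx, tDeriv_congr (g := fun _ => 0) h.isOpen hρ hx]
    simp [tDeriv]
  obtain ⟨c, hc⟩ := exists_eq_quadratic h.isOpen hDc h.smooth_tau 0 0 0
    (fun x hx => by simp [hτ x hx]) (fun x hx => by simp [h.tau_r x hx]) h.tau_u
  obtain ⟨d, hd⟩ := exists_eq_quadratic h.isOpen hDc h.smooth_phase 0 0 0
    (fun x hx => by simp [h.phase_t hp hx]) (fun x hx => by simp [hθ x hx])
    fun x hx ξ => h.phase_u hx ξ
  refine ⟨c, d, fun x hx => ?_⟩
  rw [h.eq_of_phase hp hx, hc x hx, hd x hx, hτ x hx, hρ x hx]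
  simp [Xphas, Xtrans, mul_left_comm, mul_assoc]

/-- Here `τ` is quadratic in `t` and determines `ρ` and `Re α`, and the phase up to a constant. -/
theorem exists_eqOn_of_eq (h : Determining n p D X) (hDc : IsPreconnected D) (hn : n ≠ 1)
    (hp : p ≠ 0) (hnp : n * p = 4) :
    ∃ a b c d : ℝ, EqOn X (d • Xphas + c • Xtrans + b • Xscal p + a • Xinver p) D := by
  have sτt : ContDiffOn ℝ ∞ (tDeriv (tau X)) D := contDiffOn_fderiv_apply h.isOpen h.smooth_tau _
  have sτtt : ContDiffOn ℝ ∞ (tDeriv (tDeriv (tau X))) D := contDiffOn_fderiv_apply h.isOpen sτt _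
  have hρ : ∀ x ∈ D, rho X x = x.2.1 / 2 * tDeriv (tau X) x := fun x hx => by
    have h1 := h.rho_eq hp hx
    have h2 : 2 / p = n / 2 := by
      field_simp; linarith
    rw [h2] at h1
    refine mul_left_cancel₀ (sub_ne_zero.2 hn) ?_
    linear_combination h1
  have hmul : ∀ {f : Base → ℝ}, ContDiffOn ℝ ∞ f D → ∀ c : ℝ, ∀ x ∈ D,
      tDeriv (fun x => x.2.1 / c * f x) x = x.2.1 / c * tDeriv f x := fun hf c x hx => by
    have df := differentiableAt_of_mem h.isOpen hf hx
    refine fderiv_apply_of_line (DifferentiableAt.mul (by fun_prop) df) ?_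
    refine (((hasDerivAt_add_smul x.2.1 0).div_const c).mul
      (hasDerivAt_line df (1, 0, 0))).congr_deriv ?_
    simp [tDeriv]
  have hθ : ∀ x ∈ D, rDeriv (phase X) x = x.2.1 / (-4) * tDeriv (tDeriv (tau X)) x := fun x hx => by
    rw [h.phase_r hx, tDeriv_congr h.isOpen hρ hx, hmul sτt 2 x hx]
    ring
  -- `Im α` has no `t`-derivative, and its `r`-derivative is `-r τ_tt / 4`; so `τ_ttt = 0`.
  have hτ3 : ∀ x ∈ D, tDeriv (tDeriv (tDeriv (tau X))) x = 0 := fun x hx => by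
    have e1 : tDeriv (rDeriv (phase X)) x = 0 :=
      fderiv_comm_of_eqOn_zero h.isOpen h.smooth_phase hx fun x hx => h.phase_t hp hx
    rw [tDeriv_congr h.isOpen hθ hx, hmul sτtt (-4) x hx] at e1
    refine (mul_eq_zero.1 e1).resolve_left ?_
    have := (h.regular x hx).1
    exact div_ne_zero this.ne' (by norm_num)
  have hτtr : ∀ x ∈ D, rDeriv (tDeriv (tDeriv (tau X))) x = 0 := fun x hx =>
    fderiv_comm_of_eqOn_zero h.isOpen sτt hx fun x hx => h.tau_tr hx
  have hτtu : ∀ x ∈ D, ∀ ξ, uDeriv ξ (tDeriv (tDeriv (tau X))) x = 0 := fun x hx ξ =>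
    fderiv_comm_of_eqOn_zero h.isOpen sτt hx fun x hx => h.tau_tu hx ξ
  obtain ⟨a, ha⟩ := exists_eq_quadratic h.isOpen hDc sτtt 0 0 0
    (fun x hx => by simp [hτ3 x hx]) (fun x hx => by simp [hτtr x hx]) hτtu
  obtain ⟨b, hb⟩ := exists_eq_quadratic h.isOpen hDc sτt 0 a 0
    (fun x hx => by simp [ha x hx]) (fun x hx => by simp [h.tau_tr hx])
    fun x hx ξ => h.tau_tu hx ξ
  obtain ⟨c, hc⟩ := exists_eq_quadratic h.isOpen hDc h.smooth_tau (a / 2) b 0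
    (fun x hx => by rw [hb x hx]; ring) (fun x hx => by simp [h.tau_r x hx]) h.tau_u
  obtain ⟨d, hd⟩ := exists_eq_quadratic h.isOpen hDc h.smooth_phase 0 0 (-a / 8)
    (fun x hx => by simp [h.phase_t hp hx]) (fun x hx => by rw [hθ x hx, ha x hx]; ring)
    fun x hx ξ => h.phase_u hx ξ
  refine ⟨a / 2, b / 2, c, d, fun x hx => ?_⟩
  rw [h.eq_of_phase hp hx, hρ x hx, hc x hx, hd x hx, hb x hx]
  refine Prod.ext ?_ (Prod.ext ?_ ?_)
  · simp [Xphas, Xtrans, Xscal, Xinver]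
    ring
  · simp [Xphas, Xtrans, Xscal, Xinver]
    ring
  · simp [Xphas, Xtrans, Xscal, Xinver]
    ring

end Determining

/-- The combination `d X_phas + c X_trans + b X_scal + a X_inver`, in coordinates. -/
lemma combination_apply (p a b c d : ℝ) (x : Base) :
    (d • Xphas + c • Xtrans + b • Xscal p + a • Xinver p) x
      = (a * x.1 ^ 2 + 2 * b * x.1 + c, x.2.1 * (a * x.1 + b),
        ((-(2 / p) * (a * x.1 + b) : ℝ) + I * (d - a / 4 * x.2.1 ^ 2 : ℝ)) * x.2.2) := by
  refine Prod.ext ?_ (Prod.ext ?_ ?_)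
  · simp [Xphas, Xtrans, Xscal, Xinver]
    ring
  · simp [Xphas, Xtrans, Xscal, Xinver]
    ring
  · simp [Xphas, Xtrans, Xscal, Xinver]
    ring

lemma contDiff_combination (p a b c d : ℝ) :
    ContDiff ℝ ∞ (d • Xphas + c • Xtrans + b • Xscal p + a • Xinver p) := by
  rw [funext (combination_apply p a b c d)]
  have h : ∀ f : Base → ℝ, ContDiff ℝ ∞ f → ContDiff ℝ ∞ (fun x => (f x : ℂ)) := fun f hf =>
    ofRealCLM.contDiff.comp hf
  exact ContDiff.prodMk (by fun_prop) (ContDiff.prodMk (by fun_prop)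
    (((h _ (by fun_prop)).add (contDiff_const.mul (h _ (by fun_prop)))).mul (by fun_prop)))

lemma fderiv_combination (p a b c d : ℝ) (x e : Base) :
    fderiv ℝ (d • Xphas + c • Xtrans + b • Xscal p + a • Xinver p) x e
      = (2 * a * x.1 * e.1 + 2 * b * e.1, e.2.1 * (a * x.1 + b) + x.2.1 * (a * e.1),
        ((-(2 / p) * (a * e.1) : ℝ) - I * (a / 2 * x.2.1 * e.2.1 : ℝ)) * x.2.2
        + ((-(2 / p) * (a * x.1 + b) : ℝ) + I * (d - a / 4 * x.2.1 ^ 2 : ℝ)) * e.2.2) := by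
  refine fderiv_apply_of_line ((contDiff_combination p a b c d).differentiable (by simp) x) ?_
  simp_rw [combination_apply]
  have h1 := hasDerivAt_add_smul x.1 e.1
  have h2 := hasDerivAt_add_smul x.2.1 e.2.1
  have h3 := hasDerivAt_add_smul x.2.2 e.2.2
  have h4 := (h1.const_mul a).add_const b
  refine (((((h1.pow 2).const_mul a).add (h1.const_mul (2 * b))).add_const c).prodMk
    ((h2.mul h4).prodMk ((((h4.const_mul (-(2 / p))).ofReal_comp.add
      ((((h2.pow 2).const_mul (a / 4)).const_sub d).ofReal_comp.const_mul I)).mul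
        h3)))).congr_deriv ?_
  refine Prod.ext ?_ (Prod.ext ?_ ?_)
  · simp
    ring
  · simp
  · simp
    exact Or.inl (by ring)

/-- The Lagrangian form is invariant under phase rotation and time translation, and for `n p = 4`
also under scaling and inversion. -/
theorem lieLagrangian_combination {n p : ℝ} (k : ℝ) (hp : p ≠ 0) (hp2 : p ≠ -2) {a b : ℝ}
    (c d : ℝ) (hab : (a = 0 ∧ b = 0) ∨ n * p = 4) {x : Base} (hx : 0 < x.2.1 ∧ x.2.2 ≠ 0)
    (v w : ℂ) :
    lieLagrangian n p k (d • Xphas + c • Xtrans + b • Xscal p + a • Xinver p) (x, v, w) = 0 := by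
  have hp2' : p + 2 ≠ 0 := fun h => hp2 (by linarith)
  have hr : x.2.1 ≠ 0 := hx.1.ne'
  have hpow : ‖x.2.2‖ ^ (p + 2) = ‖x.2.2‖ ^ p * ‖x.2.2‖ ^ 2 := by
    rw [Real.rpow_add (norm_pos_iff.2 hx.2)]
    norm_num
  simp only [lieLagrangian, lagrangianDensity, fderiv_combination, combination_apply, hpow]
  refine mul_eq_zero_of_right _ ?_
  simp only [← normSq_eq_norm_sq, normSq_apply, map_add, map_mul, conj_ofReal, mul_re,
    mul_im, sub_re, sub_im, add_re, add_im, I_re, I_im, conj_re, conj_im, ofReal_re, ofReal_im,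
    conj_I, neg_re, neg_im]
  rcases hab with ⟨rfl, rfl⟩ | hnp
  · simp
    ring
  · obtain rfl : n = 4 / p := by field_simp; linarith
    field_simp
    ring

/-! ### Classification and conservation laws -/

section Classification

variable {n p k : ℝ} {D : Set Base} {X Y : Base → Base}

lemma lieLagrangian_congr (hD : IsOpen D) (h : EqOn X Y D) {x : Base} (hx : x ∈ D) (v w : ℂ) :
    lieLagrangian n p k X (x, v, w) = lieLagrangian n p k Y (x, v, w) := by
  simp only [lieLagrangian, h hx, fderiv_eq_of_eqOn hD h hx]

/-- For `n = 0` both sides are false: the right one reads `p = 0`, as `4 / 0 = 0`. -/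
lemma mul_eq_four_iff (hp : p ≠ 0) : n * p = 4 ↔ p = 4 / n := by
  constructor
  · intro h
    have hn : n ≠ 0 := by rintro rfl; simp at h
    field_simp; linarith
  · rintro rfl
    have hn : n ≠ 0 := by rintro rfl; simp at hp
    field_simp

/-- The variational point symmetries are the combinations of the four generators, without scaling
and inversion unless `n p = 4`. -/
theorem isVariational_iff (hn : n ≠ 1) (hp : p ≠ 0) (hp2 : p ≠ -2) (hk : k ≠ 0) (hD : IsOpen D)
    (hDc : IsConnected D) (hDr : ∀ x ∈ D, 0 < x.2.1 ∧ x.2.2 ≠ 0) :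
    IsVariational n p k D X ↔ ∃ a b c d : ℝ, ((a = 0 ∧ b = 0) ∨ n * p = 4) ∧
      EqOn X (d • Xphas + c • Xtrans + b • Xscal p + a • Xinver p) D := by
  constructor
  · intro h
    have hnull := h.isNullLagrangian hp2 hD hDr
    have hdet := (hnull.firstDetermining hD hDr h.1).determining hp hp2 hk hnull
    by_cases hnp : n * p = 4
    · obtain ⟨a, b, c, d, h⟩ := hdet.exists_eqOn_of_eq hDc.isPreconnected hn hp hnp
      exact ⟨a, b, c, d, Or.inr hnp, h⟩
    · obtain ⟨c, d, h⟩ := hdet.exists_eqOn_of_ne hDc.isPreconnected hn hp hnp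
      exact ⟨0, 0, c, d, Or.inl ⟨rfl, rfl⟩, by simpa using h⟩
  · rintro ⟨a, b, c, d, hab, h⟩
    refine isVariational_of_lieLagrangian_eq_zero hp2 hD hDr
      ((contDiff_combination p a b c d).contDiffOn.congr h) fun x hx v w => ?_
    rw [lieLagrangian_congr hD h hx, lieLagrangian_combination k hp hp2 c d hab (hDr x hx)]

/-- If `X` leaves the Lagrangian form invariant, then the multiplier equation holds. -/
lemma multiplier_equation (hp2 : p ≠ -2) {z : Jet 2} (hz : z ∈ regularJets 2)
    (hX : DifferentiableAt ℝ X (base z))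
    (h : ∀ v w, lieLagrangian n p k X (base z, v, w) = 0) :
    2 * (base z).2.1 ^ (n - 1) * (residual n p k z
        * conj (characteristic X (trunc one_le_two z))).re
      = totalT (noetherDensity n p k X) z + totalR (noetherFlux n p k X) z := by
  rw [noether_identity hp2 hX hz, h, add_zero]

lemma IsVariational.multiplier_equation (hn : n ≠ 1) (hp : p ≠ 0) (hp2 : p ≠ -2) (hk : k ≠ 0)
    (hD : IsOpen D) (hDc : IsConnected D) (hDr : ∀ x ∈ D, 0 < x.2.1 ∧ x.2.2 ≠ 0)
    (hX : IsVariational n p k D X) {z : Jet 2} (hz : base z ∈ D) :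
    2 * (base z).2.1 ^ (n - 1) * (residual n p k z
        * conj (characteristic X (trunc one_le_two z))).re
      = totalT (noetherDensity n p k X) z + totalR (noetherFlux n p k X) z := by
  obtain ⟨a, b, c, d, hab, h⟩ := (isVariational_iff hn hp hp2 hk hD hDc hDr).1 hX
  refine RadialNLS.multiplier_equation hp2 (hDr _ hz) (differentiableAt_of_mem hD hX.1 hz)
    fun v w => ?_
  rw [lieLagrangian_congr hD h hz, lieLagrangian_combination k hp hp2 c d hab (hDr _ hz)]

end Classification

section ConservationLaws

variable {n p k : ℝ}

/-- A pair of functions that agrees up to sign with the Noether density and flux of a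
variational combination of the four generators is a conservation law. -/
lemma yieldsConservationLaw_of_eq (hp : p ≠ 0) (hp2 : p ≠ -2) {a b : ℝ} (c d : ℝ)
    (hab : (a = 0 ∧ b = 0) ∨ n * p = 4) {X : Base → Base} {T Φ : Jet 1 → ℂ}
    (hX : X = d • Xphas + c • Xtrans + b • Xscal p + a • Xinver p)
    (h : ∀ z : Jet 1, 0 < (base z).2.1 → (base z).2.2 ≠ 0 →
      T z = -(noetherDensity n p k X z : ℂ) ∧ Φ z = -(noetherFlux n p k X z : ℂ)) :
    YieldsConservationLaw n p k X T Φ := by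
  have hL : ∀ x : Base, 0 < x.2.1 ∧ x.2.2 ≠ 0 → ∀ v w, lieLagrangian n p k X (x, v, w) = 0 :=
    fun x hx v w => by rw [hX, lieLagrangian_combination k hp hp2 c d hab hx v w]
  replace hX : Differentiable ℝ X := by
    rw [hX]; exact (contDiff_combination p a b c d).differentiable (by simp)
  refine ⟨h, fun z hr hu hres => ?_⟩
  have hz : z ∈ regularJets 2 := ⟨hr, hu⟩
  have hz1 := trunc_mem_regularJets hz
  have hnhds := (isOpen_regularJets 1).mem_nhds hz1
  have dT : DifferentiableAt ℝ (noetherDensity n p k X) (trunc one_le_two z) := by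
    rw [noetherDensity_eq]
    exact (differentiableAt_momentumDensity n hz1 (hX _)).sub
      (differentiableAt_coeff_mul_lagrangian n p k hz1 (f := fun x => (X x).1) (hX _).fst)
  have dR : DifferentiableAt ℝ (noetherFlux n p k X) (trunc one_le_two z) := by
    rw [noetherFlux_eq]
    exact (differentiableAt_momentumFlux n hz1 (hX _)).neg.sub
      (differentiableAt_coeff_mul_lagrangian n p k hz1 (f := fun x => (X x).2.1) (hX _).snd.fst)
  have hof : ∀ {F : Jet 1 → ℂ} {f : Jet 1 → ℝ}, DifferentiableAt ℝ f (trunc one_le_two z) →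
      (∀ z ∈ regularJets 1, F z = -(f z : ℂ)) → ∀ d,
      fderiv ℝ F (trunc one_le_two z) d = -(fderiv ℝ f (trunc one_le_two z) d : ℂ) := by
    intro F f hf hF d
    have e : F =ᶠ[𝓝 (trunc one_le_two z)] fun z => -(f z : ℂ) := by
      filter_upwards [hnhds] with z hz using hF z hz
    rw [e.fderiv_eq]
    exact fderiv_apply_of_line (ofRealCLM.differentiableAt.comp _ hf).neg
      (hasDerivAt_line hf d).ofReal_comp.neg
  have eT : totalT T z = -((totalT (noetherDensity n p k X) z : ℝ) : ℂ) :=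
    hof dT (fun z hz => (h z hz.1 hz.2).1) _
  have eR : totalR Φ z = -((totalR (noetherFlux n p k X) z : ℝ) : ℂ) :=
    hof dR (fun z hz => (h z hz.1 hz.2).2) _
  have hm := multiplier_equation hp2 hz (hX _) (hL _ hz)
  rw [hres] at hm
  simp only [zero_mul, zero_re, mul_zero] at hm
  rw [eT, eR, ← neg_add, ← ofReal_add, ← hm]
  simp

theorem yieldsConservationLaw_Xphas (n k : ℝ) (hp : p ≠ 0) (hp2 : p ≠ -2) :
    YieldsConservationLaw n p k Xphas (chargeDensity n) (chargeFlux n) := by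
  refine yieldsConservationLaw_of_eq (a := 0) (b := 0) hp hp2 0 1 (Or.inl ⟨rfl, rfl⟩) (by simp)
    fun z _ _ => ?_
  refine ⟨Complex.ext ?_ ?_, Complex.ext ?_ ?_⟩
  all_goals
    simp only [chargeDensity, chargeFlux, noetherDensity, noetherFlux, characteristic, Xphas,
      base, lagrangian_eq, lagrangianDensity, ← normSq_eq_norm_sq, normSq_apply]
    simp only [map_sub, map_mul, map_zero, conj_I, sub_re, sub_im, neg_re, neg_im, mul_re, mul_im,
      I_re, I_im, conj_re, conj_im, ofReal_re, ofReal_im, zero_re, zero_im, ofReal_zero]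
    try ring

theorem yieldsConservationLaw_Xtrans (n k : ℝ) (hp : p ≠ 0) (hp2 : p ≠ -2) :
    YieldsConservationLaw n p k Xtrans (energyDensity n p k) (energyFlux n) := by
  refine yieldsConservationLaw_of_eq (a := 0) (b := 0) hp hp2 1 0 (Or.inl ⟨rfl, rfl⟩) (by simp)
    fun z _ _ => ?_
  refine ⟨Complex.ext ?_ ?_, Complex.ext ?_ ?_⟩
  all_goals
    simp only [energyDensity, energyFlux, noetherDensity, noetherFlux, characteristic, Xtrans,
      lagrangian_eq, lagrangianDensity, ← normSq_eq_norm_sq, normSq_apply, add_comm 2 p]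
    simp only [map_sub, map_mul, map_zero, map_one, add_re, add_im, sub_re, sub_im, neg_re, neg_im,
      mul_re, mul_im, I_re, I_im, conj_re, conj_im, ofReal_re, ofReal_im, zero_re, zero_im, one_re,
      one_im, ofReal_zero, ofReal_one]
    ring

theorem yieldsConservationLaw_Xscal (n k : ℝ) (hp : p ≠ 0) (hp2 : p ≠ -2) (hnp : n * p = 4) :
    YieldsConservationLaw n p k (Xscal p) (dilationDensity n p k) (dilationFlux n p k) := by
  refine yieldsConservationLaw_of_eq (a := 0) (b := 1) hp hp2 0 0 (Or.inr hnp) (by simp)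
    fun z hr _ => ?_
  have hr0 : z.2.1 ≠ 0 := hr.ne'
  have h2 : (1 / 2 : ℂ) = ((1 / 2 : ℝ) : ℂ) := by norm_num
  have r1 : z.2.1 ^ n = z.2.1 ^ (n - 1) * z.2.1 := by
    rw [Real.rpow_sub_one hr0]; field_simp
  refine ⟨Complex.ext ?_ ?_, Complex.ext ?_ ?_⟩
  all_goals
    simp only [dilationDensity, dilationFlux, noetherDensity, noetherFlux, characteristic, Xscal,
      base, lagrangian_eq, lagrangianDensity, ← normSq_eq_norm_sq, normSq_apply, r1, h2,
      add_comm 2 p]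
    simp only [map_sub, map_mul, map_neg, conj_ofReal, add_re, add_im, sub_re, sub_im,
      neg_re, neg_im, mul_re, mul_im, I_re, I_im, conj_re, conj_im, ofReal_re, ofReal_im]
    ring

theorem yieldsConservationLaw_Xinver (n k : ℝ) (hp : p ≠ 0) (hp2 : p ≠ -2) (hnp : n * p = 4) :
    YieldsConservationLaw n p k (Xinver p) (pseudoConformalDensity n p k)
      (pseudoConformalFlux n p k) := by
  refine yieldsConservationLaw_of_eq (a := 1) (b := 0) hp hp2 0 0 (Or.inr hnp) (by simp)
    fun z hr _ => ?_
  have hr0 : z.2.1 ≠ 0 := hr.ne'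
  have h2 : (1 / 2 : ℂ) = ((1 / 2 : ℝ) : ℂ) := by norm_num
  have h4 : (1 / 4 : ℂ) = ((1 / 4 : ℝ) : ℂ) := by norm_num
  have r1 : z.2.1 ^ n = z.2.1 ^ (n - 1) * z.2.1 := by
    rw [Real.rpow_sub_one hr0]; field_simp
  have r2 : z.2.1 ^ (n + 1) = z.2.1 ^ (n - 1) * z.2.1 ^ 2 := by
    rw [Real.rpow_add_one hr0, r1]; ring
  refine ⟨Complex.ext ?_ ?_, Complex.ext ?_ ?_⟩
  all_goals
    simp only [pseudoConformalDensity, pseudoConformalFlux, noetherDensity, noetherFlux,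
      characteristic, Xinver, base, lagrangian_eq, lagrangianDensity, ← normSq_eq_norm_sq,
      normSq_apply, r1, r2, h2, h4, add_comm 2 p]
    simp only [map_sub, map_mul, map_neg, conj_ofReal, map_add, conj_I, add_re, add_im, sub_re,
      sub_im, neg_re, neg_im, mul_re, mul_im, I_re, I_im, conj_re, conj_im, ofReal_re, ofReal_im]
    ring

end ConservationLaws

end RadialNLS

theorem mainTheorem7 (n p k : ℝ) (hn : n ≠ 1) (hp : p ≠ 0) (hp2 : p ≠ -2) (hk : k ≠ 0)
    (D : Set RadialNLS.Base) (hDopen : IsOpen D) (hDconn : IsConnected D)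
    (hD : ∀ x ∈ D, 0 < x.2.1 ∧ x.2.2 ≠ 0) :
    (p ≠ 4 / n → ∀ X : RadialNLS.Base → RadialNLS.Base,
      (RadialNLS.IsVariational n p k D X ↔
        ∃ Y ∈ Submodule.span ℝ {RadialNLS.Xphas, RadialNLS.Xtrans}, Set.EqOn X Y D)) ∧
    (p = 4 / n → ∀ X : RadialNLS.Base → RadialNLS.Base,
      (RadialNLS.IsVariational n p k D X ↔
        ∃ Y ∈ Submodule.span ℝ {RadialNLS.Xphas, RadialNLS.Xtrans,
          RadialNLS.Xscal p, RadialNLS.Xinver p}, Set.EqOn X Y D)) ∧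
    (∀ X : RadialNLS.Base → RadialNLS.Base, RadialNLS.IsVariational n p k D X →
      ∀ z : RadialNLS.Jet 2, RadialNLS.base z ∈ D →
        2 * (RadialNLS.base z).2.1 ^ (n - 1) *
            (RadialNLS.residual n p k z * (starRingEnd ℂ)
              (RadialNLS.characteristic X (RadialNLS.trunc one_le_two z))).re
          = RadialNLS.totalT (RadialNLS.noetherDensity n p k X) z
            + RadialNLS.totalR (RadialNLS.noetherFlux n p k X) z ∧
        (RadialNLS.residual n p k z = 0 →
          RadialNLS.totalT (RadialNLS.noetherDensity n p k X) z
            + RadialNLS.totalR (RadialNLS.noetherFlux n p k X) z = 0)) ∧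
    RadialNLS.YieldsConservationLaw n p k RadialNLS.Xphas
      (RadialNLS.chargeDensity n) (RadialNLS.chargeFlux n) ∧
    RadialNLS.YieldsConservationLaw n p k RadialNLS.Xtrans
      (RadialNLS.energyDensity n p k) (RadialNLS.energyFlux n) ∧
    (p = 4 / n →
      RadialNLS.YieldsConservationLaw n p k (RadialNLS.Xscal p)
        (RadialNLS.dilationDensity n p k) (RadialNLS.dilationFlux n p k) ∧
      RadialNLS.YieldsConservationLaw n p k (RadialNLS.Xinver p)
        (RadialNLS.pseudoConformalDensity n p k) (RadialNLS.pseudoConformalFlux n p k)) := by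
  have hiff := RadialNLS.mul_eq_four_iff (n := n) hp
  have hvar := fun X => RadialNLS.isVariational_iff (X := X) hn hp hp2 hk hDopen hDconn hD
  refine ⟨fun hpn X => ?_, fun hpn X => ?_, fun X hX z hz => ?_,
    RadialNLS.yieldsConservationLaw_Xphas n k hp hp2,
    RadialNLS.yieldsConservationLaw_Xtrans n k hp hp2, fun hpn =>
    ⟨RadialNLS.yieldsConservationLaw_Xscal n k hp hp2 (hiff.2 hpn),
      RadialNLS.yieldsConservationLaw_Xinver n k hp hp2 (hiff.2 hpn)⟩⟩
  · rw [hvar]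
    constructor
    · rintro ⟨a, b, c, d, hab, h⟩
      obtain ⟨rfl, rfl⟩ := hab.resolve_right fun h => hpn (hiff.1 h)
      exact ⟨_, Submodule.mem_span_pair.2 ⟨d, c, rfl⟩, by simpa using h⟩
    · rintro ⟨Y, hY, h⟩
      obtain ⟨d, c, rfl⟩ := Submodule.mem_span_pair.1 hY
      exact ⟨0, 0, c, d, Or.inl ⟨rfl, rfl⟩, by simpa using h⟩
  · rw [hvar]
    constructor
    · rintro ⟨a, b, c, d, -, h⟩
      refine ⟨_, ?_, h⟩
      have hmem := fun Z hZ => Submodule.subset_span (R := ℝ) (s := {RadialNLS.Xphas,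
        RadialNLS.Xtrans, RadialNLS.Xscal p, RadialNLS.Xinver p}) (a := Z) hZ
      exact add_mem (add_mem (add_mem (Submodule.smul_mem _ d (hmem _ (by simp)))
        (Submodule.smul_mem _ c (hmem _ (by simp)))) (Submodule.smul_mem _ b (hmem _ (by simp))))
        (Submodule.smul_mem _ a (hmem _ (by simp)))
    · rintro ⟨Y, hY, h⟩
      obtain ⟨d, Y₁, hY₁, rfl⟩ := Submodule.mem_span_insert.1 hY
      obtain ⟨c, Y₂, hY₂, rfl⟩ := Submodule.mem_span_insert.1 hY₁
      obtain ⟨b, a, rfl⟩ := Submodule.mem_span_pair.1 hY₂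
      exact ⟨a, b, c, d, Or.inr (hiff.2 hpn), by simpa only [add_assoc] using h⟩
  · have h := hX.multiplier_equation hn hp hp2 hk hDopen hDconn hD hz
    refine ⟨h, fun hres => ?_⟩
    rw [← h, hres]
    simp
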